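/- **Setting.** Fix integers $N$ (nodes) and $r$ (factors). For each number of layers $m>r$ and each date $t=0,1,2,\dots$ an $N\times N\times m$ tensor $\mathcal W_t=\mathcal F_t\times_3U+\mathcal E_t$ is observed; with mode-3 unfoldings, $\mathcal W_{(3)t}=U\mathcal F_{(3)t}+\mathcal E_{(3)t}$, where $U$ is a nonrandom $m\times r$ matrix. $\mathcal W_t,\mathcal E_t,U$ depend on $m$; the square-integrable factors $\mathcal F_t$, with frontal slices $F_{1,t},\dots,F_{r,t}$ of size $N\times N$, do not. The $N$-vectors $y_t$ satisfy, for $t\ge1$, with $P=\mathrm{diag}(\rho_1,\dots,\rho_N)$, $$y_t=\sum_{k=1}^r\beta_kF_{k,t-1}y_{t-1}+Py_{t-1}+\alpha+\nu_t=X_t\theta+\nu_t,$$ $$X_t=\bigl(F_{1,t-1}y_{t-1},\dots,F_{r,t-1}y_{t-1},\ \mathrm{diag}(y_{t-1}),\ I_N\bigr),\qquad \theta=(\beta',\rho',\alpha')',$$ and do not depend on $m$. $\|\cdot\|$ is the Frobenius norm on matrices. **Assumptions** (those stated for each $m$ need hold only for all large $m$). 1. $\mathcal W_{(3)t}=\chi_t+\mathcal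 E_{(3)t}$, where $\Gamma^\chi=E(\chi_t\chi_t')$ does not depend on $t$. If $\mu_1^\chi\ge\mu_2^\chi\ge\dots$ are the eigenvalues of $\Gamma^\chi$, $M^\chi=\mathrm{diag}(\mu_1^\chi,\dots,\mu_r^\chi)$ and $V^\chi$ is a matrix of corresponding orthonormal eigenvectors, then $\mathcal F_{(3)t}=(M^\chi)^{-1/2}V^{\chi\prime}\chi_t$ and $U=V^\chi(M^\chi)^{1/2}$. 2. $E\,\mathcal E_{(3)t}=0$ and $E\|\mathcal E_{(3)t}\|^4<\infty$. 3. $E[\mathcal E_{(3)t}\mathcal F_{(3)t}']=0$. 4. There are constants $\underline c_j,\overline c_j$ with $\underline c_j>\overline c_{j+1}$ for $j<r$ and $0<\underline c_j<\liminf_m\mu_j^\chi/m\le\limsup_m\mu_j^\chi/m<\overline c_j<\infty$ for $j\le r$. 5. The largest eigenvalue of $E[\mathcal E_{(3)t}\mathcal E_{(3)t}']$ is at most a constant $\lambda$, for all $m,t$. 6. $\Gamma^{\mathcal W}=E[\mathcal W_{(3)t}\mathcal W_{(3)t}']$ does not depend on $t$, and $\widehat\Gamma^{\mathcal W}=T^{-1}\sum_{t=1}^T\mathcal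 W_{(3)t}\mathcal W_{(3)t}'$ satisfies $T\,E[(\widehat\gamma_{ij}-\gamma_{ij})^2]<R<\infty$ with a constant $R$, for all $m$, $T\ge1$ and $i,j\le m$. 7. $E\|X_t\|^8\le M<\infty$ for all $t\ge1$. 8. $T^{-1/2}\sum_{t=1}^TX_t'\nu_t\to N(0,\Sigma_{X\nu})$ in distribution as $T\to\infty$, where $\Sigma_{X\nu}=\operatorname{plim}T^{-1}\sum_{t=1}^TX_t'\nu_t\nu_t'X_t$. 9. $E(\nu_t\mid X_t)=0$, and $X_t$ and $\nu_t$ are independent of $\mathcal E_s$ for all $s$. 10. (No asymptotic collinearity of the true regressors.) The smallest eigenvalue of $T^{-1}\sum_{t=1}^TX_t'X_t$ is bounded away from $0$ in probability: for each $\varepsilon>0$ there is $c>0$ such that it is at least $c$ with probability at least $1-\varepsilon$ for all large $T$. **Estimators.** Let $\widehat M$ be the diagonal matrix of the $r$ largest eigenvalues of $\widehat\Gamma^{\mathcal W}$ in decreasing order and $\widehat V$ any $m\times r$ matrix of corresponding orthonormal eigenvectors; $\widehat U=\widehat V\widehat M^{1/2}$ and $\widehat{\mathcal F}_{(3)t}=\widehat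 M^{-1/2}\widehat V'\mathcal W_{(3)t}$. Let $\widehat X_t$ be $X_t$ with $\widehat{\mathcal F}_{t-1}$ in place of $\mathcal F_{t-1}$, and $\widehat\theta=\bigl(\sum_{t=1}^T\widehat X_t'\widehat X_t\bigr)^{-1}\sum_{t=1}^T\widehat X_t'y_t$. **Conclusion.** As $m,T\to\infty$ jointly: there are random diagonal matrices $\widehat{\mathcal J}_r$ with diagonal entries $\pm1$ such that $$\tfrac1{\sqrt m}\|\widehat U-U\widehat{\mathcal J}_r\|=O_p\bigl(\max(T^{-1/2},m^{-1})\bigr),\qquad \|\widehat{\mathcal F}_{(3)t}-\widehat{\mathcal J}_r\mathcal F_{(3)t}\|=O_p\bigl(\max(T^{-1/2},m^{-1/2})\bigr)\ \text{for each } t;$$ $\sum_{t=1}^T\widehat X_t'\widehat X_t$ is invertible with probability tending to $1$; and for every such $\widehat{\mathcal J}_r$ the estimator $\widehat\theta$ is consistent for $\theta^*=(\beta'\widehat{\mathcal J}_r,\rho',\alpha')'$, i.e. $\widehat\theta-\theta^*\to0$ in probability. -/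

import Mathlib

open MeasureTheory ProbabilityTheory Filter
open scoped Matrix Topology ENNReal Matrix.Norms.Frobenius

/-- The product sigma-algebra on real matrices. -/
instance FNAR.matrixMeasurableSpace {ι κ : Type*} : MeasurableSpace (Matrix ι κ ℝ) :=
  MeasurableSpace.pi

namespace FNAR

/-- The mode-3 unfolding of a real `N × N × d` tensor: row `k` lists the entries `(i, j)` of the
`k`-th frontal slice. A tensor is identified with this unfolding. -/
abbrev Tensor3 (N d : ℕ) : Type := Matrix (Fin d) (Fin N × Fin N) ℝ

/-- The `k`-th frontal slice of a tensor, an `N × N` matrix. -/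
def slice {N d : ℕ} (A : Tensor3 N d) (k : Fin d) : Matrix (Fin N) (Fin N) ℝ :=
  Matrix.of fun i j => A k (i, j)

/-- The matrix of expectations `E(A B')`. -/
noncomputable def crossMoment {Ω : Type*} [MeasurableSpace Ω] (μ : Measure Ω) {ι κ π : Type*}
    [Fintype π] (A : Ω → Matrix ι π ℝ) (B : Ω → Matrix κ π ℝ) : Matrix ι κ ℝ :=
  Matrix.of fun i k => ∫ ω, (A ω * (B ω)ᵀ) i k ∂μ

/-- The sample second moment `T⁻¹ ∑_{t=1}^T A_t A_t'`. -/
noncomputable def sampleMoment {ι π : Type*} [Fintype π] (A : ℕ → Matrix ι π ℝ) (T : ℕ) :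
    Matrix ι ι ℝ :=
  (T : ℝ)⁻¹ • ∑ t ∈ Finset.Icc 1 T, A t * (A t)ᵀ

/-- The eigenvalue number `j` (counted from `0`, with multiplicity, in decreasing order) of a real
symmetric `m × m` matrix. -/
noncomputable def eig {m : ℕ} (A : Matrix (Fin m) (Fin m) ℝ) (j : ℕ) : ℝ :=
  open Classical in
  if h : A.IsHermitian ∧ j < Fintype.card (Fin m) then h.1.eigenvalues₀ ⟨j, h.2⟩ else 0

/-- The columns of `V` are orthonormal eigenvectors of `A` that belong to its `r` largest
eigenvalues, in decreasing order. -/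
structure IsTopEigenvectors {m r : ℕ} (A : Matrix (Fin m) (Fin m) ℝ)
    (V : Matrix (Fin m) (Fin r) ℝ) : Prop where
  orthonormal : Vᵀ * V = 1
  eigen : A * V = V * Matrix.diagonal (fun j : Fin r => eig A j)

/-- `M^{1/2}`, where `M` is the diagonal matrix of the `r` largest eigenvalues of `A`. -/
noncomputable def eigSqrt {m : ℕ} (r : ℕ) (A : Matrix (Fin m) (Fin m) ℝ) :
    Matrix (Fin r) (Fin r) ℝ :=
  Matrix.diagonal fun j : Fin r => √(eig A j)

/-- `M^{-1/2}`, where `M` is the diagonal matrix of the `r` largest eigenvalues of `A`. -/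
noncomputable def eigInvSqrt {m : ℕ} (r : ℕ) (A : Matrix (Fin m) (Fin m) ℝ) :
    Matrix (Fin r) (Fin r) ℝ :=
  Matrix.diagonal fun j : Fin r => (√(eig A j))⁻¹

/-- Index set of the `r + 2N` regressors and parameters `(β, ρ, α)`. -/
abbrev Param (r N : ℕ) : Type := Fin r ⊕ (Fin N ⊕ Fin N)

/-- The parameter vector `(β, ρ, α)`. -/
def param {r N : ℕ} (β : Fin r → ℝ) (ρ α : Fin N → ℝ) : Param r N → ℝ :=
  Sum.elim β (Sum.elim ρ α)

/-- The regressor matrix `(F₁ y, …, F_r y, diag(y), I_N)`. -/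
def regressor {N r : ℕ} (F : Tensor3 N r) (y : Fin N → ℝ) : Matrix (Fin N) (Param r N) ℝ :=
  Matrix.fromCols (Matrix.of fun i k => (slice F k *ᵥ y) i)
    (Matrix.fromCols (Matrix.diagonal y) 1)

/-- `X_t`, the regressor matrix at date `t ≥ 1`, built from the factors and `y` at date `t - 1`. -/
def X {N r : ℕ} (F : ℕ → Tensor3 N r) (y : ℕ → Fin N → ℝ) (t : ℕ) :
    Matrix (Fin N) (Param r N) ℝ :=
  regressor (F (t - 1)) (y (t - 1))

/-- `∑_{t=1}^T X_t' X_t`. -/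
def gram {N r : ℕ} (X : ℕ → Matrix (Fin N) (Param r N) ℝ) (T : ℕ) :
    Matrix (Param r N) (Param r N) ℝ :=
  ∑ t ∈ Finset.Icc 1 T, (X t)ᵀ * X t

/-- The OLS estimator `(∑ X_t' X_t)⁻¹ ∑ X_t' y_t`. -/
noncomputable def ols {N r : ℕ} (X : ℕ → Matrix (Fin N) (Param r N) ℝ) (y : ℕ → Fin N → ℝ)
    (T : ℕ) : Param r N → ℝ :=
  (gram X T)⁻¹ *ᵥ ∑ t ∈ Finset.Icc 1 T, (X t)ᵀ *ᵥ y t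

/-- The estimated loadings `Û = V̂ M̂^{1/2}`, for a matrix `V̂` of eigenvectors of the sample second
moment of the observed tensors. -/
noncomputable def loadingsHat {N m r : ℕ} (W : ℕ → Tensor3 N m) (Vhat : Matrix (Fin m) (Fin r) ℝ)
    (T : ℕ) : Matrix (Fin m) (Fin r) ℝ :=
  Vhat * eigSqrt r (sampleMoment W T)

/-- The estimated factors `F̂_t = M̂^{-1/2} V̂' W_t`. -/
noncomputable def factorsHat {N m r : ℕ} (W : ℕ → Tensor3 N m) (Vhat : Matrix (Fin m) (Fin r) ℝ)
    (T t : ℕ) : Tensor3 N r :=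
  eigInvSqrt r (sampleMoment W T) * Vhatᵀ * W t

/-- `f = O_p(a)` along the filter `l`. -/
def IsBigOp {Ω ι E : Type*} [MeasurableSpace Ω] [Norm E] (μ : Measure Ω) (f : ι → Ω → E)
    (a : ι → ℝ) (l : Filter ι) : Prop :=
  ∀ ε : ℝ, 0 < ε → ∃ K : ℝ, ∀ᶠ i in l, μ {ω | K * a i < ‖f i ω‖} ≤ ENNReal.ofReal ε

/-- `J` is a (random) choice of signs up to which loadings and factors are consistently estimated:
a diagonal `r × r` matrix (given by its diagonal) with entries `1` or `-1` such that
`m^{-1/2} ‖Û - U J‖ = O_p(max(T^{-1/2}, m^{-1}))` and, for each `t`,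
`‖F̂_t - J F_t‖ = O_p(max(T^{-1/2}, m^{-1/2}))`, as `m, T → ∞` jointly. -/
structure IsSignMatrix {Ω : Type*} [MeasurableSpace Ω] (μ : Measure Ω) {N r : ℕ}
    (W : (m : ℕ) → ℕ → Ω → Tensor3 N m) (U : (m : ℕ) → Matrix (Fin m) (Fin r) ℝ)
    (F : ℕ → Ω → Tensor3 N r) (Vhat : (m : ℕ) → ℕ → Ω → Matrix (Fin m) (Fin r) ℝ)
    (J : ℕ → ℕ → Ω → Fin r → ℝ) : Prop where
  sign : ∀ m T ω k, J m T ω k = 1 ∨ J m T ω k = -1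
  loadings : IsBigOp μ
    (fun (p : ℕ × ℕ) ω => (√(p.1 : ℝ))⁻¹ *
      ‖loadingsHat (fun s => W p.1 s ω) (Vhat p.1 p.2 ω) p.2 -
        U p.1 * Matrix.diagonal (J p.1 p.2 ω)‖)
    (fun p => max (√(p.2 : ℝ))⁻¹ (p.1 : ℝ)⁻¹) (atTop ×ˢ atTop)
  factors : ∀ t, IsBigOp μ
    (fun (p : ℕ × ℕ) ω =>
      factorsHat (fun s => W p.1 s ω) (Vhat p.1 p.2 ω) p.2 t -
        Matrix.diagonal (J p.1 p.2 ω) * F t ω)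
    (fun p => max (√(p.2 : ℝ))⁻¹ (√(p.1 : ℝ))⁻¹) (atTop ×ˢ atTop)

/-- `X̂_t`, the regressor matrix with the estimated factors in place of the true ones. -/
noncomputable def Xhat {N m r : ℕ} (W : ℕ → Tensor3 N m) (y : ℕ → Fin N → ℝ)
    (Vhat : Matrix (Fin m) (Fin r) ℝ) (T : ℕ) : ℕ → Matrix (Fin N) (Param r N) ℝ :=
  X (factorsHat W Vhat T) y

/-- The estimator `θ̂`: OLS of `y_t` on `X̂_t`, `t = 1, …, T`. -/
noncomputable def thetaHat {N m r : ℕ} (W : ℕ → Tensor3 N m) (y : ℕ → Fin N → ℝ)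
    (Vhat : Matrix (Fin m) (Fin r) ℝ) (T : ℕ) : Param r N → ℝ :=
  ols (Xhat W y Vhat T) y T

/-- `θ* = (β' J, ρ, α)'`, for the diagonal matrix `J` with the given diagonal. -/
def thetaStar {r N : ℕ} (β : Fin r → ℝ) (ρ α : Fin N → ℝ) (J : Fin r → ℝ) : Param r N → ℝ :=
  param (β ᵥ* Matrix.diagonal J) ρ α

end FNAR

/-! Three ingredients carry the argument: spectral perturbation, exact algebra for the
principal-component filter, and a deterministic least-squares inequality. Probability enters only
through Markov's inequality, independence and tightness.

The normalization forces `E(FF') = 1`. Hence `Γχ = UU'` has rank `r`, with top eigenvalues of order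
`m` separated by gaps of order `m`, and `ΓW - Γχ = E(EE')` is positive semidefinite with eigenvalues
at most `lam`. The sample matrix differs from `ΓW` by a Frobenius norm of order `m T^{-1/2}`. Its
distance from `Γχ`, divided by `m`, is therefore of order `max(T^{-1/2}, m^{-1})`
(`isBigOp_covarianceError`). Weyl's inequality (`eig_le_eig_add`) and an eigenvector bound
(`exists_sign_dotProduct_sub_le`) turn this into the rate for the loadings.

For the factors, the filter `M̂^{-1/2}V̂'` maps `Û` to the identity, so its error on the signal is
linear in `Û - UJ`. It also equals `M̂^{-1}Û'`, so on the noise it produces `U'E / m`, of order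
`m^{-1/2}` because the noise covariance is bounded, and a product of the loading error with `‖E‖ /
√m` (`norm_factor_sub_le`).

Rates at each fixed date say nothing about averages over a growing number of dates. The regressor
error is therefore bounded by the loading error or `m^{-1}`, common to all dates, times time
averages. Independence of regressors and layer errors bounds the expectations of these averages
(`isBigOp_regressorError`). A small mean-square error preserves non-collinearity, and the normal
equations bound the estimation error by the score of the true regressors, which the central limit
theorem makes tight, plus terms that vanish with the regressor error (`norm_ols_sub_le`). Any signs
with the loading rate fit into this argument. -/

namespace FNAR

/-! ### Ordered eigenvalues and Weyl's inequality. -/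

section Spectral

variable {m : ℕ} {A B : Matrix (Fin m) (Fin m) ℝ}

lemma eig_antitone (A : Matrix (Fin m) (Fin m) ℝ) {i j : ℕ} (hij : i ≤ j) (hj : j < m) :
    eig A j ≤ eig A i := by
  unfold eig
  by_cases hA : A.IsHermitian
  · have hj' : j < Fintype.card (Fin m) := by simpa using hj
    rw [dif_pos ⟨hA, hj'⟩, dif_pos ⟨hA, lt_of_le_of_lt hij hj'⟩]
    exact hA.eigenvalues₀_antitone (by simpa using hij)
  · rw [dif_neg (fun h => hA h.1), dif_neg (fun h => hA h.1)]

/-- The spectral theorem, with the eigenvalues in decreasing order. -/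
lemma exists_orthogonal_diagonalization (hA : A.IsHermitian) :
    ∃ Q : Matrix (Fin m) (Fin m) ℝ, Qᵀ * Q = 1 ∧
      A = Q * Matrix.diagonal (fun j : Fin m => eig A j) * Qᵀ := by
  let e : Fin (Fintype.card (Fin m)) ≃ Fin m :=
    Fintype.equivOfCardEq (Fintype.card_fin _)
  let s : Fin m ≃ Fin m := (finCongr (Fintype.card_fin m).symm).trans e
  let P : Matrix (Fin m) (Fin m) ℝ := (hA.eigenvectorUnitary : Matrix (Fin m) (Fin m) ℝ)
  have hPP : Pᵀ * P = 1 := by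
    have h := Unitary.coe_star_mul_self hA.eigenvectorUnitary
    rwa [Matrix.star_eq_conjTranspose, Matrix.conjTranspose_eq_transpose_of_trivial] at h
  have hev : ∀ j : Fin m, hA.eigenvalues (s j) = eig A j := by
    intro j
    have hj : (j : ℕ) < Fintype.card (Fin m) := by simp
    unfold eig
    rw [dif_pos ⟨hA, hj⟩]
    change hA.eigenvalues₀ (e.symm (s j)) = _
    simp only [s, Equiv.trans_apply, Equiv.symm_apply_apply]
    rfl
  have hsp : A = P * Matrix.diagonal hA.eigenvalues * Pᵀ := by
    have h := hA.spectral_theorem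
    rw [Unitary.conjStarAlgAut_apply] at h
    rw [Matrix.star_eq_conjTranspose, Matrix.conjTranspose_eq_transpose_of_trivial] at h
    exact h
  refine ⟨P.submatrix id s, ?_, ?_⟩
  · have : (P.submatrix id s)ᵀ * P.submatrix id s = (Pᵀ * P).submatrix s s := by
      ext i j; simp [Matrix.mul_apply]
    rw [this, hPP]; simp
  · have hd : Matrix.diagonal (fun j : Fin m => eig A j)
        = (Matrix.diagonal hA.eigenvalues).submatrix s s := by
      ext i j
      by_cases hij : i = j
      · subst hij; simp [hev]
      · simp [hij]
    have ht : (P.submatrix id s)ᵀ = Pᵀ.submatrix s id := rfl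
    rw [hd, ht, Matrix.submatrix_mul_equiv, Matrix.submatrix_mul_equiv, ← hsp]
    simp

lemma dotProduct_mulVec_diagonalization {Q : Matrix (Fin m) (Fin m) ℝ} {d : Fin m → ℝ}
    (hA : A = Q * Matrix.diagonal d * Qᵀ) (x : Fin m → ℝ) :
    x ⬝ᵥ (A *ᵥ x) = ∑ i, d i * (Qᵀ *ᵥ x) i ^ 2 := by
  have : A *ᵥ x = Q *ᵥ (Matrix.diagonal d *ᵥ (Qᵀ *ᵥ x)) := by
    rw [hA]; simp [Matrix.mulVec_mulVec, Matrix.mul_assoc]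
  rw [this, Matrix.dotProduct_mulVec, ← Matrix.mulVec_transpose, dotProduct]
  refine Finset.sum_congr rfl fun i _ => ?_
  rw [Matrix.mulVec_diagonal]; ring

lemma dotProduct_self_orthogonal {Q : Matrix (Fin m) (Fin m) ℝ} (hQ : Qᵀ * Q = 1)
    (x : Fin m → ℝ) : x ⬝ᵥ x = ∑ i, (Qᵀ *ᵥ x) i ^ 2 := by
  have h := dotProduct_mulVec_diagonalization (A := 1) (Q := Q) (d := fun _ => 1)
    (by simp [mul_eq_one_comm.mp hQ]) x
  simpa using h

/-- The largest eigenvalue bounds the quadratic form. -/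
lemma dotProduct_mulVec_le_eig_zero (hA : A.IsHermitian) (x : Fin m → ℝ) :
    x ⬝ᵥ (A *ᵥ x) ≤ eig A 0 * (x ⬝ᵥ x) := by
  obtain ⟨Q, hQ, hd⟩ := exists_orthogonal_diagonalization hA
  rw [dotProduct_mulVec_diagonalization hd, dotProduct_self_orthogonal hQ, Finset.mul_sum]
  refine Finset.sum_le_sum fun i _ => ?_
  exact mul_le_mul_of_nonneg_right (eig_antitone A (Nat.zero_le _) i.2) (sq_nonneg _)

/-- **Weyl's inequality** for ordered eigenvalues. -/
lemma eig_le_eig_add (hA : A.IsHermitian) (hB : B.IsHermitian) {d : ℝ}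
    (h : ∀ x : Fin m → ℝ, x ⬝ᵥ ((A - B) *ᵥ x) ≤ d * (x ⬝ᵥ x)) {j : ℕ} (hj : j < m) :
    eig A j ≤ eig B j + d := by
  obtain ⟨Q, hQ, hdA⟩ := exists_orthogonal_diagonalization hA
  obtain ⟨P, hP, hdB⟩ := exists_orthogonal_diagonalization hB
  -- Courant–Fischer by dimension count: a vector of the kernel gives a nonzero `x` in the span of
  -- the first `j + 1` eigenvectors of `A` that is orthogonal to the first `j` eigenvectors of `B`.
  -- At this `x` the form of `A` is at least `eig A j` and that of `B` at most `eig B j`, relative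
  -- to `x ⬝ᵥ x`.
  let L : (Fin (j + 1) → ℝ) →ₗ[ℝ] (Fin j → ℝ) :=
    Matrix.mulVecLin ((Pᵀ * Q).submatrix (Fin.castLE hj.le) (Fin.castLE hj))
  have hker : LinearMap.ker L ≠ ⊥ := LinearMap.ker_ne_bot_of_finrank_lt (by simp)
  obtain ⟨a, haL, ha0⟩ := (Submodule.ne_bot_iff _).mp hker
  let a' : Fin m → ℝ := fun i => if hi : (i : ℕ) < j + 1 then a ⟨i, hi⟩ else 0
  have ha'cast : ∀ i : Fin (j + 1), a' (Fin.castLE hj i) = a i := by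
    intro i; simp only [a', Fin.val_castLE, i.2, dif_pos]
  have ha'0 : ∀ i : Fin m, ¬ (i : ℕ) < j + 1 → a' i = 0 := by
    intro i hi; simp only [a', hi, dif_neg, not_false_iff]
  have hsum : ∀ f : Fin m → ℝ, ∑ i, f i * a' i = ∑ i : Fin (j + 1), f (Fin.castLE hj i) * a i := by
    intro f
    symm
    refine Finset.sum_of_injOn (Fin.castLE hj) (Fin.castLE_injective hj).injOn
      (fun _ _ => Finset.mem_coe.2 (Finset.mem_univ _)) ?_ (fun i _ => by rw [ha'cast])
    intro i _ hi
    rw [ha'0 i, mul_zero]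
    intro hlt
    exact hi ⟨⟨i, hlt⟩, by simp, rfl⟩
  let x := Q *ᵥ a'
  have hQx : Qᵀ *ᵥ x = a' := by simp [x, Matrix.mulVec_mulVec, hQ]
  have hPx : ∀ i : Fin m, (i : ℕ) < j → (Pᵀ *ᵥ x) i = 0 := by
    intro i hi
    have h1 : (Pᵀ *ᵥ x) i = ∑ k, (Pᵀ * Q) i k * a' k := by
      simp only [x, Matrix.mulVec_mulVec]
      rfl
    rw [h1, hsum]
    exact congrFun (LinearMap.mem_ker.mp haL) ⟨i, hi⟩
  have hxA : eig A j * (x ⬝ᵥ x) ≤ x ⬝ᵥ (A *ᵥ x) := by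
    rw [dotProduct_mulVec_diagonalization hdA, dotProduct_self_orthogonal hQ, Finset.mul_sum, hQx]
    refine Finset.sum_le_sum fun i _ => ?_
    by_cases hi : (i : ℕ) < j + 1
    · exact mul_le_mul_of_nonneg_right (eig_antitone A (by omega) hj) (sq_nonneg _)
    · simp [ha'0 i hi]
  have hxB : x ⬝ᵥ (B *ᵥ x) ≤ eig B j * (x ⬝ᵥ x) := by
    rw [dotProduct_mulVec_diagonalization hdB, dotProduct_self_orthogonal hP, Finset.mul_sum]
    refine Finset.sum_le_sum fun i _ => ?_
    by_cases hi : (i : ℕ) < j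
    · simp [hPx i hi]
    · exact mul_le_mul_of_nonneg_right (eig_antitone B (by omega) i.2) (sq_nonneg _)
  have hpos : 0 < x ⬝ᵥ x := by
    rw [dotProduct_self_orthogonal hQ, hQx]
    obtain ⟨k, hk⟩ := Function.ne_iff.mp ha0
    refine Finset.sum_pos' (fun i _ => sq_nonneg _) ⟨Fin.castLE hj k, Finset.mem_univ _, ?_⟩
    rw [ha'cast]
    exact (sq_pos_iff).2 hk
  have h' := h x
  rw [Matrix.sub_mulVec, dotProduct_sub] at h'
  nlinarith

end Spectral

/-! ### Perturbation of eigenvectors and loadings. -/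

section Perturbation

lemma frobenius_norm_sq {ι κ : Type*} [Fintype ι] [Fintype κ] (A : Matrix ι κ ℝ) :
    ‖A‖ ^ 2 = ∑ i, ∑ j, A i j ^ 2 := by
  have h0 : 0 ≤ ∑ i, ∑ j, A i j ^ 2 :=
    Finset.sum_nonneg fun _ _ => Finset.sum_nonneg fun _ _ => sq_nonneg _
  have h : ‖A‖ = √(∑ i, ∑ j, A i j ^ 2) := by
    rw [Matrix.frobenius_norm_def, Real.sqrt_eq_rpow]
    simp
  rw [h, Real.sq_sqrt h0]

lemma dotProduct_self_nonneg_real {ι : Type*} [Fintype ι] (x : ι → ℝ) : 0 ≤ x ⬝ᵥ x :=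
  Finset.sum_nonneg fun _ _ => mul_self_nonneg _

lemma dotProduct_self_add_le {ι : Type*} [Fintype ι] (x y : ι → ℝ) :
    (x + y) ⬝ᵥ (x + y) ≤ 2 * (x ⬝ᵥ x) + 2 * (y ⬝ᵥ y) := by
  have h := dotProduct_self_nonneg_real (x - y)
  simp only [sub_dotProduct, dotProduct_sub, add_dotProduct, dotProduct_add] at h ⊢
  linarith

variable {m r : ℕ} {G S : Matrix (Fin m) (Fin m) ℝ} {V Vh : Matrix (Fin m) (Fin r) ℝ}

lemma IsTopEigenvectors.dotProduct_col (hV : IsTopEigenvectors S V) (i j : Fin r) :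
    V.col i ⬝ᵥ V.col j = if i = j then 1 else 0 := by
  have h := congrFun (congrFun hV.orthonormal i) j
  rw [Matrix.one_apply] at h
  exact h

lemma IsTopEigenvectors.mulVec_col (hV : IsTopEigenvectors S V) (j : Fin r) :
    S *ᵥ V.col j = eig S j • V.col j := by
  ext i
  have h := congrFun (congrFun hV.eigen i) j
  rw [Matrix.mul_diagonal] at h
  rw [Pi.smul_apply, smul_eq_mul, mul_comm]
  exact h

lemma dotProduct_mulVec_comm_of_isHermitian (hG : G.IsHermitian) (x y : Fin m → ℝ) :
    x ⬝ᵥ (G *ᵥ y) = (G *ᵥ x) ⬝ᵥ y := by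
  have hGt : Gᵀ = G := by rw [← Matrix.conjTranspose_eq_transpose_of_trivial]; exact hG
  rw [Matrix.dotProduct_mulVec, ← Matrix.mulVec_transpose, hGt]

/-- Eigenvectors of nearby symmetric matrices agree up to sign, at the rate of the perturbation
relative to the eigenvalue gap. -/
lemma exists_sign_dotProduct_sub_le (hS : S.IsHermitian)
    (hV : IsTopEigenvectors S V) (hVh : IsTopEigenvectors G Vh)
    (hSV : S = V * Matrix.diagonal (fun j : Fin r => eig S j) * Vᵀ)
    {d g : ℝ} (hg : 0 < g)
    (hbil : ∀ x z : Fin m → ℝ, (x ⬝ᵥ ((G - S) *ᵥ z)) ^ 2 ≤ d ^ 2 * ((x ⬝ᵥ x) * (z ⬝ᵥ z)))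
    (j : Fin r) (hgap : ∀ i : Fin r, i ≠ j → g ≤ |eig G j - eig S i|) (hpos : g ≤ eig G j) :
    ∃ s : ℝ, (s = 1 ∨ s = -1) ∧
      (Vh.col j - s • V.col j) ⬝ᵥ (Vh.col j - s • V.col j) ≤ 2 * r * (d ^ 2 / g ^ 2) := by
  set v : Fin r → Fin m → ℝ := fun i => V.col i with hv
  set u : Fin m → ℝ := Vh.col j with hu
  have huu : u ⬝ᵥ u = 1 := by simpa using hVh.dotProduct_col j j
  have hvv : ∀ i k, v i ⬝ᵥ v k = if i = k then 1 else 0 := hV.dotProduct_col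
  -- Split `u` into its coordinates `h` along the eigenvectors of `S` and a remainder `w` orthogonal
  -- to them. By `hSV` the remainder lies in the kernel of `S`, so it behaves like an eigenvector
  -- for the eigenvalue `0`, whose gap is `eig G j` itself.
  set h : Fin r → ℝ := fun i => v i ⬝ᵥ u with hh
  set w : Fin m → ℝ := u - ∑ i, h i • v i with hw
  have hvw : ∀ i, v i ⬝ᵥ w = 0 := by
    intro i
    rw [hw, dotProduct_sub, dotProduct_sum]
    simp [hvv, hh]
  have huw : w ⬝ᵥ u = w ⬝ᵥ w := by
    conv_rhs => rw [hw]
    conv_rhs => rw [dotProduct_sub, ← hw, dotProduct_sum]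
    have : ∀ i, w ⬝ᵥ h i • v i = 0 := fun i => by
      rw [dotProduct_smul, dotProduct_comm, hvw, smul_zero]
    simp [this]
  have hnorm : 1 = ∑ i, h i ^ 2 + w ⬝ᵥ w := by
    have : w ⬝ᵥ u = u ⬝ᵥ u - ∑ i, h i ^ 2 := by
      rw [hw, sub_dotProduct, sum_dotProduct]
      simp [hh, sq]
    rw [← huw, this, huu]; ring
  have hGu : G *ᵥ u = eig G j • u := hVh.mulVec_col j
  have hSw : S *ᵥ w = 0 := by
    have : Vᵀ *ᵥ w = 0 := by ext i; exact hvw i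
    rw [hSV, ← Matrix.mulVec_mulVec, this, Matrix.mulVec_zero]
  -- Pairing `(G - S) u` with an eigenvector of `S` multiplies the coordinate by the eigenvalue
  -- difference; the gap can then be divided out.
  have hoff : ∀ i, i ≠ j → h i ^ 2 ≤ d ^ 2 / g ^ 2 := by
    intro i hij
    have h1 : v i ⬝ᵥ ((G - S) *ᵥ u) = (eig G j - eig S i) * h i := by
      rw [Matrix.sub_mulVec, dotProduct_sub, hGu, dotProduct_mulVec_comm_of_isHermitian hS,
        hv, hV.mulVec_col]
      simp [hh, hv]; ring
    have h2 := hbil (v i) u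
    rw [h1, hvv, huu, mul_pow] at h2
    rw [le_div_iff₀ (by positivity)]
    have h3 : g ^ 2 ≤ (eig G j - eig S i) ^ 2 := by
      rw [← sq_abs (eig G j - eig S i)]
      exact pow_le_pow_left₀ hg.le (hgap i hij) 2
    simp at h2
    nlinarith [mul_le_mul_of_nonneg_right h3 (sq_nonneg (h i))]
  have hww : w ⬝ᵥ w ≤ d ^ 2 / g ^ 2 := by
    have h1 : w ⬝ᵥ ((G - S) *ᵥ u) = eig G j * (w ⬝ᵥ w) := by
      rw [Matrix.sub_mulVec, dotProduct_sub, hGu, dotProduct_mulVec_comm_of_isHermitian hS, hSw]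
      simp [huw]
    have h2 := hbil w u
    rw [h1, huu, mul_pow] at h2
    have h0 := dotProduct_self_nonneg_real w
    rw [le_div_iff₀ (by positivity)]
    have h3 : g ^ 2 ≤ eig G j ^ 2 := pow_le_pow_left₀ hg.le hpos 2
    rcases h0.eq_or_lt with h0 | h0
    · rw [← h0]; simp; positivity
    · have h4 := mul_le_mul_of_nonneg_right h3 (sq_nonneg (w ⬝ᵥ w))
      have h5 : (w ⬝ᵥ w * g ^ 2) * (w ⬝ᵥ w) ≤ d ^ 2 * (w ⬝ᵥ w) := by nlinarith
      exact le_of_mul_le_mul_right h5 h0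
  -- The `r - 1` foreign coordinates and the remainder `w` make up `r` equal contributions.
  have hsum : 1 - h j ^ 2 ≤ r * (d ^ 2 / g ^ 2) := by
    have h1 : ∑ i, h i ^ 2 = h j ^ 2 + ∑ i ∈ Finset.univ.erase j, h i ^ 2 :=
      (Finset.add_sum_erase _ _ (Finset.mem_univ j)).symm
    have h2 : ∑ i ∈ Finset.univ.erase j, h i ^ 2 ≤ ((r : ℝ) - 1) * (d ^ 2 / g ^ 2) := by
      have := Finset.sum_le_card_nsmul (Finset.univ.erase j) (fun i => h i ^ 2) (d ^ 2 / g ^ 2)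
        (fun i hi => hoff i (Finset.ne_of_mem_erase hi))
      rw [Finset.card_erase_of_mem (Finset.mem_univ _), Finset.card_univ, Fintype.card_fin,
        nsmul_eq_mul, Nat.cast_sub (Nat.one_le_iff_ne_zero.2 (by have := j.2; omega))] at this
      simpa using this
    linarith
  have hexp : ∀ s : ℝ, s ^ 2 = 1 → (u - s • v j) ⬝ᵥ (u - s • v j) = 2 - 2 * (s * h j) := by
    intro s hs
    simp only [sub_dotProduct, dotProduct_sub, smul_dotProduct, dotProduct_smul, huu, hvv,
      dotProduct_comm u (v j), smul_eq_mul, if_true]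
    change 1 - s * h j - s * (h j - s * 1) = _
    linear_combination hs
  have hjle : h j ^ 2 ≤ 1 := by
    have h1 := Finset.single_le_sum (f := fun i => h i ^ 2) (fun i _ => sq_nonneg _)
      (Finset.mem_univ j)
    have h0 := dotProduct_self_nonneg_real w
    linarith
  have habs : |h j| ≤ 1 := by rwa [sq_le_one_iff_abs_le_one] at hjle
  -- Since `|h j| ≤ 1`, `1 - |h j| ≤ 1 - h j ^ 2`; the sign of `h j` is the sign to choose.
  have hle : 2 - 2 * |h j| ≤ 2 * r * (d ^ 2 / g ^ 2) := by
    have h0 := abs_nonneg (h j)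
    have h1 := sq_abs (h j)
    nlinarith
  rcases le_total 0 (h j) with h0 | h0
  · refine ⟨1, Or.inl rfl, ?_⟩
    rw [hexp 1 (by norm_num), one_mul]
    rwa [abs_of_nonneg h0] at hle
  · refine ⟨-1, Or.inr rfl, ?_⟩
    rw [hexp (-1) (by norm_num), neg_one_mul]
    rwa [abs_of_nonpos h0] at hle

/-- Weyl's inequality in both directions: `hbil` with `x = z` bounds the quadratic form of `±(G -
S)`. -/
lemma abs_eig_sub_le (hG : G.IsHermitian) (hS : S.IsHermitian) {d : ℝ} (hd : 0 ≤ d)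
    (hbil : ∀ x z : Fin m → ℝ, (x ⬝ᵥ ((G - S) *ᵥ z)) ^ 2 ≤ d ^ 2 * ((x ⬝ᵥ x) * (z ⬝ᵥ z)))
    {j : ℕ} (hj : j < m) : |eig G j - eig S j| ≤ d := by
  have hq : ∀ x : Fin m → ℝ, |x ⬝ᵥ ((G - S) *ᵥ x)| ≤ d * (x ⬝ᵥ x) := by
    intro x
    refine abs_le_of_sq_le_sq ?_ (mul_nonneg hd (dotProduct_self_nonneg_real x))
    calc _ ≤ _ := hbil x x
      _ = _ := by ring
  have h1 := eig_le_eig_add hG hS (d := d) (fun x => (le_abs_self _).trans (hq x)) hj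
  have h2 := eig_le_eig_add hS hG (d := d) (fun x => by
    have := (neg_le_abs _).trans (hq x)
    rwa [← dotProduct_neg, ← Matrix.neg_mulVec, neg_sub] at this) hj
  rw [abs_le]; constructor <;> linarith

/-- Perturbation bound for the loadings: principal-component loadings of two nearby symmetric
matrices agree up to signs. -/
lemma exists_sign_norm_loadings_sub_sq_le (hG : G.IsHermitian) (hS : S.IsHermitian)
    (hV : IsTopEigenvectors S V) (hVh : IsTopEigenvectors G Vh)
    (hSV : S = V * Matrix.diagonal (fun j : Fin r => eig S j) * Vᵀ)
    (hrm : r ≤ m) (hm : 0 < m) {d c C : ℝ} (hc : 0 < c) (hd : 0 ≤ d)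
    (hbil : ∀ x z : Fin m → ℝ, (x ⬝ᵥ ((G - S) *ᵥ z)) ^ 2 ≤ d ^ 2 * ((x ⬝ᵥ x) * (z ⬝ᵥ z)))
    (hlow : ∀ j : Fin r, c * m ≤ eig S j) (hup : ∀ j : Fin r, eig S j ≤ C * m)
    (hgap : ∀ i j : Fin r, i ≠ j → c * m ≤ |eig S j - eig S i|) (hdc : 2 * d ≤ c * m) :
    ∃ s : Fin r → ℝ, (∀ k, s k = 1 ∨ s k = -1) ∧
      ‖Vh * eigSqrt r G - V * eigSqrt r S * Matrix.diagonal s‖ ^ 2 ≤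
        r * (2 / c + 16 * C * r / c ^ 2) * (d ^ 2 / m) := by
  have hm' : (0 : ℝ) < m := by exact_mod_cast hm
  have hweyl : ∀ j : Fin r, |eig G j - eig S j| ≤ d := fun j =>
    abs_eig_sub_le hG hS hd hbil (j.2.trans_le hrm)
  have hlow' : ∀ j : Fin r, c * m / 2 ≤ eig G j := fun j => by
    have := (abs_le.1 (hweyl j)).1
    have := hlow j
    linarith
  -- By Weyl's inequality and `2 * d ≤ c * m`, passing from `eig S j` to `eig G j` costs at most
  -- half of the gap, hence `g = c * m / 2`.
  choose s hs hsv using fun j : Fin r =>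
    exists_sign_dotProduct_sub_le hS hV hVh hSV (g := c * m / 2) (by positivity) hbil j
      (fun i hij => by
        have h1 := hgap i j hij
        have h2 := hweyl j
        have h3 : |eig S j - eig S i| ≤ |eig S j - eig G j| + |eig G j - eig S i| :=
          abs_sub_le _ _ _
        rw [abs_sub_comm (eig S j) (eig G j)] at h3
        linarith) (hlow' j)
  refine ⟨s, hs, ?_⟩
  rw [frobenius_norm_sq, Finset.sum_comm]
  have hcol : ∀ j : Fin r, ∑ i, (Vh * eigSqrt r G - V * eigSqrt r S * Matrix.diagonal s) i j ^ 2
      ≤ (2 / c + 16 * C * r / c ^ 2) * (d ^ 2 / m) := by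
    intro j
    set p := √(eig G j) with hp
    set q := √(eig S j) with hq
    have hG0 : 0 ≤ eig G j := le_trans (by positivity) (hlow' j)
    have hS0 : 0 < eig S j := lt_of_lt_of_le (by positivity) (hlow j)
    have hp2 : p ^ 2 = eig G j := Real.sq_sqrt hG0
    have hq2 : q ^ 2 = eig S j := Real.sq_sqrt hS0.le
    have huu : Vh.col j ⬝ᵥ Vh.col j = 1 := by simpa using hVh.dotProduct_col j j
    -- The error of a loading column separates into an error of its length, `p - q`, and an error of
    -- its direction.
    have h1 : ∑ i, (Vh * eigSqrt r G - V * eigSqrt r S * Matrix.diagonal s) i j ^ 2 =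
        ((p - q) • Vh.col j + q • (Vh.col j - s j • V.col j)) ⬝ᵥ
          ((p - q) • Vh.col j + q • (Vh.col j - s j • V.col j)) := by
      have h0 : ∀ i, (Vh * eigSqrt r G - V * eigSqrt r S * Matrix.diagonal s) i j =
          (p - q) * Vh i j + q * (Vh i j - s j * V i j) := fun i => by
        simp only [eigSqrt, Matrix.sub_apply, Matrix.mul_diagonal, ← hp, ← hq]
        ring
      simp only [h0, sq]
      rfl
    have h2 := dotProduct_self_add_le ((p - q) • Vh.col j) (q • (Vh.col j - s j • V.col j))
    refine h1.trans_le (h2.trans ?_)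
    clear h1 h2
    -- `(p - q)(p + q)` is the eigenvalue difference, and `p + q ≥ q`, whose square is at least `c *
    -- m`.
    have hpq : (p - q) ^ 2 ≤ d ^ 2 / (c * m) := by
      rw [le_div_iff₀ (by positivity)]
      have h3 : (p - q) ^ 2 * q ^ 2 ≤ (p - q) ^ 2 * (p + q) ^ 2 := by
        have : 0 ≤ p := Real.sqrt_nonneg _
        have : 0 ≤ q := Real.sqrt_nonneg _
        gcongr
        linarith
      have h4 : (p - q) ^ 2 * (p + q) ^ 2 = (eig G j - eig S j) ^ 2 := by
        rw [← hp2, ← hq2]; ring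
      have h5 : (eig G j - eig S j) ^ 2 ≤ d ^ 2 := by
        rw [← sq_abs (eig G j - eig S j)]
        exact pow_le_pow_left₀ (abs_nonneg _) (hweyl j) 2
      have h6 : (p - q) ^ 2 * (c * m) ≤ (p - q) ^ 2 * q ^ 2 := by
        rw [hq2]; exact mul_le_mul_of_nonneg_left (hlow j) (sq_nonneg _)
      linarith
    have hlast : q ^ 2 * ((Vh.col j - s j • V.col j) ⬝ᵥ (Vh.col j - s j • V.col j)) ≤
        (C * m) * (2 * r * (d ^ 2 / (c * m / 2) ^ 2)) := by
      rw [hq2]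
      exact mul_le_mul (hup j) (hsv j) (dotProduct_self_nonneg_real _) (hS0.le.trans (hup j))
    have he : 2 * (d ^ 2 / (c * m)) + 2 * ((C * m) * (2 * r * (d ^ 2 / (c * m / 2) ^ 2))) =
        (2 / c + 16 * C * r / c ^ 2) * (d ^ 2 / m) := by
      field_simp
      ring
    rw [← he]
    simp only [smul_dotProduct, dotProduct_smul, smul_eq_mul, huu]
    nlinarith
  calc _ ≤ ∑ _j : Fin r, (2 / c + 16 * C * r / c ^ 2) * (d ^ 2 / m) :=
        Finset.sum_le_sum fun j _ => hcol j
    _ = _ := by simp; ring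

end Perturbation

/-! ### From loading errors to factor errors. -/

section FactorBound

lemma frobenius_norm_diagonal_le {r : ℕ} {d : Fin r → ℝ} {b : ℝ} (hb : 0 ≤ b)
    (hd : ∀ k, |d k| ≤ b) : ‖(Matrix.diagonal d : Matrix (Fin r) (Fin r) ℝ)‖ ≤ r * b := by
  refine abs_le_of_sq_le_sq (a := ‖_‖) ?_ (by positivity) |> (le_abs_self _).trans
  rw [frobenius_norm_sq]
  have h1 : ∀ i : Fin r, ∑ j, (Matrix.diagonal d) i j ^ 2 ≤ b ^ 2 := by
    intro i
    rw [Finset.sum_eq_single i (fun j _ hj => by simp [Matrix.diagonal_apply_ne _ hj.symm])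
      (by simp), Matrix.diagonal_apply_eq, ← sq_abs]
    exact pow_le_pow_left₀ (abs_nonneg _) (hd i) 2
  calc _ ≤ ∑ _i : Fin r, b ^ 2 := Finset.sum_le_sum fun i _ => h1 i
    _ = r * b ^ 2 := by simp
    _ ≤ (r * b) ^ 2 := by
      rw [mul_pow]
      have : (r : ℝ) ≤ (r : ℝ) ^ 2 := by exact_mod_cast Nat.le_self_pow two_ne_zero r
      gcongr

lemma IsTopEigenvectors.frobenius_norm_le {m r : ℕ} {A : Matrix (Fin m) (Fin m) ℝ}
    {V : Matrix (Fin m) (Fin r) ℝ} (hV : IsTopEigenvectors A V) : ‖V‖ ≤ r := by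
  refine abs_le_of_sq_le_sq (a := ‖_‖) ?_ (by positivity) |> (le_abs_self _).trans
  rw [frobenius_norm_sq, Finset.sum_comm]
  have h1 : ∀ j : Fin r, ∑ i, V i j ^ 2 = 1 := by
    intro j
    have h := hV.dotProduct_col j j
    rw [if_pos rfl] at h
    rw [← h]
    simp only [sq]
    rfl
  simp only [h1, Finset.sum_const, Finset.card_univ, Fintype.card_fin, nsmul_eq_mul, mul_one]
  exact_mod_cast Nat.le_self_pow two_ne_zero r

/-- Deterministic error bound for estimated principal components, in terms of the error of the
estimated loadings. -/
lemma norm_factor_sub_le {m r : ℕ} {π : Type*} [Fintype π] {G : Matrix (Fin m) (Fin m) ℝ}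
    {U Vh : Matrix (Fin m) (Fin r) ℝ} (hVh : IsTopEigenvectors G Vh) {s : Fin r → ℝ}
    (hs : ∀ k, s k = 1 ∨ s k = -1) {b : ℝ} (hb : 0 < b) (hG : ∀ j : Fin r, b ≤ eig G j)
    (A : Matrix (Fin r) π ℝ) (B : Matrix (Fin m) π ℝ) :
    ‖eigInvSqrt r G * Vhᵀ * (U * A + B) - Matrix.diagonal s * A‖ ≤
      r ^ 3 * (‖Vh * eigSqrt r G - U * Matrix.diagonal s‖ / √b * ‖A‖ + ‖Uᵀ * B‖ / b +
        ‖Vh * eigSqrt r G - U * Matrix.diagonal s‖ / b * ‖B‖) := by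
  rcases Nat.eq_zero_or_pos r with rfl | hr
  · have : eigInvSqrt 0 G * Vhᵀ * (U * A + B) - Matrix.diagonal s * A = 0 := by
      ext i; exact i.elim0
    rw [this]; simp
  have hr1 : (1 : ℝ) ≤ r := by exact_mod_cast hr
  set J : Matrix (Fin r) (Fin r) ℝ := Matrix.diagonal s with hJ
  set L := Vh * eigSqrt r G with hL
  set P := eigInvSqrt r G * Vhᵀ with hP
  set D : Matrix (Fin r) (Fin r) ℝ := Matrix.diagonal (fun j : Fin r => (eig G j)⁻¹) with hD
  have hpos : ∀ j : Fin r, 0 < eig G j := fun j => hb.trans_le (hG j)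
  have hss : ∀ k, s k * s k = 1 := fun k => by rcases hs k with h | h <;> simp [h]
  have hJJ : J * J = 1 := by
    rw [hJ, Matrix.diagonal_mul_diagonal]; simp [hss]
  have hJt : Jᵀ = J := Matrix.diagonal_transpose _
  have hPL : P * L = 1 := by
    rw [hP, hL, Matrix.mul_assoc, ← Matrix.mul_assoc Vhᵀ, hVh.orthonormal, Matrix.one_mul,
      eigInvSqrt, eigSqrt, Matrix.diagonal_mul_diagonal]
    have : ∀ j : Fin r, (√(eig G j))⁻¹ * √(eig G j) = 1 := fun j =>
      inv_mul_cancel₀ (Real.sqrt_pos.2 (hpos j)).ne'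
    simp [this]
  have hPD : P = D * Lᵀ := by
    rw [hP, hL, hD, Matrix.transpose_mul, ← Matrix.mul_assoc, eigInvSqrt, eigSqrt,
      Matrix.diagonal_transpose, Matrix.diagonal_mul_diagonal]
    congr 3
    ext j
    have h1 := Real.sqrt_pos.2 (hpos j)
    rw [← Real.mul_self_sqrt (hpos j).le]
    field_simp
    rw [Real.sqrt_sq h1.le]
  have hPn : ‖P‖ ≤ r * (√b)⁻¹ * r := by
    refine (Matrix.frobenius_norm_mul _ _).trans ?_
    rw [Matrix.frobenius_norm_transpose]
    refine mul_le_mul ?_ hVh.frobenius_norm_le (norm_nonneg _) (by positivity)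
    refine frobenius_norm_diagonal_le (by positivity) fun k => ?_
    rw [abs_of_nonneg (by positivity)]
    exact inv_anti₀ (Real.sqrt_pos.2 hb) (Real.sqrt_le_sqrt (hG k))
  have hDn : ‖D‖ ≤ r * b⁻¹ := by
    refine frobenius_norm_diagonal_le (by positivity) fun k => ?_
    rw [abs_of_nonneg (inv_nonneg.2 (hpos k).le)]
    exact inv_anti₀ hb (hG k)
  have hJn : ‖J‖ ≤ r := by
    have := frobenius_norm_diagonal_le (d := s) (b := 1) (by norm_num) fun k => by
      rcases hs k with h | h <;> simp [h]
    rwa [mul_one] at this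
  -- On the signal, `P * L = 1` and `J * J = 1` leave only `L - U * J`. On the noise, `P = D * Lᵀ`
  -- and `L = U * J + (L - U * J)`; the leading part then involves `Uᵀ * B`, for which a sharper
  -- bound than `‖U‖ * ‖B‖` will be available.
  have hdec : P * (U * A + B) - J * A =
      -(P * (L - U * J) * J * A) + (D * (J * (Uᵀ * B)) + D * ((L - U * J)ᵀ * B)) := by
    have h1 : P * (L - U * J) * J * A = J * A - P * (U * A) := by
      rw [Matrix.mul_sub, hPL, Matrix.sub_mul, Matrix.one_mul, Matrix.sub_mul]
      simp only [Matrix.mul_assoc]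
      rw [← Matrix.mul_assoc J J, hJJ, Matrix.one_mul]
    have h2 : D * (J * (Uᵀ * B)) + D * ((L - U * J)ᵀ * B) = P * B := by
      rw [hPD, Matrix.transpose_sub, Matrix.transpose_mul U J, hJt, Matrix.sub_mul, Matrix.mul_sub]
      simp only [Matrix.mul_assoc]
      abel
    rw [h1, h2, Matrix.mul_add]; abel
  rw [hdec]
  set l := ‖L - U * J‖ with hl
  have e1 : ‖P * (L - U * J) * J * A‖ ≤ (r * (√b)⁻¹ * r) * l * r * ‖A‖ := by
    refine (Matrix.frobenius_norm_mul _ _).trans ?_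
    refine mul_le_mul_of_nonneg_right ?_ (norm_nonneg _)
    refine (Matrix.frobenius_norm_mul _ _).trans ?_
    refine mul_le_mul ?_ hJn (norm_nonneg _) (by positivity)
    refine (Matrix.frobenius_norm_mul _ _).trans ?_
    exact mul_le_mul_of_nonneg_right hPn (norm_nonneg _)
  have e2 : ‖D * (J * (Uᵀ * B))‖ ≤ (r * b⁻¹) * (r * ‖Uᵀ * B‖) := by
    refine (Matrix.frobenius_norm_mul _ _).trans ?_
    refine mul_le_mul hDn ?_ (norm_nonneg _) (by positivity)
    refine (Matrix.frobenius_norm_mul _ _).trans ?_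
    exact mul_le_mul_of_nonneg_right hJn (norm_nonneg _)
  have e3 : ‖D * ((L - U * J)ᵀ * B)‖ ≤ (r * b⁻¹) * (l * ‖B‖) := by
    refine (Matrix.frobenius_norm_mul _ _).trans ?_
    refine mul_le_mul hDn ?_ (norm_nonneg _) (by positivity)
    refine (Matrix.frobenius_norm_mul _ _).trans ?_
    rw [Matrix.frobenius_norm_transpose]
  have hr2 : (r : ℝ) * r ≤ r ^ 3 := by nlinarith [mul_self_nonneg (r : ℝ)]
  have hr3 : (r : ℝ) ≤ r ^ 3 := by nlinarith [mul_self_nonneg (r : ℝ)]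
  calc _ ≤ ‖P * (L - U * J) * J * A‖ + (‖D * (J * (Uᵀ * B))‖ + ‖D * ((L - U * J)ᵀ * B)‖) := by
        refine (norm_add_le _ _).trans (add_le_add ?_ (norm_add_le _ _))
        rw [norm_neg]
    _ ≤ (r * (√b)⁻¹ * r) * l * r * ‖A‖ + ((r * b⁻¹) * (r * ‖Uᵀ * B‖) + (r * b⁻¹) * (l * ‖B‖)) :=
        add_le_add e1 (add_le_add e2 e3)
    _ = r ^ 3 * (l / √b * ‖A‖) + ((r * r) * (‖Uᵀ * B‖ / b) + r * (l / b * ‖B‖)) := by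
        simp only [div_eq_mul_inv]; ring
    _ ≤ r ^ 3 * (l / √b * ‖A‖) + (r ^ 3 * (‖Uᵀ * B‖ / b) + r ^ 3 * (l / b * ‖B‖)) := by
        gcongr
    _ = _ := by ring

end FactorBound

/-! ### Regressors as linear images of the factors. -/

section Regressor

variable {N r : ℕ}

/-- The matrix of the linear map that multiplies each frontal slice by the vector `y`. -/
def sliceMul (y : Fin N → ℝ) : Matrix (Fin N × Fin N) (Fin N) ℝ :=
  Matrix.of fun p i => if p.1 = i then y p.2 else 0

/-- Slice-wise products become one right multiplication of the unfolding. Bounds for left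
multiplication by the principal-component filter thus carry over to the regressors. -/
lemma slice_mulVec_eq {d : ℕ} (A : Tensor3 N d) (y : Fin N → ℝ) (k : Fin d) (i : Fin N) :
    (slice A k *ᵥ y) i = (A * sliceMul y) k i := by
  simp [slice, sliceMul, Matrix.mulVec, dotProduct, Matrix.mul_apply, Fintype.sum_prod_type]

/-- The signs `J`, extended by `1` to the parameters that do not belong to factors. -/
def extendSign (J : Fin r → ℝ) : Param r N → ℝ := Sum.elim J fun _ => 1

/-- The matrix `A` with its columns multiplied by the numbers `s`. -/
def scaleCols {ι π : Type*} (A : Matrix ι π ℝ) (s : π → ℝ) : Matrix ι π ℝ :=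
  Matrix.of fun i p => A i p * s p

lemma extendSign_sq {J : Fin r → ℝ} (hJ : ∀ k, J k = 1 ∨ J k = -1) (p : Param r N) :
    extendSign J p * extendSign J p = 1 := by
  rcases p with k | k
  · rcases hJ k with h | h <;> simp [extendSign, h]
  · simp [extendSign]

lemma norm_sliceMul_sq (y : Fin N → ℝ) : ‖sliceMul y‖ ^ 2 = N * (y ⬝ᵥ y) := by
  rw [frobenius_norm_sq, Fintype.sum_prod_type]
  have : ∀ i j : Fin N, ∑ k, sliceMul y (i, j) k ^ 2 = y j * y j := by
    intro i j
    simp [sliceMul, ite_pow, sq]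
  simp [this, dotProduct]

/-- The blocks `diag(y)` and `I` do not depend on the factors and carry the sign `1`, so they
cancel. -/
lemma norm_regressor_sub_scaleCols (F G : Tensor3 N r) (y : Fin N → ℝ) (J : Fin r → ℝ) :
    ‖regressor F y - scaleCols (regressor G y) (extendSign J)‖ =
      ‖F * sliceMul y - Matrix.diagonal J * (G * sliceMul y)‖ := by
  refine (sq_eq_sq₀ (norm_nonneg _) (norm_nonneg _)).1 ?_
  rw [frobenius_norm_sq, frobenius_norm_sq, Finset.sum_comm, Fintype.sum_sum_type]
  have h1 : ∀ (k : Fin r) (i : Fin N), (regressor F y -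
      scaleCols (regressor G y) (extendSign J)) i (Sum.inl k) =
      (F * sliceMul y - Matrix.diagonal J * (G * sliceMul y)) k i := by
    intro k i
    rw [Matrix.sub_apply, Matrix.sub_apply, Matrix.diagonal_mul]
    simp only [scaleCols, regressor, Matrix.fromCols_apply_inl, Matrix.of_apply, slice_mulVec_eq, extendSign,
      Sum.elim_inl]
    ring
  have h2 : ∀ (k : Fin N ⊕ Fin N) (i : Fin N), (regressor F y -
      scaleCols (regressor G y) (extendSign J)) i (Sum.inr k) = 0 := by
    intro k i
    rw [Matrix.sub_apply]
    simp [scaleCols, regressor, extendSign]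
  simp only [h1, h2]
  simp

lemma norm_regressor_sq (F : Tensor3 N r) (y : Fin N → ℝ) :
    ‖regressor F y‖ ^ 2 = ‖F * sliceMul y‖ ^ 2 + (y ⬝ᵥ y) + N := by
  rw [frobenius_norm_sq, frobenius_norm_sq, Finset.sum_comm, Fintype.sum_sum_type,
    Fintype.sum_sum_type, ← add_assoc]
  congr 1
  · congr 1
    · refine Finset.sum_congr rfl fun k _ => Finset.sum_congr rfl fun i _ => ?_
      simp [regressor, slice_mulVec_eq]
    · refine Finset.sum_congr rfl fun k _ => ?_
      simp [regressor, Matrix.diagonal_apply, ite_pow, sq]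
  · simp [regressor, Matrix.one_apply, ite_pow]

lemma norm_mul_sliceMul_le (F : Tensor3 N r) (y : Fin N → ℝ) :
    ‖F * sliceMul y‖ ≤ ‖regressor F y‖ := by
  refine abs_le_of_sq_le_sq (a := ‖_‖) ?_ (norm_nonneg _) |> (le_abs_self _).trans
  rw [norm_regressor_sq]
  have := dotProduct_self_nonneg_real y
  have : (0 : ℝ) ≤ N := by positivity
  linarith

/-- The block `diag(y)` is part of the regressors. Moments of the regressors at date `t + 1`
therefore control those of `y` at date `t`. -/
lemma dotProduct_self_le_norm_regressor_sq (F : Tensor3 N r) (y : Fin N → ℝ) :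
    y ⬝ᵥ y ≤ ‖regressor F y‖ ^ 2 := by
  rw [norm_regressor_sq]
  have : (0 : ℝ) ≤ N := by positivity
  have := sq_nonneg ‖F * sliceMul y‖
  linarith

end Regressor

/-! ### Deterministic least squares with perturbed regressors. -/

section LeastSquares

/-- Plain functions carry the sup norm; `WithLp.toLp 2` supplies the Euclidean norm, which is
compatible with the Frobenius norm. -/
lemma norm_toLp_sq {ι : Type*} [Fintype ι] (x : ι → ℝ) : ‖WithLp.toLp 2 x‖ ^ 2 = x ⬝ᵥ x := by
  rw [EuclideanSpace.norm_sq_eq]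
  simp [dotProduct, sq]

lemma dotProduct_le_norm_mul_norm {ι : Type*} [Fintype ι] (x z : ι → ℝ) :
    x ⬝ᵥ z ≤ ‖WithLp.toLp 2 x‖ * ‖WithLp.toLp 2 z‖ := by
  refine (le_abs_self _).trans (abs_le_of_sq_le_sq ?_ (by positivity))
  rw [mul_pow, norm_toLp_sq, norm_toLp_sq]
  simpa [dotProduct, sq] using Finset.sum_mul_sq_le_sq_mul_sq Finset.univ x z

lemma norm_toLp_mulVec_le {ι κ : Type*} [Fintype ι] [Fintype κ] (A : Matrix ι κ ℝ) (x : κ → ℝ) :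
    ‖WithLp.toLp 2 (A *ᵥ x)‖ ≤ ‖A‖ * ‖WithLp.toLp 2 x‖ := by
  refine (le_abs_self _).trans (abs_le_of_sq_le_sq ?_ (by positivity))
  rw [mul_pow, norm_toLp_sq, norm_toLp_sq, frobenius_norm_sq, Finset.sum_mul]
  refine Finset.sum_le_sum fun i _ => ?_
  simpa [Matrix.mulVec, dotProduct, sq] using Finset.sum_mul_sq_le_sq_mul_sq Finset.univ (A i) x

variable {N r : ℕ} {X Xh : ℕ → Matrix (Fin N) (Param r N) ℝ} {s : Param r N → ℝ}

lemma scaleCols_mulVec {ι π : Type*} [Fintype π] (A : Matrix ι π ℝ) (s v : π → ℝ) :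
    scaleCols A s *ᵥ v = A *ᵥ (s * v) := by
  ext i
  simp [scaleCols, Matrix.mulVec, dotProduct, mul_assoc]

lemma dotProduct_sign_mul {π : Type*} [Fintype π] {s : π → ℝ} (hs : ∀ p, s p * s p = 1)
    (v : π → ℝ) : (s * v) ⬝ᵥ (s * v) = v ⬝ᵥ v := by
  refine Finset.sum_congr rfl fun p _ => ?_
  simp only [Pi.mul_apply]
  linear_combination v p * v p * hs p

lemma norm_scaleCols {ι π : Type*} [Fintype ι] [Fintype π] (A : Matrix ι π ℝ) {s : π → ℝ}
    (hs : ∀ p, s p * s p = 1) : ‖scaleCols A s‖ = ‖A‖ := by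
  refine (sq_eq_sq₀ (norm_nonneg _) (norm_nonneg _)).1 ?_
  rw [frobenius_norm_sq, frobenius_norm_sq]
  refine Finset.sum_congr rfl fun i _ => Finset.sum_congr rfl fun p _ => ?_
  simp only [scaleCols, Matrix.of_apply]
  linear_combination A i p ^ 2 * hs p

lemma gram_mulVec (X : ℕ → Matrix (Fin N) (Param r N) ℝ) (T : ℕ) (v : Param r N → ℝ) :
    gram X T *ᵥ v = ∑ t ∈ Finset.Icc 1 T, (X t)ᵀ *ᵥ (X t *ᵥ v) := by
  rw [gram, Matrix.sum_mulVec]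
  exact Finset.sum_congr rfl fun t _ => (Matrix.mulVec_mulVec v (X t)ᵀ (X t)).symm

lemma dotProduct_gram_mulVec (X : ℕ → Matrix (Fin N) (Param r N) ℝ) (T : ℕ)
    (u v : Param r N → ℝ) :
    u ⬝ᵥ (gram X T *ᵥ v) = ∑ t ∈ Finset.Icc 1 T, (X t *ᵥ u) ⬝ᵥ (X t *ᵥ v) := by
  rw [gram_mulVec, dotProduct_sum]
  refine Finset.sum_congr rfl fun t _ => ?_
  rw [Matrix.dotProduct_mulVec, Matrix.vecMul_transpose]

/-- If regressors are close in mean square to non-collinear ones, they are not collinear. -/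
lemma le_gram_of_meanSquare_le (hs : ∀ p, s p * s p = 1) {T : ℕ} {c : ℝ}
    (hc : ∀ v : Param r N → ℝ, c * (v ⬝ᵥ v) ≤ (T : ℝ)⁻¹ * (v ⬝ᵥ (gram X T *ᵥ v)))
    (ha : (T : ℝ)⁻¹ * ∑ t ∈ Finset.Icc 1 T, ‖Xh t - scaleCols (X t) s‖ ^ 2 ≤ c / 4)
    (v : Param r N → ℝ) :
    c / 4 * (v ⬝ᵥ v) ≤ (T : ℝ)⁻¹ * (v ⬝ᵥ (gram Xh T *ᵥ v)) := by
  have h1 := hc (s * v)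
  rw [dotProduct_sign_mul hs, dotProduct_gram_mulVec] at h1
  rw [dotProduct_gram_mulVec]
  -- With `|a + b|² ≤ 2|a|² + 2|b|²`, averaging gives `c ≤ 2 ĉ + 2 (c / 4)` for the normalized forms
  -- at `v`, that is `ĉ ≥ c / 4`.
  have h2 : ∀ t, (X t *ᵥ (s * v)) ⬝ᵥ (X t *ᵥ (s * v)) ≤
      2 * ((Xh t *ᵥ v) ⬝ᵥ (Xh t *ᵥ v)) + 2 * (‖Xh t - scaleCols (X t) s‖ ^ 2 * (v ⬝ᵥ v)) := by
    intro t
    have h3 : X t *ᵥ (s * v) = Xh t *ᵥ v + (-((Xh t - scaleCols (X t) s) *ᵥ v)) := by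
      rw [Matrix.sub_mulVec, scaleCols_mulVec]; abel
    have h4 := dotProduct_self_add_le (Xh t *ᵥ v) (-((Xh t - scaleCols (X t) s) *ᵥ v))
    rw [← h3, neg_dotProduct_neg] at h4
    have h5 := pow_le_pow_left₀ (norm_nonneg _)
      (norm_toLp_mulVec_le (Xh t - scaleCols (X t) s) v) 2
    rw [mul_pow, norm_toLp_sq, norm_toLp_sq] at h5
    linarith
  have h6 := Finset.sum_le_sum fun t (_ : t ∈ Finset.Icc 1 T) => h2 t
  rw [Finset.sum_add_distrib, ← Finset.mul_sum, ← Finset.mul_sum, ← Finset.sum_mul] at h6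
  have h7 := mul_le_mul_of_nonneg_left h6 (by positivity : (0 : ℝ) ≤ (T : ℝ)⁻¹)
  have h8 := mul_le_mul_of_nonneg_right ha (dotProduct_self_nonneg_real v)
  linarith

lemma isUnit_det_gram {T : ℕ} {c : ℝ} (hc0 : 0 < c)
    (hc : ∀ v : Param r N → ℝ, c * (v ⬝ᵥ v) ≤ (T : ℝ)⁻¹ * (v ⬝ᵥ (gram X T *ᵥ v))) :
    IsUnit (gram X T).det := by
  rw [isUnit_iff_ne_zero]
  intro h0
  obtain ⟨v, hv, hv0⟩ := Matrix.exists_mulVec_eq_zero_iff.2 h0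
  have h := hc v
  rw [hv0, dotProduct_zero, mul_zero] at h
  have h1 : v ⬝ᵥ v = 0 := le_antisymm (nonpos_of_mul_nonpos_right h hc0) (dotProduct_self_nonneg_real v)
  exact hv (dotProduct_self_eq_zero.1 h1)

lemma le_of_mul_sq_le_mul {c n Q : ℝ} (hc : 0 < c) (hn : 0 ≤ n) (hQ : 0 ≤ Q)
    (h : c / 4 * n ^ 2 ≤ n * Q) : n ≤ 4 / c * Q := by
  rcases hn.eq_or_lt with h0 | h0
  · rw [← h0]; positivity
  · rw [div_mul_eq_mul_div, le_div_iff₀ hc]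
    have h1 : c / 4 * n ≤ Q := le_of_mul_le_mul_left (by linarith) h0
    linarith

/-- Deterministic bound for the error of least squares on estimated regressors. -/
lemma norm_ols_sub_le (hs : ∀ p, s p * s p = 1) {T : ℕ} {c : ℝ} (hc0 : 0 < c)
    (hc : ∀ v : Param r N → ℝ, c * (v ⬝ᵥ v) ≤ (T : ℝ)⁻¹ * (v ⬝ᵥ (gram X T *ᵥ v)))
    {a : ℝ} (ha : (T : ℝ)⁻¹ * ∑ t ∈ Finset.Icc 1 T, ‖Xh t - scaleCols (X t) s‖ ^ 2 = a)
    (hac : a ≤ c / 4) (y ν : ℕ → Fin N → ℝ) (θ : Param r N → ℝ)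
    (hy : ∀ t ∈ Finset.Icc 1 T, y t = scaleCols (X t) s *ᵥ θ + ν t) :
    ‖WithLp.toLp 2 (ols Xh y T - θ)‖ ≤ 4 / c *
      ((T : ℝ)⁻¹ * ‖WithLp.toLp 2 (∑ t ∈ Finset.Icc 1 T, (X t)ᵀ *ᵥ ν t)‖ +
        √a * √((T : ℝ)⁻¹ * ∑ t ∈ Finset.Icc 1 T, ‖WithLp.toLp 2 (ν t)‖ ^ 2) +
        (a + √a * √((T : ℝ)⁻¹ * ∑ t ∈ Finset.Icc 1 T, ‖X t‖ ^ 2)) * ‖WithLp.toLp 2 θ‖) := by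
  have hlow := le_gram_of_meanSquare_le hs hc (ha.trans_le hac)
  have hunit := isUnit_det_gram (by positivity : 0 < c / 4) hlow
  set e := ols Xh y T - θ with he
  set D : ℕ → Matrix (Fin N) (Param r N) ℝ := fun t => Xh t - scaleCols (X t) s with hD
  have hDt : ∀ t, D t = Xh t - scaleCols (X t) s := fun _ => rfl
  have hT0 : (0 : ℝ) ≤ (T : ℝ)⁻¹ := by positivity
  have hcs : ∀ f g : ℕ → ℝ, (T : ℝ)⁻¹ * ∑ t ∈ Finset.Icc 1 T, f t * g t ≤
      √((T : ℝ)⁻¹ * ∑ t ∈ Finset.Icc 1 T, f t ^ 2) *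
        √((T : ℝ)⁻¹ * ∑ t ∈ Finset.Icc 1 T, g t ^ 2) := by
    intro f g
    rw [Real.sqrt_mul hT0, Real.sqrt_mul hT0, mul_mul_mul_comm, Real.mul_self_sqrt hT0]
    exact mul_le_mul_of_nonneg_left (Real.sum_mul_le_sqrt_mul_sqrt _ f g) hT0
  -- Normal equations: relative to the estimated regressors the disturbance is `ν t - D t *ᵥ θ`.
  have hnormal : gram Xh T *ᵥ e = ∑ t ∈ Finset.Icc 1 T, (Xh t)ᵀ *ᵥ (ν t - D t *ᵥ θ) := by
    rw [he, Matrix.mulVec_sub, ols, Matrix.mulVec_mulVec, Matrix.mul_nonsing_inv _ hunit,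
      Matrix.one_mulVec, gram_mulVec, ← Finset.sum_sub_distrib]
    refine Finset.sum_congr rfl fun t ht => ?_
    rw [← Matrix.mulVec_sub, hy t ht, hDt, Matrix.sub_mulVec]
    congr 1
    abel
  -- Against the noise, the estimated regressor is split into the true one plus `D t`. The score of
  -- the true regressors must stay intact as a sum: a term-by-term norm bound would lose its
  -- cancellation.
  have hexp : e ⬝ᵥ (gram Xh T *ᵥ e) = (s * e) ⬝ᵥ (∑ t ∈ Finset.Icc 1 T, (X t)ᵀ *ᵥ ν t) +
      ∑ t ∈ Finset.Icc 1 T, ((D t *ᵥ e) ⬝ᵥ ν t - (Xh t *ᵥ e) ⬝ᵥ (D t *ᵥ θ)) := by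
    rw [hnormal, dotProduct_sum, dotProduct_sum, ← Finset.sum_add_distrib]
    refine Finset.sum_congr rfl fun t _ => ?_
    have h1 : D t *ᵥ e = Xh t *ᵥ e - scaleCols (X t) s *ᵥ e := by rw [hDt, Matrix.sub_mulVec]
    rw [Matrix.dotProduct_mulVec, Matrix.vecMul_transpose, Matrix.dotProduct_mulVec,
      Matrix.vecMul_transpose, dotProduct_sub, ← scaleCols_mulVec, h1, sub_dotProduct]
    abel
  set n := ‖WithLp.toLp 2 e‖ with hn
  set q := ‖WithLp.toLp 2 θ‖ with hq
  have hse : ‖WithLp.toLp 2 (s * e)‖ = n := by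
    refine (sq_eq_sq₀ (norm_nonneg _) (norm_nonneg _)).1 ?_
    rw [norm_toLp_sq, dotProduct_sign_mul hs, norm_toLp_sq]
  have hXh : ∀ t, ‖Xh t‖ ≤ ‖D t‖ + ‖X t‖ := by
    intro t
    have h1 : Xh t = D t + scaleCols (X t) s := by rw [hDt, sub_add_cancel]
    calc ‖Xh t‖ = ‖D t + scaleCols (X t) s‖ := by rw [← h1]
      _ ≤ _ := (norm_add_le _ _).trans_eq (by rw [norm_scaleCols _ hs])
  have hterm : ∀ t, (D t *ᵥ e) ⬝ᵥ ν t - (Xh t *ᵥ e) ⬝ᵥ (D t *ᵥ θ) ≤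
      n * (‖D t‖ * ‖WithLp.toLp 2 (ν t)‖ + q * (‖D t‖ ^ 2 + ‖D t‖ * ‖X t‖)) := by
    intro t
    have h1 : (D t *ᵥ e) ⬝ᵥ ν t ≤ (‖D t‖ * n) * ‖WithLp.toLp 2 (ν t)‖ :=
      (dotProduct_le_norm_mul_norm _ _).trans
        (mul_le_mul_of_nonneg_right (norm_toLp_mulVec_le _ _) (norm_nonneg _))
    have h2 : -((Xh t *ᵥ e) ⬝ᵥ (D t *ᵥ θ)) ≤ ((‖D t‖ + ‖X t‖) * n) * (‖D t‖ * q) := by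
      rw [← neg_dotProduct]
      refine (dotProduct_le_norm_mul_norm _ _).trans ?_
      rw [WithLp.toLp_neg, norm_neg]
      refine mul_le_mul ((norm_toLp_mulVec_le _ _).trans ?_) (norm_toLp_mulVec_le _ _)
        (norm_nonneg _) (by positivity)
      exact mul_le_mul_of_nonneg_right (hXh t) (norm_nonneg _)
    linarith
  have hmain : c / 4 * n ^ 2 ≤ n *
      ((T : ℝ)⁻¹ * ‖WithLp.toLp 2 (∑ t ∈ Finset.Icc 1 T, (X t)ᵀ *ᵥ ν t)‖ +
        √a * √((T : ℝ)⁻¹ * ∑ t ∈ Finset.Icc 1 T, ‖WithLp.toLp 2 (ν t)‖ ^ 2) +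
        (a + √a * √((T : ℝ)⁻¹ * ∑ t ∈ Finset.Icc 1 T, ‖X t‖ ^ 2)) * q) := by
    rw [hn, norm_toLp_sq, ← hn]
    refine (hlow e).trans ?_
    rw [hexp, mul_add]
    have h1 : (s * e) ⬝ᵥ (∑ t ∈ Finset.Icc 1 T, (X t)ᵀ *ᵥ ν t) ≤
        n * ‖WithLp.toLp 2 (∑ t ∈ Finset.Icc 1 T, (X t)ᵀ *ᵥ ν t)‖ := by
      rw [← hse]; exact dotProduct_le_norm_mul_norm _ _
    have h2 := Finset.sum_le_sum fun t (_ : t ∈ Finset.Icc 1 T) => hterm t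
    rw [← Finset.mul_sum, Finset.sum_add_distrib, ← Finset.mul_sum, Finset.sum_add_distrib] at h2
    have h3 := hcs (fun t => ‖D t‖) (fun t => ‖WithLp.toLp 2 (ν t)‖)
    have h4 := hcs (fun t => ‖D t‖) (fun t => ‖X t‖)
    rw [ha] at h3 h4
    have hn0 : 0 ≤ n := norm_nonneg _
    have hq0 : 0 ≤ q := norm_nonneg _
    calc _ ≤ (T : ℝ)⁻¹ * (n * ‖WithLp.toLp 2 (∑ t ∈ Finset.Icc 1 T, (X t)ᵀ *ᵥ ν t)‖) +
          (T : ℝ)⁻¹ * _ :=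
          add_le_add (mul_le_mul_of_nonneg_left h1 hT0) (mul_le_mul_of_nonneg_left h2 hT0)
      _ = n * ((T : ℝ)⁻¹ * ‖WithLp.toLp 2 (∑ t ∈ Finset.Icc 1 T, (X t)ᵀ *ᵥ ν t)‖ +
          (T : ℝ)⁻¹ * ∑ t ∈ Finset.Icc 1 T, ‖D t‖ * ‖WithLp.toLp 2 (ν t)‖ +
          ((T : ℝ)⁻¹ * ∑ t ∈ Finset.Icc 1 T, ‖D t‖ ^ 2 +
            (T : ℝ)⁻¹ * ∑ t ∈ Finset.Icc 1 T, ‖D t‖ * ‖X t‖) * q) := by ring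
      _ ≤ _ := by
          rw [ha]
          gcongr
  have ha0 : 0 ≤ a := by rw [← ha]; positivity
  refine le_of_mul_sq_le_mul hc0 (norm_nonneg _) ?_ hmain
  exact add_nonneg (add_nonneg (mul_nonneg hT0 (norm_nonneg _))
    (mul_nonneg (Real.sqrt_nonneg _) (Real.sqrt_nonneg _)))
    (mul_nonneg (add_nonneg ha0 (mul_nonneg (Real.sqrt_nonneg _) (Real.sqrt_nonneg _)))
      (norm_nonneg _))

end LeastSquares

/-! ### Calculus of stochastic boundedness. -/

section StochasticOrder

variable {Ω ι : Type*} [MeasurableSpace Ω] {μ : Measure Ω} {f g : ι → Ω → ℝ} {a b : ι → ℝ}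
  {l : Filter ι}

/-- The exceptional sets absorb half of `ε`. Inequalities valid only on events of probability
tending to `1` thereby yield stochastic orders. -/
lemma IsBigOp.of_norm_le {E E' : Type*} [Norm E] [Norm E'] {f : ι → Ω → E} {g : ι → Ω → E'}
    {B : ι → Set Ω} (hg : IsBigOp μ g a l)
    (hB : Tendsto (fun i => μ (B i)) l (𝓝 0))
    (h : ∀ᶠ i in l, ∀ ω, ω ∉ B i → ‖f i ω‖ ≤ ‖g i ω‖) : IsBigOp μ f a l := by
  intro ε hε
  obtain ⟨K, hK⟩ := hg (ε / 2) (by positivity)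
  refine ⟨K, ?_⟩
  have hB' := ENNReal.tendsto_nhds_zero.1 hB (ENNReal.ofReal (ε / 2)) (by simpa using hε)
  filter_upwards [hK, hB', h] with i h1 h2 h3
  calc μ {ω | K * a i < ‖f i ω‖} ≤ μ ({ω | K * a i < ‖g i ω‖} ∪ B i) := by
        refine measure_mono fun ω hω => ?_
        by_cases hb : ω ∈ B i
        · exact Or.inr hb
        · exact Or.inl (lt_of_lt_of_le hω (h3 ω hb))
    _ ≤ _ := measure_union_le _ _
    _ ≤ ENNReal.ofReal (ε / 2) + ENNReal.ofReal (ε / 2) := add_le_add h1 h2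
    _ = ENNReal.ofReal ε := by
        rw [← ENNReal.ofReal_add (by positivity) (by positivity), add_halves]

lemma IsBigOp.add (hf : IsBigOp μ f a l) (hg : IsBigOp μ g a l) :
    IsBigOp μ (fun i ω => f i ω + g i ω) a l := by
  intro ε hε
  obtain ⟨K, hK⟩ := hf (ε / 2) (by positivity)
  obtain ⟨K', hK'⟩ := hg (ε / 2) (by positivity)
  refine ⟨K + K', ?_⟩
  filter_upwards [hK, hK'] with i h1 h2
  calc _ ≤ μ ({ω | K * a i < ‖f i ω‖} ∪ {ω | K' * a i < ‖g i ω‖}) := by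
        refine measure_mono fun ω hω => ?_
        by_contra hn
        simp only [Set.mem_union, Set.mem_ofPred_eq, not_or, not_lt] at hn hω
        have := norm_add_le (f i ω) (g i ω)
        linarith
    _ ≤ _ := measure_union_le _ _
    _ ≤ ENNReal.ofReal (ε / 2) + ENNReal.ofReal (ε / 2) := add_le_add h1 h2
    _ = ENNReal.ofReal ε := by
        rw [← ENNReal.ofReal_add (by positivity) (by positivity), add_halves]

lemma IsBigOp.mul (hf : IsBigOp μ f a l) (hg : IsBigOp μ g b l) :
    IsBigOp μ (fun i ω => f i ω * g i ω) (fun i => a i * b i) l := by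
  intro ε hε
  obtain ⟨K, hK⟩ := hf (ε / 2) (by positivity)
  obtain ⟨K', hK'⟩ := hg (ε / 2) (by positivity)
  refine ⟨K * K', ?_⟩
  filter_upwards [hK, hK'] with i h1 h2
  calc _ ≤ μ ({ω | K * a i < ‖f i ω‖} ∪ {ω | K' * b i < ‖g i ω‖}) := by
        refine measure_mono fun ω hω => ?_
        by_contra hn
        simp only [Set.mem_union, Set.mem_ofPred_eq, not_or, not_lt] at hn hω
        rw [norm_mul] at hω
        have := mul_le_mul hn.1 hn.2 (norm_nonneg _) ((norm_nonneg _).trans hn.1)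
        linarith
    _ ≤ _ := measure_union_le _ _
    _ ≤ ENNReal.ofReal (ε / 2) + ENNReal.ofReal (ε / 2) := add_le_add h1 h2
    _ = ENNReal.ofReal ε := by
        rw [← ENNReal.ofReal_add (by positivity) (by positivity), add_halves]

lemma IsBigOp.const_mul (hf : IsBigOp μ f a l) (c : ℝ) :
    IsBigOp μ (fun i ω => c * f i ω) a l := by
  intro ε hε
  obtain ⟨K, hK⟩ := hf ε hε
  refine ⟨|c| * K, ?_⟩
  filter_upwards [hK] with i h1
  refine (measure_mono fun ω hω => ?_).trans h1
  simp only [Set.mem_ofPred_eq, norm_mul, Real.norm_eq_abs, mul_assoc] at hω ⊢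
  exact lt_of_mul_lt_mul_left hω (abs_nonneg c)

/-- The constant `K` in `IsBigOp` may be negative; this is the reason for `|K|` and for the lower
bound on `a`. -/
lemma IsBigOp.mono_rate {E : Type*} [Norm E] {f : ι → Ω → E} {C : ℝ} (hf : IsBigOp μ f a l)
    (h : ∀ᶠ i in l, 0 ≤ a i ∧ a i ≤ C * b i) : IsBigOp μ f b l := by
  intro ε hε
  obtain ⟨K, hK⟩ := hf ε hε
  refine ⟨|K| * C, ?_⟩
  filter_upwards [hK, h] with i h1 h2
  refine (measure_mono fun ω (hω : |K| * C * b i < ‖f i ω‖) => ?_).trans h1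
  refine lt_of_le_of_lt (b := |K| * C * b i) ?_ hω
  calc K * a i ≤ |K| * a i := mul_le_mul_of_nonneg_right (le_abs_self K) h2.1
    _ ≤ |K| * (C * b i) := mul_le_mul_of_nonneg_left h2.2 (abs_nonneg K)
    _ = _ := by ring

lemma IsBigOp.of_sq (hf : IsBigOp μ (fun i ω => f i ω ^ 2) (fun i => a i ^ 2) l)
    (ha : ∀ᶠ i in l, 0 ≤ a i) : IsBigOp μ f a l := by
  intro ε hε
  obtain ⟨K, hK⟩ := hf ε hε
  refine ⟨√|K|, ?_⟩
  filter_upwards [hK, ha] with i h1 h2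
  refine (measure_mono fun ω hω => ?_).trans h1
  simp only [Set.mem_ofPred_eq, norm_pow] at hω ⊢
  have h3 := pow_lt_pow_left₀ hω (by positivity) two_ne_zero
  rw [mul_pow, Real.sq_sqrt (abs_nonneg K)] at h3
  exact lt_of_le_of_lt (mul_le_mul_of_nonneg_right (le_abs_self K) (sq_nonneg _)) h3

/-- Where `f` is negative the real square root is `0`, so no sign condition on `f` is needed. -/
lemma IsBigOp.sqrt (hf : IsBigOp μ f (fun i => a i ^ 2) l)
    (ha : ∀ᶠ i in l, 0 ≤ a i) : IsBigOp μ (fun i ω => √(f i ω)) a l := by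
  refine IsBigOp.of_sq (hf.of_norm_le (B := fun _ => ∅)
    (by simp [tendsto_const_nhds]) (.of_forall fun i ω _ => ?_)) ha
  rw [norm_pow, Real.norm_eq_abs, Real.norm_eq_abs, sq_abs]
  rcases le_total 0 (f i ω) with h | h
  · rw [Real.sq_sqrt h]; exact le_abs_self _
  · rw [Real.sqrt_eq_zero_of_nonpos h]; simp

lemma IsBigOp.comp_tendsto {κ E : Type*} [Norm E] {f : ι → Ω → E} {k : Filter κ} {φ : κ → ι}
    (hf : IsBigOp μ f a l) (hφ : Tendsto φ k l) :
    IsBigOp μ (fun i => f (φ i)) (fun i => a (φ i)) k := by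
  intro ε hε
  obtain ⟨K, hK⟩ := hf ε hε
  exact ⟨K, hφ.eventually hK⟩

/-- Markov's inequality, as a criterion for stochastic boundedness. -/
lemma isBigOp_of_lintegral_le {C : ℝ} (ha : ∀ᶠ i in l, 0 < a i)
    (hm : ∀ᶠ i in l, AEMeasurable (f i) μ) (h0 : ∀ᶠ i in l, ∀ ω, 0 ≤ f i ω)
    (h : ∀ᶠ i in l, ∫⁻ ω, ENNReal.ofReal (f i ω) ∂μ ≤ ENNReal.ofReal (C * a i)) :
    IsBigOp μ f a l := by
  intro ε hε
  -- The summand `1` keeps the threshold positive even for `C = 0`, so that it can be cancelled from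
  -- Markov's inequality.
  refine ⟨|C| / ε + 1, ?_⟩
  filter_upwards [ha, hm, h0, h] with i ha hm h0 h
  have hK : 0 < (|C| / ε + 1) * a i := by positivity
  have h1 := mul_meas_ge_le_lintegral₀ hm.ennreal_ofReal
    (ENNReal.ofReal ((|C| / ε + 1) * a i))
  have hsub : μ {ω | (|C| / ε + 1) * a i < ‖f i ω‖} ≤
      μ {ω | ENNReal.ofReal ((|C| / ε + 1) * a i) ≤ ENNReal.ofReal (f i ω)} := by
    refine measure_mono fun ω hω => ENNReal.ofReal_le_ofReal ?_
    simp only [Set.mem_ofPred_eq, Real.norm_eq_abs, abs_of_nonneg (h0 ω)] at hω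
    exact hω.le
  have h2 : ENNReal.ofReal ((|C| / ε + 1) * a i) * μ {ω | (|C| / ε + 1) * a i < ‖f i ω‖} ≤
      ENNReal.ofReal ((|C| / ε + 1) * a i) * ENNReal.ofReal ε := by
    refine ((mul_le_mul_right hsub _).trans h1).trans (h.trans ?_)
    rw [← ENNReal.ofReal_mul hK.le]
    refine ENNReal.ofReal_le_ofReal ?_
    have : (|C| / ε + 1) * a i * ε = (|C| + ε) * a i := by field_simp
    rw [this]
    exact mul_le_mul_of_nonneg_right (by linarith [le_abs_self C]) ha.le
  exact (ENNReal.mul_le_mul_iff_right (by simpa using hK) ENNReal.ofReal_ne_top).1 h2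

/-- For each `ε` the bound `K * a i` eventually falls below `δ`. -/
lemma IsBigOp.tendsto_measure_le {E : Type*} [Norm E] {f : ι → Ω → E} (hf : IsBigOp μ f a l)
    (ha : Tendsto a l (𝓝 0)) {δ : ℝ} (hδ : 0 < δ) :
    Tendsto (fun i => μ {ω | δ ≤ ‖f i ω‖}) l (𝓝 0) := by
  refine ENNReal.tendsto_nhds_zero.2 fun ε hε => ?_
  rcases eq_or_ne ε ⊤ with rfl | htop
  · simp
  obtain ⟨K, hK⟩ := hf ε.toReal (ENNReal.toReal_pos hε.ne' htop)
  have h1 : Tendsto (fun i => K * a i) l (𝓝 0) := by simpa using ha.const_mul K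
  filter_upwards [hK, h1.eventually_lt_const hδ] with i h2 h3
  rw [ENNReal.ofReal_toReal htop] at h2
  exact (measure_mono fun ω hω => lt_of_lt_of_le h3 hω).trans h2

lemma isBigOp_const (μ : Measure Ω) {c : ι → ℝ} {C : ℝ} (h : ∀ᶠ i in l, ‖c i‖ ≤ C * a i) :
    IsBigOp μ (fun i _ => c i) a l := by
  intro ε hε
  refine ⟨C, ?_⟩
  filter_upwards [h] with i hi
  rw [show {ω : Ω | C * a i < ‖c i‖} = ∅ from Set.eq_empty_of_forall_notMem fun _ h => not_lt.2 hi h,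
    measure_empty]
  exact zero_le

lemma lintegral_ofReal_average_le {T : ℕ} {f : ℕ → Ω → ℝ} {C : ℝ}
    (hm : ∀ t ∈ Finset.Icc 1 T, Measurable (f t)) (h0 : ∀ t ω, 0 ≤ f t ω)
    (h : ∀ t ∈ Finset.Icc 1 T, ∫⁻ ω, ENNReal.ofReal (f t ω) ∂μ ≤ ENNReal.ofReal C) :
    ∫⁻ ω, ENNReal.ofReal ((T : ℝ)⁻¹ * ∑ t ∈ Finset.Icc 1 T, f t ω) ∂μ ≤ ENNReal.ofReal C := by
  have h1 : ∀ ω, ENNReal.ofReal ((T : ℝ)⁻¹ * ∑ t ∈ Finset.Icc 1 T, f t ω) =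
      ENNReal.ofReal (T : ℝ)⁻¹ * ∑ t ∈ Finset.Icc 1 T, ENNReal.ofReal (f t ω) := fun ω => by
    rw [ENNReal.ofReal_mul (by positivity), ENNReal.ofReal_sum_of_nonneg fun t _ => h0 t ω]
  simp only [h1]
  rw [lintegral_const_mul' _ _ ENNReal.ofReal_ne_top,
    lintegral_finsetSum' _ fun t ht => (hm t ht).ennreal_ofReal.aemeasurable]
  calc _ ≤ ENNReal.ofReal (T : ℝ)⁻¹ * ∑ t ∈ Finset.Icc 1 T, ENNReal.ofReal C := by
        gcongr with t ht; exact h t ht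
    _ ≤ ENNReal.ofReal C := by
        rw [Finset.sum_const, Nat.card_Icc, Nat.add_sub_cancel, nsmul_eq_mul, ← mul_assoc,
          ← ENNReal.ofReal_natCast, ← ENNReal.ofReal_mul (by positivity)]
        refine (mul_le_mul_left (ENNReal.ofReal_le_one.2 ?_) _).trans_eq (one_mul _)
        rcases Nat.eq_zero_or_pos T with rfl | hT
        · simp
        · rw [inv_mul_cancel₀ (by positivity)]

/-- Weakly convergent sequences are stochastically bounded. -/
lemma isBigOp_one_of_tendstoInDistribution [IsProbabilityMeasure μ] {E Ω' : Type*}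
    [NormedAddCommGroup E] [MeasurableSpace E] [BorelSpace E] [MeasurableSpace Ω']
    {μ' : Measure Ω'} [IsProbabilityMeasure μ'] {Z : ℕ → Ω → E} {Y : Ω' → E}
    (h : TendstoInDistribution Z atTop Y (fun _ => μ) μ') :
    IsBigOp μ Z (fun _ => 1) atTop := by
  intro ε hε
  set P : ProbabilityMeasure E :=
    ⟨μ'.map Y, Measure.isProbabilityMeasure_map h.aemeasurable_limit⟩ with hP
  have hcl : ∀ K : ℕ, IsClosed {x : E | (K : ℝ) ≤ ‖x‖} := fun K =>
    isClosed_le continuous_const continuous_norm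
  -- A single limit law has small tails. The tails are closed, so the portmanteau inequality passes
  -- the bound to all large indices.
  have htend : Tendsto (fun K : ℕ => (P : Measure E) {x : E | (K : ℝ) ≤ ‖x‖}) atTop (𝓝 0) := by
    have h1 : ⋂ K : ℕ, {x : E | (K : ℝ) ≤ ‖x‖} = ∅ := by
      ext x
      simp only [Set.mem_iInter, Set.mem_ofPred_eq, Set.mem_empty_iff_false, iff_false, not_forall,
        not_le]
      exact exists_nat_gt _
    rw [← measure_empty (μ := (P : Measure E)), ← h1]
    exact tendsto_measure_iInter_atTop (fun K => (hcl K).measurableSet.nullMeasurableSet)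
      (fun i j hij x hx => by
        simp only [Set.mem_ofPred_eq] at hx ⊢
        exact le_trans (by exact_mod_cast hij) hx) ⟨0, measure_ne_top _ _⟩
  obtain ⟨K, hK⟩ := (htend.eventually_lt_const (ENNReal.ofReal_pos.2 hε)).exists
  refine ⟨K, ?_⟩
  have hls := ProbabilityMeasure.limsup_measure_closed_le_of_tendsto h.tendsto (hcl K)
  filter_upwards [eventually_lt_of_limsup_lt (lt_of_le_of_lt hls hK)] with T hT
  rw [mul_one]
  refine le_trans ?_ hT.le
  rw [ProbabilityMeasure.coe_mk,
    Measure.map_apply_of_aemeasurable (h.forall_aemeasurable T) (hcl K).measurableSet]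
  refine measure_mono fun ω hω => ?_
  simp only [Set.mem_ofPred_eq, Set.mem_preimage] at hω ⊢
  exact hω.le

end StochasticOrder

/-! ### Second-moment matrices of random matrices. -/

section Moments

variable {Ω : Type*} [MeasurableSpace Ω] {μ : Measure Ω} {ι κ π τ : Type*}

lemma measurable_entry {A : Ω → Matrix ι π ℝ} (hA : Measurable A) (i : ι) (p : π) :
    Measurable fun ω => A ω i p :=
  (measurable_pi_apply p).comp ((measurable_pi_apply i).comp hA)

lemma measurable_of_entries {A : Ω → Matrix ι π ℝ} (hA : ∀ i p, Measurable fun ω => A ω i p) :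
    Measurable A :=
  measurable_pi_lambda _ fun i => measurable_pi_lambda _ fun p => hA i p

lemma measurable_const_mul [Fintype ι] {A : Ω → Matrix ι π ℝ} (hA : Measurable A)
    (G : Matrix κ ι ℝ) : Measurable fun ω => G * A ω := by
  refine measurable_of_entries fun k p => ?_
  simp only [Matrix.mul_apply]
  exact Finset.measurable_sum _ fun i _ => (measurable_entry hA i p).const_mul _

/-- All entries of the random matrix are square-integrable. -/
def SqIntegrable (μ : Measure Ω) (A : Ω → Matrix ι π ℝ) : Prop :=
  ∀ i p, MemLp (fun ω => A ω i p) 2 μ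

lemma SqIntegrable.const_mul [Fintype ι] {A : Ω → Matrix ι π ℝ} (hA : SqIntegrable μ A)
    (G : Matrix κ ι ℝ) : SqIntegrable μ fun ω => G * A ω := by
  intro k p
  simp only [Matrix.mul_apply]
  exact memLp_finsetSum _ fun i _ => (hA i p).const_mul _

lemma SqIntegrable.congr {A B : Ω → Matrix ι π ℝ} (hA : SqIntegrable μ A) (h : A =ᵐ[μ] B) :
    SqIntegrable μ B := fun i p =>
  (memLp_congr_ae (by filter_upwards [h] with ω hω; rw [hω])).1 (hA i p)

lemma SqIntegrable.add {A B : Ω → Matrix ι π ℝ} (hA : SqIntegrable μ A) (hB : SqIntegrable μ B) :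
    SqIntegrable μ fun ω => A ω + B ω := fun i p => (hA i p).add (hB i p)

variable [Fintype π]

lemma SqIntegrable.integrable_mul {A : Ω → Matrix ι π ℝ} {B : Ω → Matrix κ π ℝ}
    (hA : SqIntegrable μ A) (hB : SqIntegrable μ B) (i : ι) (k : κ) :
    Integrable (fun ω => (A ω * (B ω)ᵀ) i k) μ := by
  simp only [Matrix.mul_apply, Matrix.transpose_apply]
  exact integrable_finsetSum _ fun p _ => (hA i p).integrable_mul (hB k p)

lemma crossMoment_congr {A A' : Ω → Matrix ι π ℝ} {B B' : Ω → Matrix κ π ℝ} (hA : A =ᵐ[μ] A')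
    (hB : B =ᵐ[μ] B') : crossMoment μ A B = crossMoment μ A' B' := by
  ext i k
  refine integral_congr_ae ?_
  filter_upwards [hA, hB] with ω h1 h2
  rw [h1, h2]

lemma crossMoment_transpose (A : Ω → Matrix ι π ℝ) (B : Ω → Matrix κ π ℝ) :
    (crossMoment μ A B)ᵀ = crossMoment μ B A := by
  ext i k
  simp [crossMoment, Matrix.mul_apply, mul_comm]

lemma crossMoment_const_mul [Fintype ι] {A : Ω → Matrix ι π ℝ} {B : Ω → Matrix κ π ℝ}
    (hA : SqIntegrable μ A) (hB : SqIntegrable μ B) (G : Matrix τ ι ℝ) :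
    crossMoment μ (fun ω => G * A ω) B = G * crossMoment μ A B := by
  ext i k
  have h : ∀ ω, (G * A ω * (B ω)ᵀ) i k = ∑ j, G i j * (A ω * (B ω)ᵀ) j k := fun ω => by
    rw [Matrix.mul_assoc, Matrix.mul_apply]
  simp only [crossMoment, Matrix.of_apply, h, Matrix.mul_apply (M := G)]
  rw [integral_finsetSum _ fun j _ => (hA.integrable_mul hB j k).const_mul _]
  simp only [integral_const_mul]

lemma crossMoment_const_mul_const_mul [Fintype ι] [Fintype κ] {σ : Type*} {A : Ω → Matrix ι π ℝ}
    {B : Ω → Matrix κ π ℝ} (hA : SqIntegrable μ A) (hB : SqIntegrable μ B) (G : Matrix τ ι ℝ)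
    (H : Matrix σ κ ℝ) :
    crossMoment μ (fun ω => G * A ω) (fun ω => H * B ω) = G * crossMoment μ A B * Hᵀ := by
  rw [crossMoment_const_mul hA (hB.const_mul H), ← crossMoment_transpose,
    crossMoment_const_mul hB hA, Matrix.transpose_mul, crossMoment_transpose, Matrix.mul_assoc]

lemma crossMoment_add_left {A A' : Ω → Matrix ι π ℝ} {B : Ω → Matrix κ π ℝ}
    (hA : SqIntegrable μ A) (hA' : SqIntegrable μ A') (hB : SqIntegrable μ B) :
    crossMoment μ (fun ω => A ω + A' ω) B = crossMoment μ A B + crossMoment μ A' B := by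
  ext i k
  simp only [crossMoment, Matrix.of_apply, Matrix.add_apply]
  rw [← integral_add (hA.integrable_mul hB i k) (hA'.integrable_mul hB i k)]
  simp [Matrix.add_mul]

lemma crossMoment_add_right {A : Ω → Matrix ι π ℝ} {B B' : Ω → Matrix κ π ℝ}
    (hA : SqIntegrable μ A) (hB : SqIntegrable μ B) (hB' : SqIntegrable μ B') :
    crossMoment μ A (fun ω => B ω + B' ω) = crossMoment μ A B + crossMoment μ A B' := by
  rw [← crossMoment_transpose, crossMoment_add_left hB hB' hA, Matrix.transpose_add,
    crossMoment_transpose, crossMoment_transpose]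

lemma isHermitian_crossMoment (A : Ω → Matrix ι π ℝ) : (crossMoment μ A A).IsHermitian := by
  rw [Matrix.IsHermitian, Matrix.conjTranspose_eq_transpose_of_trivial, crossMoment_transpose]

lemma crossMoment_self_diag_nonneg (A : Ω → Matrix ι π ℝ) (i : ι) : 0 ≤ crossMoment μ A A i i :=
  integral_nonneg fun ω => by
    simp only [Matrix.mul_apply, Matrix.transpose_apply]
    exact Finset.sum_nonneg fun p _ => mul_self_nonneg _

/-- The form is the second moment of the one-row matrix `x'A`. -/
lemma dotProduct_crossMoment_nonneg [Fintype ι] {A : Ω → Matrix ι π ℝ} (hA : SqIntegrable μ A)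
    (x : ι → ℝ) : 0 ≤ x ⬝ᵥ (crossMoment μ A A *ᵥ x) := by
  have h := crossMoment_self_diag_nonneg (μ := μ)
    (fun ω => Matrix.replicateRow Unit x * A ω) ()
  rw [crossMoment_const_mul_const_mul hA hA, Matrix.transpose_replicateRow, Matrix.mul_assoc] at h
  exact h

lemma SqIntegrable.lintegral_norm_sq [Fintype ι] {A : Ω → Matrix ι π ℝ} (hA : SqIntegrable μ A) :
    ∫⁻ ω, ENNReal.ofReal (‖A ω‖ ^ 2) ∂μ = ENNReal.ofReal (∑ i, crossMoment μ A A i i) := by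
  have h : ∀ ω, ‖A ω‖ ^ 2 = ∑ i, (A ω * (A ω)ᵀ) i i := fun ω => by
    rw [frobenius_norm_sq]
    simp [Matrix.mul_apply, sq]
  simp only [h, crossMoment, Matrix.of_apply]
  rw [← integral_finsetSum _ fun i _ => hA.integrable_mul hA i i,
    ofReal_integral_eq_lintegral_ofReal
      (integrable_finsetSum _ fun i _ => hA.integrable_mul hA i i)]
  exact .of_forall fun ω => (sq_nonneg ‖A ω‖).trans_eq (h ω)

/-- The left side is the trace of `G' E(AA') G`, a sum of quadratic forms over the columns of `G`.
For `G = U` this gives order `m`, whereas bounding `‖U‖² ‖E‖²` would give `m²`. -/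
lemma lintegral_norm_transpose_mul_sq_le [Fintype ι] [Fintype κ] {A : Ω → Matrix ι π ℝ}
    (hA : SqIntegrable μ A) {lam : ℝ}
    (hlam : ∀ x : ι → ℝ, x ⬝ᵥ (crossMoment μ A A *ᵥ x) ≤ lam * (x ⬝ᵥ x)) (G : Matrix ι κ ℝ) :
    ∫⁻ ω, ENNReal.ofReal (‖Gᵀ * A ω‖ ^ 2) ∂μ ≤ ENNReal.ofReal (lam * ‖G‖ ^ 2) := by
  rw [(hA.const_mul Gᵀ).lintegral_norm_sq, crossMoment_const_mul_const_mul hA hA,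
    Matrix.transpose_transpose, Matrix.mul_assoc]
  refine ENNReal.ofReal_le_ofReal ?_
  calc ∑ k, (Gᵀ * (crossMoment μ A A * G)) k k
      = ∑ k, G.col k ⬝ᵥ (crossMoment μ A A *ᵥ G.col k) := rfl
    _ ≤ ∑ k, lam * (G.col k ⬝ᵥ G.col k) := Finset.sum_le_sum fun k _ => hlam _
    _ = lam * ‖G‖ ^ 2 := by
        rw [← Finset.mul_sum, frobenius_norm_sq, Finset.sum_comm]
        simp [dotProduct, sq]

/-- Cauchy–Schwarz for a possibly degenerate form: the quadratic polynomial in `t` given by the form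
at `x + t • z` is nonnegative, so its discriminant is not positive. -/
lemma sq_dotProduct_mulVec_le {m : ℕ} {C : Matrix (Fin m) (Fin m) ℝ} (hC : C.IsHermitian)
    (h0 : ∀ x, 0 ≤ x ⬝ᵥ (C *ᵥ x)) (x z : Fin m → ℝ) :
    (x ⬝ᵥ (C *ᵥ z)) ^ 2 ≤ (x ⬝ᵥ (C *ᵥ x)) * (z ⬝ᵥ (C *ᵥ z)) := by
  have hsym : z ⬝ᵥ (C *ᵥ x) = x ⬝ᵥ (C *ᵥ z) := by
    rw [dotProduct_mulVec_comm_of_isHermitian hC, dotProduct_comm]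
  have h := discrim_le_zero (a := z ⬝ᵥ (C *ᵥ z)) (b := 2 * (x ⬝ᵥ (C *ᵥ z)))
    (c := x ⬝ᵥ (C *ᵥ x)) fun t => by
      have h1 := h0 (x + t • z)
      simp only [Matrix.mulVec_add, Matrix.mulVec_smul, dotProduct_add, add_dotProduct,
        smul_dotProduct, dotProduct_smul, smul_eq_mul, hsym] at h1
      linarith
  rw [discrim] at h
  linarith

/-- Bilinear form of the sum of a matrix with given Frobenius norm and a positive semidefinite
matrix with bounded eigenvalues. -/
lemma sq_dotProduct_add_mulVec_le {m : ℕ} {A C : Matrix (Fin m) (Fin m) ℝ} (hC : C.IsHermitian)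
    (h0 : ∀ x, 0 ≤ x ⬝ᵥ (C *ᵥ x)) {lam : ℝ} (hlam0 : 0 ≤ lam)
    (hlam : ∀ x : Fin m → ℝ, x ⬝ᵥ (C *ᵥ x) ≤ lam * (x ⬝ᵥ x)) (x z : Fin m → ℝ) :
    (x ⬝ᵥ ((A + C) *ᵥ z)) ^ 2 ≤ (‖A‖ + lam) ^ 2 * ((x ⬝ᵥ x) * (z ⬝ᵥ z)) := by
  set p := ‖WithLp.toLp 2 x‖ with hp
  set q := ‖WithLp.toLp 2 z‖ with hq
  have hp0 : 0 ≤ p := norm_nonneg _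
  have hq0 : 0 ≤ q := norm_nonneg _
  have h1 : |x ⬝ᵥ (A *ᵥ z)| ≤ ‖A‖ * (p * q) := by
    have h2 : ∀ x' : Fin m → ℝ, ‖WithLp.toLp 2 x'‖ = p → x' ⬝ᵥ (A *ᵥ z) ≤ ‖A‖ * (p * q) := by
      intro x' hx'
      calc _ ≤ ‖WithLp.toLp 2 x'‖ * ‖WithLp.toLp 2 (A *ᵥ z)‖ := dotProduct_le_norm_mul_norm _ _
        _ ≤ p * (‖A‖ * q) := by
            rw [hx']; exact mul_le_mul_of_nonneg_left (norm_toLp_mulVec_le _ _) hp0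
        _ = _ := by ring
    refine abs_le'.2 ⟨h2 x rfl, ?_⟩
    rw [← neg_dotProduct]
    exact h2 _ (by rw [WithLp.toLp_neg, norm_neg])
  have h3 : |x ⬝ᵥ (C *ᵥ z)| ≤ lam * (p * q) := by
    refine abs_le_of_sq_le_sq ?_ (by positivity)
    refine (sq_dotProduct_mulVec_le hC h0 x z).trans ?_
    calc _ ≤ (lam * (x ⬝ᵥ x)) * (lam * (z ⬝ᵥ z)) :=
          mul_le_mul (hlam x) (hlam z) (h0 z) (mul_nonneg hlam0 (dotProduct_self_nonneg_real x))
      _ = _ := by rw [← norm_toLp_sq, ← norm_toLp_sq]; ring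
  rw [Matrix.add_mulVec, dotProduct_add, ← norm_toLp_sq, ← norm_toLp_sq, ← mul_pow, ← mul_pow,
    ← sq_abs]
  refine pow_le_pow_left₀ (abs_nonneg _) ((abs_add_le _ _).trans ?_) 2
  linarith

lemma measurable_norm_sq [Fintype ι] {A : Ω → Matrix ι π ℝ} (hA : Measurable A) :
    Measurable fun ω => ‖A ω‖ ^ 2 := by
  simp only [frobenius_norm_sq]
  exact Finset.measurable_sum _ fun i _ => Finset.measurable_sum _ fun p _ =>
    (measurable_entry hA i p).pow_const 2

lemma measurable_norm [Fintype ι] {A : Ω → Matrix ι π ℝ} (hA : Measurable A) :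
    Measurable fun ω => ‖A ω‖ := by
  have h : (fun ω => ‖A ω‖) = fun ω => √(‖A ω‖ ^ 2) := by
    ext ω; rw [Real.sqrt_sq (norm_nonneg _)]
  rw [h]
  exact (measurable_norm_sq hA).sqrt

lemma sqIntegrable_of_integrable_norm_pow_four [Fintype ι] [IsProbabilityMeasure μ]
    {A : Ω → Matrix ι π ℝ} (hA : Measurable A) (h4 : Integrable (fun ω => ‖A ω‖ ^ 4) μ) :
    SqIntegrable μ A := by
  intro i p
  rw [memLp_two_iff_integrable_sq (measurable_entry hA i p).aestronglyMeasurable]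
  refine ((integrable_const (1 : ℝ)).add h4).mono'
    ((measurable_entry hA i p).pow_const 2).aestronglyMeasurable (.of_forall fun ω => ?_)
  rw [Real.norm_eq_abs, abs_of_nonneg (sq_nonneg _), Pi.add_apply]
  have h1 : A ω i p ^ 2 ≤ ‖A ω‖ ^ 2 := by
    rw [frobenius_norm_sq]
    calc A ω i p ^ 2 ≤ ∑ q, A ω i q ^ 2 :=
          Finset.single_le_sum (f := fun q => A ω i q ^ 2) (fun _ _ => sq_nonneg _)
            (Finset.mem_univ p)
      _ ≤ _ := Finset.single_le_sum (f := fun j => ∑ q, A ω j q ^ 2)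
            (fun _ _ => Finset.sum_nonneg fun _ _ => sq_nonneg _) (Finset.mem_univ i)
  nlinarith [sq_nonneg (‖A ω‖ ^ 2 - 1)]

/-- By `t² ≤ 1 + t⁸`. The asymptotic argument works with second moments of the regressors. -/
lemma lintegral_norm_sq_le_of_pow_eight [Fintype ι] [IsProbabilityMeasure μ]
    {A : Ω → Matrix ι π ℝ} {M : ℝ} (h8 : Integrable (fun ω => ‖A ω‖ ^ 8) μ)
    (hM : ∫ ω, ‖A ω‖ ^ 8 ∂μ ≤ M) :
    ∫⁻ ω, ENNReal.ofReal (‖A ω‖ ^ 2) ∂μ ≤ ENNReal.ofReal (1 + M) := by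
  have h1 : ∀ ω, ‖A ω‖ ^ 2 ≤ 1 + ‖A ω‖ ^ 8 := fun ω => by
    rcases le_total ‖A ω‖ 1 with h | h
    · have h2 : ‖A ω‖ ^ 2 ≤ 1 := pow_le_one₀ (norm_nonneg _) h
      have h3 : 0 ≤ ‖A ω‖ ^ 8 := by positivity
      linarith
    · have h2 : ‖A ω‖ ^ 2 ≤ ‖A ω‖ ^ 8 := pow_le_pow_right₀ h (by norm_num)
      linarith
  calc _ ≤ ∫⁻ ω, ENNReal.ofReal (1 + ‖A ω‖ ^ 8) ∂μ :=
        lintegral_mono fun ω => ENNReal.ofReal_le_ofReal (h1 ω)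
    _ = ENNReal.ofReal (∫ ω, (1 + ‖A ω‖ ^ 8) ∂μ) :=
        (ofReal_integral_eq_lintegral_ofReal ((integrable_const 1).add h8)
          (.of_forall fun ω => add_nonneg zero_le_one (pow_nonneg (norm_nonneg _) _))).symm
    _ ≤ _ := by
        refine ENNReal.ofReal_le_ofReal ?_
        rw [integral_add (integrable_const 1) h8]
        simpa using hM

end Moments

/-! ### The factor model for a fixed number of layers. -/

section Layers

variable {Ω : Type*} [MeasurableSpace Ω] {μ : Measure Ω} {N r m : ℕ}

/-- What the asymptotic analysis uses about the factor model with `m` layers. -/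
structure FactorLayer (μ : Measure Ω) (W E : ℕ → Ω → Tensor3 N m) (U : Matrix (Fin m) (Fin r) ℝ)
    (Γχ ΓW : Matrix (Fin m) (Fin m) ℝ) (F : ℕ → Ω → Tensor3 N r) (c C lam R : ℝ) : Prop where
  lt : r < m
  decomposition : ∀ᵐ ω ∂μ, ∀ t, W t ω = U * F t ω + E t ω
  hermitian : Γχ.IsHermitian
  pca : ∃ V : Matrix (Fin m) (Fin r) ℝ, IsTopEigenvectors Γχ V ∧ U = V * eigSqrt r Γχ ∧
    Γχ = V * Matrix.diagonal (fun j : Fin r => eig Γχ j) * Vᵀ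
  le_eig : ∀ j : Fin r, c * m ≤ eig Γχ j
  eig_le : ∀ j : Fin r, eig Γχ j ≤ C * m
  gap : ∀ i j : Fin r, i ≠ j → c * m ≤ |eig Γχ j - eig Γχ i|
  bilinear : ∀ (A : Matrix (Fin m) (Fin m) ℝ) (x z : Fin m → ℝ),
    (x ⬝ᵥ ((A + (ΓW - Γχ)) *ᵥ z)) ^ 2 ≤ (‖A‖ + lam) ^ 2 * ((x ⬝ᵥ x) * (z ⬝ᵥ z))
  error_bound : ∀ t, ∀ {κ : Type} [Fintype κ] (G : Matrix (Fin m) κ ℝ),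
    ∫⁻ ω, ENNReal.ofReal (‖Gᵀ * E t ω‖ ^ 2) ∂μ ≤ ENNReal.ofReal (lam * ‖G‖ ^ 2)
  covariance : ∀ T : ℕ, 1 ≤ T →
    Integrable (fun ω => ‖sampleMoment (fun t => W t ω) T - ΓW‖ ^ 2) μ ∧
    ∫ ω, ‖sampleMoment (fun t => W t ω) T - ΓW‖ ^ 2 ∂μ ≤ (m : ℝ) ^ 2 * (R / T)

/-- Column `j` of the loadings has squared length `eig A j`. -/
lemma IsTopEigenvectors.norm_loadings_sq_le {A : Matrix (Fin m) (Fin m) ℝ}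
    {V : Matrix (Fin m) (Fin r) ℝ} (hV : IsTopEigenvectors A V) {b : ℝ}
    (h0 : ∀ j : Fin r, 0 ≤ eig A j) (hb : ∀ j : Fin r, eig A j ≤ b) :
    ‖V * eigSqrt r A‖ ^ 2 ≤ r * b := by
  rw [frobenius_norm_sq, Finset.sum_comm]
  have h1 : ∀ j : Fin r, ∑ i, (V * eigSqrt r A) i j ^ 2 ≤ b := by
    intro j
    have h2 : ∀ i, (V * eigSqrt r A) i j ^ 2 = V i j * V i j * eig A j := fun i => by
      rw [eigSqrt, Matrix.mul_diagonal, mul_pow, Real.sq_sqrt (h0 j), sq]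
    have h3 : ∑ i, V i j * V i j = 1 := by
      have := hV.dotProduct_col j j
      rwa [if_pos rfl] at this
    simp only [h2]
    rw [← Finset.sum_mul, h3, one_mul]
    exact hb j
  calc _ ≤ ∑ _j : Fin r, b := Finset.sum_le_sum fun j _ => h1 j
    _ = r * b := by simp

lemma exists_pos_forall_le {ι : Type*} [Finite ι] {f : ι → ℝ} (hf : ∀ i, 0 < f i) :
    ∃ c, 0 < c ∧ ∀ i, c ≤ f i := by
  rcases isEmpty_or_nonempty ι with h | h
  · exact ⟨1, one_pos, fun i => h.elim i⟩
  · obtain ⟨i, hi⟩ := Finite.exists_min f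
    exact ⟨f i, hf i, hi⟩

/-- Pervasive factors with separated eigenvalues: uniform constants. -/
lemma exists_eventually_eig_bounds (Γχ : (m : ℕ) → Matrix (Fin m) (Fin m) ℝ)
    (cund cbar : Fin r → ℝ)
    (hsep : ∀ i j : Fin r, (i : ℕ) + 1 = (j : ℕ) → cbar j < cund i)
    (hperv : ∀ j : Fin r, 0 < cund j ∧
      ((cund j : ℝ) : EReal) <
        liminf (fun m : ℕ => ((eig (Γχ m) j / (m : ℝ) : ℝ) : EReal)) atTop ∧
      limsup (fun m : ℕ => ((eig (Γχ m) j / (m : ℝ) : ℝ) : EReal)) atTop <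
        ((cbar j : ℝ) : EReal)) :
    ∃ c C : ℝ, 0 < c ∧ 0 < C ∧ ∀ᶠ m in atTop, (∀ j : Fin r, c * m ≤ eig (Γχ m) j) ∧
      (∀ j : Fin r, eig (Γχ m) j ≤ C * m) ∧
      ∀ i j : Fin r, i ≠ j → c * m ≤ |eig (Γχ m) j - eig (Γχ m) i| := by
  obtain ⟨c₁, hc₁, h₁⟩ := exists_pos_forall_le fun j => (hperv j).1
  -- Only consecutive indices carry a gap condition; the other pairs receive the dummy value `1`.
  obtain ⟨c₂, hc₂, h₂⟩ := exists_pos_forall_le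
    (f := fun p : Fin r × Fin r => if (p.1 : ℕ) + 1 = p.2 then cund p.1 - cbar p.2 else 1)
    fun p => by
      by_cases h : (p.1 : ℕ) + 1 = p.2
      · rw [if_pos h]; exact sub_pos.2 (hsep _ _ h)
      · rw [if_neg h]; exact one_pos
  have hev : ∀ᶠ m : ℕ in atTop, ∀ j : Fin r,
      cund j * m ≤ eig (Γχ m) j ∧ eig (Γχ m) j ≤ cbar j * m := by
    refine eventually_all.2 fun j => ?_
    filter_upwards [eventually_lt_of_lt_liminf (hperv j).2.1,
      eventually_lt_of_limsup_lt (hperv j).2.2, eventually_gt_atTop 0] with m h3 h4 hm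
    have hm' : (0 : ℝ) < m := by exact_mod_cast hm
    rw [EReal.coe_lt_coe_iff] at h3 h4
    exact ⟨((lt_div_iff₀ hm').1 h3).le, ((div_lt_iff₀ hm').1 h4).le⟩
  -- The summand `1` makes the upper constant positive also for `r = 0`.
  refine ⟨min c₁ c₂, ∑ j, |cbar j| + 1, lt_min hc₁ hc₂, ?_, ?_⟩
  · have : 0 ≤ ∑ j, |cbar j| := Finset.sum_nonneg fun _ _ => abs_nonneg _
    linarith
  filter_upwards [hev, eventually_gt_atTop r] with m hm hrm
  have hm0 : (0 : ℝ) ≤ m := Nat.cast_nonneg m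
  -- By monotonicity the gap from `i` to any later `j` is at least the gap from `i` to `i + 1`.
  have hgap : ∀ i j : Fin r, i < j → min c₁ c₂ * m ≤ eig (Γχ m) i - eig (Γχ m) j := by
    intro i j hij
    have hij' : (i : ℕ) + 1 ≤ j := hij
    let k : Fin r := ⟨(i : ℕ) + 1, lt_of_le_of_lt hij' j.2⟩
    have h3 : eig (Γχ m) j ≤ eig (Γχ m) k := eig_antitone _ hij' (j.2.trans hrm)
    have h4 := (hm k).2
    have h5 := (hm i).1
    have h6 := h₂ (i, k)
    simp only [k, if_true] at h6
    have h7 : min c₁ c₂ * m ≤ (cund i - cbar k) * m :=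
      mul_le_mul_of_nonneg_right ((min_le_right _ _).trans h6) hm0
    linarith
  refine ⟨fun j => ?_, fun j => ?_, fun i j hij => ?_⟩
  · exact (mul_le_mul_of_nonneg_right ((min_le_left _ _).trans (h₁ j)) hm0).trans (hm j).1
  · refine (hm j).2.trans (mul_le_mul_of_nonneg_right ?_ hm0)
    have := Finset.single_le_sum (f := fun j => |cbar j|) (fun _ _ => abs_nonneg _)
      (Finset.mem_univ j)
    have := le_abs_self (cbar j)
    linarith
  · rcases lt_or_gt_of_ne hij with h | h
    · rw [abs_sub_comm]; exact (hgap i j h).trans (le_abs_self _)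
    · exact (hgap j i h).trans (le_abs_self _)

/-- The normalization gives `E(FF') = 1`, hence `Γχ = UU'`. Uncorrelatedness of errors and factors
then identifies `ΓW - Γχ` with the error covariance. The moments of `χ` and `W` do not depend on the
date, so date `0` suffices for both facts. -/
lemma factorLayer_of_model [IsProbabilityMeasure μ] {W χ E : ℕ → Ω → Tensor3 N m}
    {U V : Matrix (Fin m) (Fin r) ℝ} {Γχ ΓW : Matrix (Fin m) (Fin m) ℝ}
    {F : ℕ → Ω → Tensor3 N r} {c C lam R : ℝ}
    (hEmeas : ∀ t, Measurable (E t)) (hF2 : ∀ t, SqIntegrable μ (F t))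
    (hWF : ∀ t, ∀ᵐ ω ∂μ, W t ω = U * F t ω + E t ω)
    (hWχ : ∀ t, ∀ᵐ ω ∂μ, W t ω = χ t ω + E t ω)
    (hΓχ : ∀ t, crossMoment μ (χ t) (χ t) = Γχ) (hV : IsTopEigenvectors Γχ V)
    (hF : ∀ t, ∀ᵐ ω ∂μ, F t ω = eigInvSqrt r Γχ * Vᵀ * χ t ω)
    (hU : U = V * eigSqrt r Γχ)
    (hE4 : ∀ t, Integrable (fun ω => ‖E t ω‖ ^ 4) μ)
    (hEF : ∀ t, crossMoment μ (E t) (F t) = 0)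
    (hlam : ∀ t, eig (crossMoment μ (E t) (E t)) 0 ≤ lam) (hlam0 : 0 ≤ lam)
    (hΓW : ∀ t, crossMoment μ (W t) (W t) = ΓW)
    (hR : ∀ T : ℕ, 1 ≤ T → ∀ i j : Fin m,
      Integrable (fun ω => (sampleMoment (fun t => W t ω) T i j - ΓW i j) ^ 2) μ ∧
      (T : ℝ) * ∫ ω, (sampleMoment (fun t => W t ω) T i j - ΓW i j) ^ 2 ∂μ < R)
    (hc : 0 < c) (hrm : r < m) (hlow : ∀ j : Fin r, c * m ≤ eig Γχ j)
    (hup : ∀ j : Fin r, eig Γχ j ≤ C * m)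
    (hgap : ∀ i j : Fin r, i ≠ j → c * m ≤ |eig Γχ j - eig Γχ i|) :
    FactorLayer μ W E U Γχ ΓW F c C lam R := by
  have hm : (0 : ℝ) < m := by exact_mod_cast (Nat.zero_le r).trans_lt hrm
  have hpos : ∀ j : Fin r, 0 < eig Γχ j := fun j => lt_of_lt_of_le (by positivity) (hlow j)
  have hEL : ∀ t, SqIntegrable μ (E t) := fun t =>
    sqIntegrable_of_integrable_norm_pow_four (hEmeas t) (hE4 t)
  have hχU : χ 0 =ᵐ[μ] fun ω => U * F 0 ω := by
    filter_upwards [hWF 0, hWχ 0] with ω h1 h2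
    exact add_right_cancel (h2.symm.trans h1)
  have hχL : SqIntegrable μ (χ 0) := ((hF2 0).const_mul U).congr hχU.symm
  have hFF : crossMoment μ (F 0) (F 0) = 1 := by
    rw [crossMoment_congr (hF 0) (hF 0), crossMoment_const_mul_const_mul hχL hχL, hΓχ 0,
      Matrix.transpose_mul, Matrix.transpose_transpose, Matrix.mul_assoc (eigInvSqrt r Γχ),
      Matrix.mul_assoc (eigInvSqrt r Γχ), Matrix.mul_assoc Vᵀ, ← Matrix.mul_assoc Γχ, hV.eigen,
      ← Matrix.mul_assoc Vᵀ, ← Matrix.mul_assoc Vᵀ, hV.orthonormal, Matrix.one_mul, eigInvSqrt,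
      Matrix.diagonal_transpose, Matrix.diagonal_mul_diagonal, Matrix.diagonal_mul_diagonal]
    have : ∀ j : Fin r, (√(eig Γχ j))⁻¹ * (eig Γχ j * (√(eig Γχ j))⁻¹) = 1 := fun j => by
      have h1 := Real.sqrt_pos.2 (hpos j)
      have h2 := Real.mul_self_sqrt (hpos j).le
      field_simp
      rw [sq, h2]
    simp [this]
  have hΓU : Γχ = U * Uᵀ := by
    rw [← hΓχ 0, crossMoment_congr hχU hχU, crossMoment_const_mul_const_mul (hF2 0) (hF2 0), hFF,
      Matrix.mul_one]
  -- The first `r` eigenpairs exhaust `Γχ`, because `UU'` has rank at most `r`.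
  have hspec : Γχ = V * Matrix.diagonal (fun j : Fin r => eig Γχ j) * Vᵀ := by
    have h1 : eigSqrt r Γχ * (eigSqrt r Γχ)ᵀ = Matrix.diagonal (fun j : Fin r => eig Γχ j) := by
      rw [eigSqrt, Matrix.diagonal_transpose, Matrix.diagonal_mul_diagonal]
      congr 1
      ext j
      exact Real.mul_self_sqrt (hpos j).le
    rw [← h1, ← Matrix.mul_assoc V, ← hU, Matrix.mul_assoc, ← Matrix.transpose_mul, ← hU]
    exact hΓU
  have hFE : crossMoment μ (F 0) (E 0) = 0 := by
    rw [← crossMoment_transpose, hEF 0, Matrix.transpose_zero]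
  have hΓE : ΓW - Γχ = crossMoment μ (E 0) (E 0) := by
    have hUF := (hF2 0).const_mul U
    rw [← hΓW 0, crossMoment_congr (hWF 0) (hWF 0),
      crossMoment_add_left hUF (hEL 0) (hUF.add (hEL 0)), crossMoment_add_right hUF hUF (hEL 0),
      crossMoment_add_right (hEL 0) hUF (hEL 0),
      crossMoment_const_mul_const_mul (hF2 0) (hF2 0), hFF, crossMoment_const_mul (hF2 0) (hEL 0),
      hFE, ← crossMoment_transpose (fun ω => U * F 0 ω), crossMoment_const_mul (hF2 0) (hEL 0), hFE,
      Matrix.mul_zero, Matrix.mul_one, ← hΓU, Matrix.transpose_zero]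
    abel
  have hquad : ∀ t (x : Fin m → ℝ),
      x ⬝ᵥ (crossMoment μ (E t) (E t) *ᵥ x) ≤ lam * (x ⬝ᵥ x) := fun t x =>
    (dotProduct_mulVec_le_eig_zero (isHermitian_crossMoment _) x).trans
      (mul_le_mul_of_nonneg_right (hlam t) (dotProduct_self_nonneg_real x))
  refine ⟨hrm, ae_all_iff.2 hWF, hΓχ 0 ▸ isHermitian_crossMoment _, ⟨V, hV, hU, hspec⟩, hlow, hup,
    hgap, fun A x z => ?_, fun t κ _ G => ?_, fun T hT => ?_⟩
  · rw [hΓE]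
    exact sq_dotProduct_add_mulVec_le (isHermitian_crossMoment _)
      (dotProduct_crossMoment_nonneg (hEL 0)) hlam0 (hquad 0) x z
  · exact lintegral_norm_transpose_mul_sq_le (hEL t) (hquad t) G
  · have hT' : (0 : ℝ) < T := by exact_mod_cast hT
    have h1 : ∀ ω, ‖sampleMoment (fun t => W t ω) T - ΓW‖ ^ 2 =
        ∑ i, ∑ j, (sampleMoment (fun t => W t ω) T i j - ΓW i j) ^ 2 := fun ω => by
      rw [frobenius_norm_sq]; rfl
    simp only [h1]
    refine ⟨integrable_finsetSum _ fun i _ => integrable_finsetSum _ fun j _ => (hR T hT i j).1, ?_⟩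
    rw [integral_finsetSum _ fun i _ => integrable_finsetSum _ fun j _ => (hR T hT i j).1]
    calc _ ≤ ∑ _i : Fin m, ∑ _j : Fin m, R / T := by
          refine Finset.sum_le_sum fun i _ => ?_
          rw [integral_finsetSum _ fun j _ => (hR T hT i j).1]
          refine Finset.sum_le_sum fun j _ => ?_
          rw [le_div_iff₀ hT', mul_comm]
          exact (hR T hT i j).2.le
      _ = _ := by simp; ring

end Layers

/-! ### Joint limits: covariance error, good event, loadings. -/

section Asymptotics

variable {Ω : Type*} [MeasurableSpace Ω] {μ : Measure Ω} {N r : ℕ}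

/-- The rate `max(T^{-1/2}, m^{-1})`. -/
noncomputable def loadingRate (p : ℕ × ℕ) : ℝ := max (√(p.2 : ℝ))⁻¹ (p.1 : ℝ)⁻¹

/-- The rate `max(T^{-1/2}, m^{-1/2})`. -/
noncomputable def factorRate (p : ℕ × ℕ) : ℝ := max (√(p.2 : ℝ))⁻¹ (√(p.1 : ℝ))⁻¹

lemma loadingRate_nonneg (p : ℕ × ℕ) : 0 ≤ loadingRate p := le_max_of_le_left (by positivity)

lemma factorRate_nonneg (p : ℕ × ℕ) : 0 ≤ factorRate p := le_max_of_le_left (by positivity)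

lemma tendsto_sqrt_inv : Tendsto (fun n : ℕ => (√(n : ℝ))⁻¹) atTop (𝓝 0) :=
  tendsto_inv_atTop_zero.comp (Real.tendsto_sqrt_atTop.comp tendsto_natCast_atTop_atTop)

lemma tendsto_factorRate : Tendsto factorRate (atTop ×ˢ atTop) (𝓝 0) := by
  have h := (tendsto_sqrt_inv.comp (tendsto_snd (f := (atTop : Filter ℕ)) (g := atTop))).max
    (tendsto_sqrt_inv.comp (tendsto_fst (f := (atTop : Filter ℕ)) (g := (atTop : Filter ℕ))))
  rwa [max_self] at h

lemma eventually_fst {P : ℕ → Prop} (h : ∀ᶠ m in atTop, P m) :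
    ∀ᶠ p : ℕ × ℕ in atTop ×ˢ atTop, P p.1 := tendsto_fst.eventually h

lemma eventually_snd {P : ℕ → Prop} (h : ∀ᶠ m in atTop, P m) :
    ∀ᶠ p : ℕ × ℕ in atTop ×ˢ atTop, P p.2 := tendsto_snd.eventually h

lemma loadingRate_le_factorRate :
    ∀ᶠ p in (atTop : Filter ℕ) ×ˢ (atTop : Filter ℕ), loadingRate p ≤ factorRate p := by
  filter_upwards [eventually_fst (eventually_ge_atTop 1)] with p hp
  refine max_le_max le_rfl ?_
  have h1 : (1 : ℝ) ≤ p.1 := by exact_mod_cast hp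
  refine inv_anti₀ (Real.sqrt_pos.2 (by linarith)) ?_
  rw [Real.sqrt_le_left (by linarith)]
  nlinarith

lemma tendsto_loadingRate : Tendsto loadingRate (atTop ×ˢ atTop) (𝓝 0) :=
  tendsto_of_tendsto_of_tendsto_of_le_of_le' tendsto_const_nhds tendsto_factorRate
    (.of_forall loadingRate_nonneg) loadingRate_le_factorRate

variable {W E : (m : ℕ) → ℕ → Ω → Tensor3 N m} {U : (m : ℕ) → Matrix (Fin m) (Fin r) ℝ}
  {Γχ ΓW : (m : ℕ) → Matrix (Fin m) (Fin m) ℝ} {F : ℕ → Ω → Tensor3 N r} {c C lam R : ℝ}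
  {Vhat : (m : ℕ) → ℕ → Ω → Matrix (Fin m) (Fin r) ℝ}

/-- A bound for the distance of `m⁻¹ Γ̂` from `m⁻¹ Γχ`. -/
noncomputable def covarianceError (W : (m : ℕ) → ℕ → Ω → Tensor3 N m)
    (ΓW : (m : ℕ) → Matrix (Fin m) (Fin m) ℝ) (lam : ℝ) (p : ℕ × ℕ) (ω : Ω) : ℝ :=
  (p.1 : ℝ)⁻¹ * ‖sampleMoment (fun t => W p.1 t ω) p.2 - ΓW p.1‖ + lam * (p.1 : ℝ)⁻¹

omit [MeasurableSpace Ω] in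
lemma covarianceError_nonneg (hlam0 : 0 ≤ lam) (p : ℕ × ℕ) (ω : Ω) :
    0 ≤ covarianceError W ΓW lam p ω := by
  unfold covarianceError; positivity

/-- The `m²` entries have mean-square errors of order `1 / T`, so Markov's inequality gives
`T^{-1/2}` for the Frobenius norm divided by `m`. The error covariance contributes the deterministic
`lam / m`. -/
lemma isBigOp_covarianceError (hlam0 : 0 ≤ lam)
    (hL : ∀ᶠ m in atTop, FactorLayer μ (W m) (E m) (U m) (Γχ m) (ΓW m) F c C lam R) :
    IsBigOp μ (covarianceError W ΓW lam) loadingRate (atTop ×ˢ atTop) := by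
  refine IsBigOp.add ?_ ?_
  · refine IsBigOp.mono_rate (a := fun p : ℕ × ℕ => (√(p.2 : ℝ))⁻¹) (C := 1)
      (IsBigOp.of_sq ?_ (.of_forall fun p => by positivity))
      (.of_forall fun p => ⟨by positivity, by rw [one_mul]; exact le_max_left _ _⟩)
    refine isBigOp_of_lintegral_le (C := R) ?_ ?_ (.of_forall fun p ω => sq_nonneg _) ?_
    · filter_upwards [eventually_snd (eventually_ge_atTop 1)] with p hp
      have : (0 : ℝ) < p.2 := by exact_mod_cast hp
      positivity
    · filter_upwards [eventually_fst hL, eventually_snd (eventually_ge_atTop 1)] with p h hp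
      simp only [mul_pow]
      exact (h.covariance p.2 hp).1.aemeasurable.const_mul _
    · filter_upwards [eventually_fst hL, eventually_snd (eventually_ge_atTop 1)] with p h hp
      obtain ⟨h1, h2⟩ := h.covariance p.2 hp
      have hm : (0 : ℝ) < p.1 := by exact_mod_cast (Nat.zero_le r).trans_lt h.lt
      simp only [mul_pow]
      rw [← ofReal_integral_eq_lintegral_ofReal (h1.const_mul _)
        (.of_forall fun ω => by positivity), integral_const_mul]
      refine ENNReal.ofReal_le_ofReal ?_
      refine (mul_le_mul_of_nonneg_left h2 (by positivity)).trans_eq ?_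
      rw [inv_pow, inv_pow, Real.sq_sqrt (by positivity)]
      field_simp
  · refine isBigOp_const μ (C := lam) (.of_forall fun p => ?_)
    rw [Real.norm_eq_abs, abs_of_nonneg (by positivity)]
    exact mul_le_mul_of_nonneg_left (le_max_right _ _) hlam0

/-- The event on which the sample second moment is far from the population one, or the factor
decomposition fails. -/
def badEvent (W E : (m : ℕ) → ℕ → Ω → Tensor3 N m) (U : (m : ℕ) → Matrix (Fin m) (Fin r) ℝ)
    (ΓW : (m : ℕ) → Matrix (Fin m) (Fin m) ℝ) (F : ℕ → Ω → Tensor3 N r) (c lam : ℝ)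
    (p : ℕ × ℕ) : Set Ω :=
  {ω | c / 2 ≤ ‖covarianceError W ΓW lam p ω‖} ∪
    {ω | ¬ ∀ t, W p.1 t ω = U p.1 * F t ω + E p.1 t ω}

lemma tendsto_measure_badEvent (hc : 0 < c) (hlam0 : 0 ≤ lam)
    (hL : ∀ᶠ m in atTop, FactorLayer μ (W m) (E m) (U m) (Γχ m) (ΓW m) F c C lam R) :
    Tendsto (fun p => μ (badEvent W E U ΓW F c lam p)) (atTop ×ˢ atTop) (𝓝 0) := by
  have h1 := (isBigOp_covarianceError hlam0 hL).tendsto_measure_le tendsto_loadingRate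
    (half_pos hc)
  refine tendsto_of_tendsto_of_tendsto_of_le_of_le' tendsto_const_nhds h1
    (.of_forall fun _ => zero_le) ?_
  filter_upwards [eventually_fst hL] with p h
  refine (measure_union_le _ _).trans_eq ?_
  rw [ae_iff.1 h.decomposition, add_zero]

lemma FactorLayer.bilinear_sampleMoment {p : ℕ × ℕ}
    (h : FactorLayer μ (W p.1) (E p.1) (U p.1) (Γχ p.1) (ΓW p.1) F c C lam R) (ω : Ω)
    (x z : Fin p.1 → ℝ) :
    (x ⬝ᵥ ((sampleMoment (fun t => W p.1 t ω) p.2 - Γχ p.1) *ᵥ z)) ^ 2 ≤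
      (p.1 * covarianceError W ΓW lam p ω) ^ 2 * ((x ⬝ᵥ x) * (z ⬝ᵥ z)) := by
  have hm : (0 : ℝ) < p.1 := by exact_mod_cast (Nat.zero_le r).trans_lt h.lt
  have h1 := h.bilinear (sampleMoment (fun t => W p.1 t ω) p.2 - ΓW p.1) x z
  rw [sub_add_sub_cancel] at h1
  have h2 : (p.1 : ℝ) * covarianceError W ΓW lam p ω =
      ‖sampleMoment (fun t => W p.1 t ω) p.2 - ΓW p.1‖ + lam := by
    unfold covarianceError
    field_simp
  rwa [h2]

lemma isHermitian_sampleMoment {m : ℕ} (A : ℕ → Tensor3 N m) (T : ℕ) :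
    (sampleMoment A T).IsHermitian := by
  rw [Matrix.IsHermitian, Matrix.conjTranspose_eq_transpose_of_trivial, sampleMoment,
    Matrix.transpose_smul, Matrix.transpose_sum]
  simp [Matrix.transpose_mul]

omit [MeasurableSpace Ω] in
lemma two_mul_covarianceError_le {p : ℕ × ℕ} {ω : Ω}
    (hω : ω ∉ badEvent W E U ΓW F c lam p) :
    2 * (p.1 * covarianceError W ΓW lam p ω) ≤ c * p.1 := by
  have h1 : ¬ c / 2 ≤ ‖covarianceError W ΓW lam p ω‖ := fun h => hω (Or.inl h)
  have h2 := (le_abs_self _).trans_lt (not_le.1 h1)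
  have h3 : (0 : ℝ) ≤ p.1 := Nat.cast_nonneg _
  nlinarith

/-- Off the bad event Weyl's inequality loses at most half of the population lower bound. -/
lemma le_eig_sampleMoment (hlam0 : 0 ≤ lam) {p : ℕ × ℕ} {ω : Ω}
    (h : FactorLayer μ (W p.1) (E p.1) (U p.1) (Γχ p.1) (ΓW p.1) F c C lam R)
    (hω : ω ∉ badEvent W E U ΓW F c lam p) (j : Fin r) :
    c * p.1 / 2 ≤ eig (sampleMoment (fun t => W p.1 t ω) p.2) j := by
  have h1 := (abs_le.1 (abs_eig_sub_le (isHermitian_sampleMoment (fun t => W p.1 t ω) p.2)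
    h.hermitian (mul_nonneg (Nat.cast_nonneg _) (covarianceError_nonneg hlam0 p ω))
    (h.bilinear_sampleMoment ω) (j.2.trans h.lt))).1
  have h2 := h.le_eig j
  have h3 := two_mul_covarianceError_le hω
  linarith

/-- The scaled error of the estimated loadings. -/
noncomputable def loadingError (W : (m : ℕ) → ℕ → Ω → Tensor3 N m)
    (U : (m : ℕ) → Matrix (Fin m) (Fin r) ℝ) (Vhat : (m : ℕ) → ℕ → Ω → Matrix (Fin m) (Fin r) ℝ)
    (J : ℕ → ℕ → Ω → Fin r → ℝ) (p : ℕ × ℕ) (ω : Ω) : ℝ :=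
  (√(p.1 : ℝ))⁻¹ * ‖loadingsHat (fun s => W p.1 s ω) (Vhat p.1 p.2 ω) p.2 -
    U p.1 * Matrix.diagonal (J p.1 p.2 ω)‖

omit [MeasurableSpace Ω] in
lemma loadingError_nonneg (J : ℕ → ℕ → Ω → Fin r → ℝ) (p : ℕ × ℕ) (ω : Ω) :
    0 ≤ loadingError W U Vhat J p ω := by
  unfold loadingError; positivity

lemma exists_sign_isBigOp_loadingError (hc : 0 < c) (hC : 0 < C) (hlam0 : 0 ≤ lam)
    (hL : ∀ᶠ m in atTop, FactorLayer μ (W m) (E m) (U m) (Γχ m) (ΓW m) F c C lam R)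
    (hVhat : ∀ m T ω, r < m →
      IsTopEigenvectors (sampleMoment (fun t => W m t ω) T) (Vhat m T ω)) :
    ∃ J : ℕ → ℕ → Ω → Fin r → ℝ, (∀ m T ω k, J m T ω k = 1 ∨ J m T ω k = -1) ∧
      IsBigOp μ (loadingError W U Vhat J) loadingRate (atTop ×ˢ atTop) := by
  classical
  set K : ℝ := r * (2 / c + 16 * C * r / c ^ 2) with hK
  have hK0 : 0 ≤ K := by positivity
  let P : ℕ → ℕ → Ω → (Fin r → ℝ) → Prop := fun m T ω s => (∀ k, s k = 1 ∨ s k = -1) ∧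
    ‖loadingsHat (fun s => W m s ω) (Vhat m T ω) T - U m * Matrix.diagonal s‖ ^ 2 ≤
      K * ((m * covarianceError W ΓW lam (m, T) ω) ^ 2 / m)
  -- The signs are chosen separately at each `ω`, with default `1`. No measurability is required,
  -- since `IsBigOp` also makes sense for the outer measure of arbitrary sets.
  refine ⟨fun m T ω => if h : ∃ s, P m T ω s then h.choose else fun _ => 1, fun m T ω k => ?_, ?_⟩
  · beta_reduce
    by_cases h : ∃ s, P m T ω s
    · rw [dif_pos h]; exact h.choose_spec.1 k
    · rw [dif_neg h]; exact Or.inl rfl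
  · refine ((isBigOp_covarianceError hlam0 hL).const_mul √K).of_norm_le
      (tendsto_measure_badEvent hc hlam0 hL) ?_
    filter_upwards [eventually_fst hL] with p h ω hω
    have hm : 0 < p.1 := (Nat.zero_le r).trans_lt h.lt
    have hm' : (0 : ℝ) < p.1 := by exact_mod_cast hm
    obtain ⟨V, hV, hU, hspec⟩ := h.pca
    have hex : ∃ s, P p.1 p.2 ω s := by
      obtain ⟨s, hs, hs'⟩ := exists_sign_norm_loadings_sub_sq_le
        (isHermitian_sampleMoment (fun t => W p.1 t ω) p.2) h.hermitian hV
        (hVhat p.1 p.2 ω h.lt) hspec h.lt.le hm hc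
        (mul_nonneg hm'.le (covarianceError_nonneg hlam0 p ω)) (h.bilinear_sampleMoment ω)
        h.le_eig h.eig_le h.gap (two_mul_covarianceError_le hω)
      rw [← hU] at hs'
      exact ⟨s, hs, hs'⟩
    have h1 := hex.choose_spec.2
    unfold loadingError
    beta_reduce
    rw [dif_pos hex]
    refine abs_le_abs_of_nonneg (by positivity) ?_
    refine abs_le_of_sq_le_sq (a := _) ?_
      (mul_nonneg (Real.sqrt_nonneg _) (covarianceError_nonneg hlam0 p ω)) |>
      (le_abs_self _).trans
    rw [mul_pow, mul_pow, inv_pow, Real.sq_sqrt hm'.le, Real.sq_sqrt hK0]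
    refine (mul_le_mul_of_nonneg_left h1 (by positivity)).trans_eq ?_
    field_simp

/-- Error of the estimated factors on the good event, in the normalization of the asymptotics. -/
lemma norm_factor_sub_le_loadingError {π : Type*} [Fintype π] (hc : 0 < c) (hlam0 : 0 ≤ lam)
    {p : ℕ × ℕ} {ω : Ω}
    (h : FactorLayer μ (W p.1) (E p.1) (U p.1) (Γχ p.1) (ΓW p.1) F c C lam R)
    (hω : ω ∉ badEvent W E U ΓW F c lam p)
    (hVhat : IsTopEigenvectors (sampleMoment (fun t => W p.1 t ω) p.2) (Vhat p.1 p.2 ω))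
    {J : ℕ → ℕ → Ω → Fin r → ℝ} (hJ : ∀ m T ω k, J m T ω k = 1 ∨ J m T ω k = -1)
    (B : Matrix (Fin N × Fin N) π ℝ) (t : ℕ) :
    ‖factorsHat (fun s => W p.1 s ω) (Vhat p.1 p.2 ω) p.2 t * B -
        Matrix.diagonal (J p.1 p.2 ω) * (F t ω * B)‖ ≤
      r ^ 3 * (√(2 / c) + 2 / c) * (loadingError W U Vhat J p ω * ‖F t ω * B‖ +
        (p.1 : ℝ)⁻¹ * ‖(U p.1)ᵀ * (E p.1 t ω * B)‖ +
        loadingError W U Vhat J p ω * ((√(p.1 : ℝ))⁻¹ * ‖E p.1 t ω * B‖)) := by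
  have hm : (0 : ℝ) < p.1 := by exact_mod_cast (Nat.zero_le r).trans_lt h.lt
  have hW : W p.1 t ω = U p.1 * F t ω + E p.1 t ω := by
    by_contra hne
    exact hω (Or.inr fun hall => hne (hall t))
  -- The matrix `B` on the right is the identity for the factors and `sliceMul y` for the
  -- regressors; `b` is the lower bound for the sample eigenvalues.
  have h1 := norm_factor_sub_le (U := U p.1) hVhat (hJ p.1 p.2 ω)
    (b := c * p.1 / 2) (by positivity) (le_eig_sampleMoment hlam0 h hω) (F t ω * B)
    (E p.1 t ω * B)
  rw [factorsHat, hW, Matrix.mul_assoc, Matrix.add_mul, Matrix.mul_assoc (U p.1)]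
  refine h1.trans ?_
  have hl := loadingError_nonneg (W := W) (U := U) (Vhat := Vhat) J p ω
  have e0 : ‖Vhat p.1 p.2 ω * eigSqrt r (sampleMoment (fun t => W p.1 t ω) p.2) -
      U p.1 * Matrix.diagonal (J p.1 p.2 ω)‖ = √p.1 * loadingError W U Vhat J p ω := by
    rw [loadingError, ← mul_assoc, mul_inv_cancel₀ (Real.sqrt_pos.2 hm).ne', one_mul]
    rfl
  have hs := Real.sqrt_pos.2 hm
  have e1 : √(c * p.1 / 2) = √p.1 * (√(2 / c))⁻¹ := by
    rw [← Real.sqrt_inv, ← Real.sqrt_mul hm.le]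
    congr 1
    field_simp
  have e2 : √(p.1 : ℝ) * √p.1 = p.1 := Real.mul_self_sqrt hm.le
  have hsc : 0 < √(2 / c) := Real.sqrt_pos.2 (by positivity)
  rw [e0, e1, mul_assoc]
  refine mul_le_mul_of_nonneg_left ?_ (by positivity)
  have t1 : √p.1 * loadingError W U Vhat J p ω / (√p.1 * (√(2 / c))⁻¹) * ‖F t ω * B‖ =
      √(2 / c) * (loadingError W U Vhat J p ω * ‖F t ω * B‖) := by
    field_simp
  have t2 : ‖(U p.1)ᵀ * (E p.1 t ω * B)‖ / (c * p.1 / 2) =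
      2 / c * ((p.1 : ℝ)⁻¹ * ‖(U p.1)ᵀ * (E p.1 t ω * B)‖) := by
    field_simp
  have t3 : √p.1 * loadingError W U Vhat J p ω / (c * p.1 / 2) * ‖E p.1 t ω * B‖ =
      2 / c * (loadingError W U Vhat J p ω * ((√(p.1 : ℝ))⁻¹ * ‖E p.1 t ω * B‖)) := by
    rw [show c * (p.1 : ℝ) / 2 = c * (√p.1 * √p.1) / 2 by rw [e2]]
    field_simp
  rw [t1, t2, t3]
  have n1 : 0 ≤ loadingError W U Vhat J p ω * ‖F t ω * B‖ := by positivity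
  have n2 : 0 ≤ (p.1 : ℝ)⁻¹ * ‖(U p.1)ᵀ * (E p.1 t ω * B)‖ := by positivity
  have n3 : 0 ≤ loadingError W U Vhat J p ω * ((√(p.1 : ℝ))⁻¹ * ‖E p.1 t ω * B‖) := by positivity
  have hc2 : 0 < 2 / c := by positivity
  nlinarith [mul_nonneg hc2.le n1, mul_nonneg hsc.le n2, mul_nonneg hsc.le n3]

end Asymptotics

/-! ### Rate for the estimated factors at a fixed date. -/

section FactorEstimation

variable {Ω : Type*} [MeasurableSpace Ω] {μ : Measure Ω} {N r : ℕ}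
  {W E : (m : ℕ) → ℕ → Ω → Tensor3 N m} {U : (m : ℕ) → Matrix (Fin m) (Fin r) ℝ}
  {Γχ ΓW : (m : ℕ) → Matrix (Fin m) (Fin m) ℝ} {F : ℕ → Ω → Tensor3 N r} {c C lam R : ℝ}
  {Vhat : (m : ℕ) → ℕ → Ω → Matrix (Fin m) (Fin r) ℝ} {J : ℕ → ℕ → Ω → Fin r → ℝ}

lemma FactorLayer.lintegral_loadings_mul_error_le {m : ℕ} {W E : ℕ → Ω → Tensor3 N m}
    {U : Matrix (Fin m) (Fin r) ℝ} {Γχ ΓW : Matrix (Fin m) (Fin m) ℝ}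
    (h : FactorLayer μ W E U Γχ ΓW F c C lam R) (hc : 0 < c) (hlam0 : 0 ≤ lam) (t : ℕ) :
    ∫⁻ ω, ENNReal.ofReal (‖Uᵀ * E t ω‖ ^ 2) ∂μ ≤ ENNReal.ofReal (lam * (r * (C * m))) := by
  refine (h.error_bound t U).trans (ENNReal.ofReal_le_ofReal ?_)
  refine mul_le_mul_of_nonneg_left ?_ hlam0
  obtain ⟨V, hV, hU, -⟩ := h.pca
  rw [hU]
  exact hV.norm_loadings_sq_le
    (fun j => le_trans (mul_nonneg hc.le (Nat.cast_nonneg m)) (h.le_eig j)) h.eig_le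

lemma FactorLayer.lintegral_error_le {m : ℕ} {W E : ℕ → Ω → Tensor3 N m}
    {U : Matrix (Fin m) (Fin r) ℝ} {Γχ ΓW : Matrix (Fin m) (Fin m) ℝ}
    (h : FactorLayer μ W E U Γχ ΓW F c C lam R) (t : ℕ) :
    ∫⁻ ω, ENNReal.ofReal (‖E t ω‖ ^ 2) ∂μ ≤ ENNReal.ofReal (lam * m) := by
  have h1 := h.error_bound t (1 : Matrix (Fin m) (Fin m) ℝ)
  have h2 : ‖(1 : Matrix (Fin m) (Fin m) ℝ)‖ ^ 2 = m := by
    rw [frobenius_norm_sq]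
    simp [Matrix.one_apply, ite_pow]
  rw [h2] at h1
  simpa only [Matrix.transpose_one, Matrix.one_mul] using h1

/-- Two of the three terms are the loading error times something bounded in probability. The third,
`U'E / m`, is of order `m^{-1/2}`, which makes this rate slower in `m` than that of the loadings. -/
lemma isBigOp_factorsHat_sub (hc : 0 < c) (hlam0 : 0 ≤ lam)
    (hEmeas : ∀ m t, Measurable (E m t)) (hFmeas : ∀ t, Measurable (F t))
    (hF2 : ∀ t, SqIntegrable μ (F t))
    (hL : ∀ᶠ m in atTop, FactorLayer μ (W m) (E m) (U m) (Γχ m) (ΓW m) F c C lam R)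
    (hVhat : ∀ m T ω, r < m →
      IsTopEigenvectors (sampleMoment (fun t => W m t ω) T) (Vhat m T ω))
    (hJ : ∀ m T ω k, J m T ω k = 1 ∨ J m T ω k = -1)
    (hJL : IsBigOp μ (loadingError W U Vhat J) loadingRate (atTop ×ˢ atTop)) (t : ℕ) :
    IsBigOp μ (fun (p : ℕ × ℕ) ω =>
      factorsHat (fun s => W p.1 s ω) (Vhat p.1 p.2 ω) p.2 t -
        Matrix.diagonal (J p.1 p.2 ω) * F t ω) factorRate (atTop ×ˢ atTop) := by
  have hpos : ∀ᶠ p : ℕ × ℕ in atTop ×ˢ atTop, (0 : ℝ) < p.1 := by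
    filter_upwards [eventually_fst (eventually_gt_atTop 0)] with p hp
    exact_mod_cast hp
  have hrate : ∀ᶠ p in (atTop : Filter ℕ) ×ˢ (atTop : Filter ℕ),
      0 ≤ loadingRate p * 1 ∧ loadingRate p * 1 ≤ 1 * factorRate p := by
    filter_upwards [loadingRate_le_factorRate] with p hp
    rw [mul_one, one_mul]
    exact ⟨loadingRate_nonneg p, hp⟩
  have hF1 : IsBigOp μ (fun (_ : ℕ × ℕ) ω => ‖F t ω‖) (fun _ => 1) (atTop ×ˢ atTop) := by
    refine IsBigOp.of_sq (isBigOp_of_lintegral_le (C := ∑ i, crossMoment μ (F t) (F t) i i)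
      (.of_forall fun _ => by norm_num)
      (.of_forall fun _ => (measurable_norm_sq (hFmeas t)).aemeasurable)
      (.of_forall fun _ _ => sq_nonneg _) (.of_forall fun _ => ?_)) (.of_forall fun _ => zero_le_one)
    rw [one_pow, mul_one]
    exact (hF2 t).lintegral_norm_sq.le
  have hUE : IsBigOp μ (fun (p : ℕ × ℕ) ω => (p.1 : ℝ)⁻¹ * ‖(U p.1)ᵀ * E p.1 t ω‖) factorRate
      (atTop ×ˢ atTop) := by
    refine IsBigOp.mono_rate (a := fun p : ℕ × ℕ => (√(p.1 : ℝ))⁻¹) (C := 1) ?_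
      (.of_forall fun p => ⟨by positivity, by rw [one_mul]; exact le_max_right _ _⟩)
    refine IsBigOp.of_sq (isBigOp_of_lintegral_le (C := lam * (r * C)) ?_
      (.of_forall fun p => (((measurable_norm (measurable_const_mul (hEmeas p.1 t)
        (U p.1)ᵀ)).const_mul _).pow_const 2).aemeasurable)
      (.of_forall fun _ _ => sq_nonneg _) ?_) (.of_forall fun _ => by positivity)
    · filter_upwards [hpos] with p hp
      positivity
    · filter_upwards [eventually_fst hL, hpos] with p h hp
      simp only [mul_pow]
      simp only [ENNReal.ofReal_mul (p := ((p.1 : ℝ)⁻¹) ^ 2) (by positivity)]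
      rw [lintegral_const_mul' _ _ ENNReal.ofReal_ne_top]
      refine (mul_le_mul_right (h.lintegral_loadings_mul_error_le hc hlam0 t) _).trans_eq ?_
      rw [← ENNReal.ofReal_mul (by positivity), inv_pow, inv_pow, Real.sq_sqrt hp.le]
      congr 1
      field_simp
  have hE1 : IsBigOp μ (fun (p : ℕ × ℕ) ω => (√(p.1 : ℝ))⁻¹ * ‖E p.1 t ω‖) (fun _ => 1)
      (atTop ×ˢ atTop) := by
    refine IsBigOp.of_sq (isBigOp_of_lintegral_le (C := lam) (.of_forall fun _ => by norm_num)
      (.of_forall fun p => (((measurable_norm (hEmeas p.1 t)).const_mul _).pow_const 2).aemeasurable)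
      (.of_forall fun _ _ => sq_nonneg _) ?_) (.of_forall fun _ => zero_le_one)
    filter_upwards [eventually_fst hL, hpos] with p h hp
    simp only [mul_pow]
    simp only [ENNReal.ofReal_mul (p := ((√(p.1 : ℝ))⁻¹) ^ 2) (by positivity)]
    rw [lintegral_const_mul' _ _ ENNReal.ofReal_ne_top]
    refine (mul_le_mul_right (h.lintegral_error_le t) _).trans_eq ?_
    rw [← ENNReal.ofReal_mul (by positivity), inv_pow, Real.sq_sqrt hp.le]
    congr 1
    field_simp
  have hsum := ((((hJL.mul hF1).mono_rate hrate).add hUE).add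
    ((hJL.mul hE1).mono_rate hrate)).const_mul (r ^ 3 * (√(2 / c) + 2 / c))
  refine hsum.of_norm_le (tendsto_measure_badEvent hc hlam0 hL) ?_
  filter_upwards [eventually_fst hL] with p h ω hω
  have h1 := norm_factor_sub_le_loadingError hc hlam0 h hω (hVhat p.1 p.2 ω h.lt) hJ
    (1 : Matrix (Fin N × Fin N) (Fin N × Fin N) ℝ) t
  simp only [Matrix.mul_one] at h1
  exact h1.trans (le_abs_self _)

end FactorEstimation

/-! ### Mean-square error of the estimated regressors. -/

section RegressorEstimation

variable {Ω : Type*} [MeasurableSpace Ω] {μ : Measure Ω} {N r : ℕ}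
  {W E : (m : ℕ) → ℕ → Ω → Tensor3 N m} {U : (m : ℕ) → Matrix (Fin m) (Fin r) ℝ}
  {Γχ ΓW : (m : ℕ) → Matrix (Fin m) (Fin m) ℝ} {F : ℕ → Ω → Tensor3 N r} {c C lam R : ℝ}
  {Vhat : (m : ℕ) → ℕ → Ω → Matrix (Fin m) (Fin r) ℝ} {J : ℕ → ℕ → Ω → Fin r → ℝ}
  {y : ℕ → Ω → Fin N → ℝ}

/-- Mean square of the error of the estimated regressors, after the choice `J` of signs. -/
noncomputable def regressorError (W : (m : ℕ) → ℕ → Ω → Tensor3 N m) (F : ℕ → Ω → Tensor3 N r)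
    (y : ℕ → Ω → Fin N → ℝ) (Vhat : (m : ℕ) → ℕ → Ω → Matrix (Fin m) (Fin r) ℝ)
    (J : ℕ → ℕ → Ω → Fin r → ℝ) (p : ℕ × ℕ) (ω : Ω) : ℝ :=
  (p.2 : ℝ)⁻¹ * ∑ t ∈ Finset.Icc 1 p.2,
    ‖Xhat (fun s => W p.1 s ω) (fun s => y s ω) (Vhat p.1 p.2 ω) p.2 t -
      scaleCols (X (fun s => F s ω) (fun s => y s ω) t) (extendSign (J p.1 p.2 ω))‖ ^ 2

/-- Independence factors the expectation, so second moments suffice. -/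
lemma lintegral_norm_sq_mul_norm_sq_le {ι κ π π' : Type*} [Fintype ι] [Fintype κ] [Fintype π]
    [Fintype π'] {A : Ω → Matrix ι π ℝ} {B : Ω → Matrix κ π' ℝ} (hA : Measurable A)
    (hB : Measurable B) (hAB : IndepFun B A μ) {a b : ℝ}
    (ha0 : 0 ≤ a) (ha : ∫⁻ ω, ENNReal.ofReal (‖A ω‖ ^ 2) ∂μ ≤ ENNReal.ofReal a)
    (hb : ∫⁻ ω, ENNReal.ofReal (‖B ω‖ ^ 2) ∂μ ≤ ENNReal.ofReal b) :
    ∫⁻ ω, ENNReal.ofReal (‖A ω‖ ^ 2 * ‖B ω‖ ^ 2) ∂μ ≤ ENNReal.ofReal (a * b) := by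
  have hmA : Measurable fun A' : Matrix ι π ℝ => ENNReal.ofReal (‖A'‖ ^ 2) :=
    (measurable_norm_sq measurable_id).ennreal_ofReal
  have hmB : Measurable fun B' : Matrix κ π' ℝ => ENNReal.ofReal (‖B'‖ ^ 2) :=
    (measurable_norm_sq measurable_id).ennreal_ofReal
  have h := lintegral_mul_eq_lintegral_mul_lintegral_of_indepFun'' (hmA.comp hA).aemeasurable
    (hmB.comp hB).aemeasurable (hAB.symm.comp hmA hmB)
  simp only [Function.comp_apply] at h
  simp only [ENNReal.ofReal_mul (sq_nonneg _)]
  rw [h, ENNReal.ofReal_mul ha0]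
  exact mul_le_mul' ha hb

lemma measurable_X (hFmeas : ∀ t, Measurable (F t)) (hymeas : ∀ t, Measurable (y t)) (t : ℕ) :
    Measurable fun ω => X (fun s => F s ω) (fun s => y s ω) t := by
  have hyj : ∀ j, Measurable fun ω => y (t - 1) ω j := fun j =>
    (measurable_pi_apply j).comp (hymeas (t - 1))
  refine measurable_of_entries fun i p => ?_
  rcases p with k | k | k
  · simp only [X, regressor, Matrix.fromCols_apply_inl, Matrix.of_apply, Matrix.mulVec, dotProduct,
      slice]
    exact Finset.measurable_sum _ fun j _ => (measurable_entry (hFmeas (t - 1)) k (i, j)).mul (hyj j)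
  · simp only [X, regressor, Matrix.fromCols_apply_inl, Matrix.fromCols_apply_inr,
      Matrix.diagonal_apply]
    by_cases h : i = k
    · simpa only [h, if_true] using hyj k
    · simp only [h, if_false]; exact measurable_const
  · simp only [X, regressor, Matrix.fromCols_apply_inr]
    exact measurable_const

lemma isBigOp_average {f : (ℕ × ℕ) → ℕ → Ω → ℝ} {K : ℝ}
    (hm : ∀ p t, Measurable (f p t)) (h0 : ∀ p t ω, 0 ≤ f p t ω)
    (h : ∀ᶠ p in atTop ×ˢ atTop, ∀ t, 1 ≤ t →
      ∫⁻ ω, ENNReal.ofReal (f p t ω) ∂μ ≤ ENNReal.ofReal K) :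
    IsBigOp μ (fun (p : ℕ × ℕ) ω => (p.2 : ℝ)⁻¹ * ∑ t ∈ Finset.Icc 1 p.2, f p t ω) (fun _ => 1)
      (atTop ×ˢ atTop) := by
  refine isBigOp_of_lintegral_le (C := K) (.of_forall fun _ => one_pos)
    (.of_forall fun p => ((Finset.measurable_sum _ fun t _ => hm p t).const_mul _).aemeasurable)
    (.of_forall fun p ω => mul_nonneg (by positivity) (Finset.sum_nonneg fun t _ => h0 p t ω)) ?_
  filter_upwards [h] with p hp
  rw [mul_one]
  exact lintegral_ofReal_average_le (fun t _ => hm p t) (h0 p)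
    fun t ht => hp t (Finset.mem_Icc.1 ht).1

omit [MeasurableSpace Ω] in
lemma norm_sliceMul_sq_le (t : ℕ) (ω : Ω) :
    ‖sliceMul (y t ω)‖ ^ 2 ≤ N * ‖X (fun s => F s ω) (fun s => y s ω) (t + 1)‖ ^ 2 := by
  rw [norm_sliceMul_sq]
  exact mul_le_mul_of_nonneg_left (dotProduct_self_le_norm_regressor_sq (F t ω) (y t ω))
    (Nat.cast_nonneg N)

/-- The form matters: `loadingError ^ 2` and the outer `m⁻¹` do not depend on `t` and leave the time
average, and what remains has expectation bounded uniformly in `t` and `m`. The regressors at `t`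
use factors at `t - 1`, hence the shift in the errors. -/
lemma sq_regressor_error_le (hc : 0 < c) (hlam0 : 0 ≤ lam) {p : ℕ × ℕ} {ω : Ω}
    (h : FactorLayer μ (W p.1) (E p.1) (U p.1) (Γχ p.1) (ΓW p.1) F c C lam R)
    (hω : ω ∉ badEvent W E U ΓW F c lam p)
    (hVhat : IsTopEigenvectors (sampleMoment (fun t => W p.1 t ω) p.2) (Vhat p.1 p.2 ω))
    (hJ : ∀ m T ω k, J m T ω k = 1 ∨ J m T ω k = -1) (t : ℕ) (ht : 1 ≤ t) :
    ‖Xhat (fun s => W p.1 s ω) (fun s => y s ω) (Vhat p.1 p.2 ω) p.2 t -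
      scaleCols (X (fun s => F s ω) (fun s => y s ω) t) (extendSign (J p.1 p.2 ω))‖ ^ 2 ≤
      3 * (r ^ 3 * (√(2 / c) + 2 / c)) ^ 2 * (N + 1) *
        (loadingError W U Vhat J p ω ^ 2 * ‖X (fun s => F s ω) (fun s => y s ω) t‖ ^ 2 +
        (p.1 : ℝ)⁻¹ * ((p.1 : ℝ)⁻¹ * (‖(U p.1)ᵀ * E p.1 (t - 1) ω‖ ^ 2 *
          ‖X (fun s => F s ω) (fun s => y s ω) t‖ ^ 2)) +
        loadingError W U Vhat J p ω ^ 2 * ((p.1 : ℝ)⁻¹ * (‖E p.1 (t - 1) ω‖ ^ 2 *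
          ‖X (fun s => F s ω) (fun s => y s ω) t‖ ^ 2))) := by
  obtain ⟨t, rfl⟩ := Nat.exists_eq_add_of_le' ht
  have hm : (0 : ℝ) < p.1 := by exact_mod_cast (Nat.zero_le r).trans_lt h.lt
  have h1 := norm_factor_sub_le_loadingError hc hlam0 h hω hVhat hJ (sliceMul (y t ω)) t
  rw [← norm_regressor_sub_scaleCols] at h1
  change ‖regressor (factorsHat (fun s => W p.1 s ω) (Vhat p.1 p.2 ω) p.2 t) (y t ω) -
    scaleCols (regressor (F t ω) (y t ω)) (extendSign (J p.1 p.2 ω))‖ ^ 2 ≤ _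
  refine (pow_le_pow_left₀ (norm_nonneg _) h1 2).trans ?_
  rw [mul_pow, Nat.add_sub_cancel]
  have hK0 : 0 ≤ (r ^ 3 * (√(2 / c) + 2 / c)) ^ 2 := sq_nonneg _
  set K := (r ^ 3 * (√(2 / c) + 2 / c)) ^ 2
  set l := loadingError W U Vhat J p ω
  set x := ‖X (fun s => F s ω) (fun s => y s ω) (t + 1)‖ with hx
  set k := ‖sliceMul (y t ω)‖ with hk
  have hkx : k ^ 2 ≤ N * x ^ 2 := norm_sliceMul_sq_le t ω
  have hN : (0 : ℝ) ≤ N := Nat.cast_nonneg N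
  -- The common factor `N + 1` covers the constant `1` here and the constant `N` from `sliceMul` in
  -- the two noise terms.
  have f1 : ‖F t ω * sliceMul (y t ω)‖ ^ 2 ≤ (N + 1) * x ^ 2 := by
    have : ‖F t ω * sliceMul (y t ω)‖ ^ 2 ≤ x ^ 2 :=
      pow_le_pow_left₀ (norm_nonneg _) (norm_mul_sliceMul_le (F t ω) (y t ω)) 2
    nlinarith [sq_nonneg x]
  have f2 : ‖(U p.1)ᵀ * (E p.1 t ω * sliceMul (y t ω))‖ ^ 2 ≤
      ‖(U p.1)ᵀ * E p.1 t ω‖ ^ 2 * ((N + 1) * x ^ 2) := by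
    rw [← Matrix.mul_assoc]
    refine (pow_le_pow_left₀ (norm_nonneg _) (Matrix.frobenius_norm_mul _ _) 2).trans ?_
    rw [mul_pow]
    exact mul_le_mul_of_nonneg_left (by nlinarith [sq_nonneg x]) (sq_nonneg _)
  have f3 : ‖E p.1 t ω * sliceMul (y t ω)‖ ^ 2 ≤ ‖E p.1 t ω‖ ^ 2 * ((N + 1) * x ^ 2) := by
    refine (pow_le_pow_left₀ (norm_nonneg _) (Matrix.frobenius_norm_mul _ _) 2).trans ?_
    rw [mul_pow]
    exact mul_le_mul_of_nonneg_left (by nlinarith [sq_nonneg x]) (sq_nonneg _)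
  have h3 : ∀ a b d : ℝ, (a + b + d) ^ 2 ≤ 3 * (a ^ 2 + b ^ 2 + d ^ 2) := fun a b d => by
    nlinarith [sq_nonneg (a - b), sq_nonneg (a - d), sq_nonneg (b - d)]
  have g1 := mul_le_mul_of_nonneg_left f1 (sq_nonneg l)
  have g2 := mul_le_mul_of_nonneg_left f2 (sq_nonneg (p.1 : ℝ)⁻¹)
  have g3 := mul_le_mul_of_nonneg_left f3 (mul_nonneg (sq_nonneg l) (inv_nonneg.2 hm.le))
  have hs : ((√(p.1 : ℝ))⁻¹) ^ 2 = (p.1 : ℝ)⁻¹ := by rw [inv_pow, Real.sq_sqrt hm.le]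
  calc _ ≤ K * (3 * ((l * ‖F t ω * sliceMul (y t ω)‖) ^ 2 +
        ((p.1 : ℝ)⁻¹ * ‖(U p.1)ᵀ * (E p.1 t ω * sliceMul (y t ω))‖) ^ 2 +
        (l * ((√(p.1 : ℝ))⁻¹ * ‖E p.1 t ω * sliceMul (y t ω)‖)) ^ 2)) :=
        mul_le_mul_of_nonneg_left (h3 _ _ _) hK0
    _ = 3 * K * (l ^ 2 * ‖F t ω * sliceMul (y t ω)‖ ^ 2 +
        (p.1 : ℝ)⁻¹ ^ 2 * ‖(U p.1)ᵀ * (E p.1 t ω * sliceMul (y t ω))‖ ^ 2 +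
        l ^ 2 * (p.1 : ℝ)⁻¹ * ‖E p.1 t ω * sliceMul (y t ω)‖ ^ 2) := by
        rw [← hs]; ring
    _ ≤ 3 * K * (l ^ 2 * ((N + 1) * x ^ 2) +
        (p.1 : ℝ)⁻¹ ^ 2 * (‖(U p.1)ᵀ * E p.1 t ω‖ ^ 2 * ((N + 1) * x ^ 2)) +
        l ^ 2 * (p.1 : ℝ)⁻¹ * (‖E p.1 t ω‖ ^ 2 * ((N + 1) * x ^ 2))) :=
        mul_le_mul_of_nonneg_left (add_le_add (add_le_add g1 g2) g3) (by positivity)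
    _ = _ := by ring

/-- The loading error depends on the whole sample and need not be independent of anything. It is
therefore kept outside the averages, and independence is applied only to products of `E` at one date
with the regressors at the next. -/
lemma isBigOp_regressorError (hc : 0 < c) (hC : 0 < C) (hlam0 : 0 ≤ lam)
    (hEmeas : ∀ m t, Measurable (E m t)) (hFmeas : ∀ t, Measurable (F t))
    (hymeas : ∀ t, Measurable (y t))
    (hL : ∀ᶠ m in atTop, FactorLayer μ (W m) (E m) (U m) (Γχ m) (ΓW m) F c C lam R)
    {M : ℝ} (hX2 : ∀ t, 1 ≤ t → ∫⁻ ω, ENNReal.ofReal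
      (‖X (fun s => F s ω) (fun s => y s ω) t‖ ^ 2) ∂μ ≤ ENNReal.ofReal M)
    (hindX : ∀ᶠ m in atTop, ∀ t s, 1 ≤ t →
      IndepFun (fun ω => X (fun s => F s ω) (fun s => y s ω) t) (E m s) μ)
    (hVhat : ∀ m T ω, r < m →
      IsTopEigenvectors (sampleMoment (fun t => W m t ω) T) (Vhat m T ω))
    (hJ : ∀ m T ω k, J m T ω k = 1 ∨ J m T ω k = -1)
    (hJL : IsBigOp μ (loadingError W U Vhat J) loadingRate (atTop ×ˢ atTop)) :
    IsBigOp μ (regressorError W F y Vhat J) (fun p => factorRate p ^ 2) (atTop ×ˢ atTop) := by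
  have hXm := measurable_X hFmeas hymeas
  have hA1 : IsBigOp μ (fun (p : ℕ × ℕ) ω => (p.2 : ℝ)⁻¹ * ∑ t ∈ Finset.Icc 1 p.2,
      ‖X (fun s => F s ω) (fun s => y s ω) t‖ ^ 2) (fun _ => 1) (atTop ×ˢ atTop) :=
    isBigOp_average (f := fun _ t ω => ‖X (fun s => F s ω) (fun s => y s ω) t‖ ^ 2) (K := M)
      (fun _ t => measurable_norm_sq (hXm t)) (fun _ _ _ => sq_nonneg _) (.of_forall fun _ => hX2)
  have hA2 : IsBigOp μ (fun (p : ℕ × ℕ) ω => (p.2 : ℝ)⁻¹ * ∑ t ∈ Finset.Icc 1 p.2,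
      (p.1 : ℝ)⁻¹ * (‖(U p.1)ᵀ * E p.1 (t - 1) ω‖ ^ 2 *
        ‖X (fun s => F s ω) (fun s => y s ω) t‖ ^ 2)) (fun _ => 1) (atTop ×ˢ atTop) := by
    refine isBigOp_average (f := fun (p : ℕ × ℕ) t ω => (p.1 : ℝ)⁻¹ *
      (‖(U p.1)ᵀ * E p.1 (t - 1) ω‖ ^ 2 * ‖X (fun s => F s ω) (fun s => y s ω) t‖ ^ 2))
      (K := lam * (r * C) * M)
      (fun p t => ((measurable_norm_sq (measurable_const_mul (hEmeas p.1 (t - 1)) _)).mul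
        (measurable_norm_sq (hXm t))).const_mul _) (fun _ _ _ => by positivity) ?_
    filter_upwards [eventually_fst hL, eventually_fst hindX] with p h hind t ht
    have hm : (0 : ℝ) < p.1 := by exact_mod_cast (Nat.zero_le r).trans_lt h.lt
    simp only [ENNReal.ofReal_mul (inv_nonneg.2 hm.le)]
    rw [lintegral_const_mul' _ _ ENNReal.ofReal_ne_top]
    refine (mul_le_mul_right (lintegral_norm_sq_mul_norm_sq_le
      (measurable_const_mul (hEmeas p.1 (t - 1)) (U p.1)ᵀ) (hXm t)
      ((hind t (t - 1) ht).comp measurable_id (measurable_const_mul measurable_id (U p.1)ᵀ))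
      (by positivity)
      (h.lintegral_loadings_mul_error_le hc hlam0 (t - 1)) (hX2 t ht)) _).trans_eq ?_
    rw [← ENNReal.ofReal_mul (by positivity)]
    congr 1
    field_simp
  have hA3 : IsBigOp μ (fun (p : ℕ × ℕ) ω => (p.2 : ℝ)⁻¹ * ∑ t ∈ Finset.Icc 1 p.2,
      (p.1 : ℝ)⁻¹ * (‖E p.1 (t - 1) ω‖ ^ 2 *
        ‖X (fun s => F s ω) (fun s => y s ω) t‖ ^ 2)) (fun _ => 1) (atTop ×ˢ atTop) := by
    refine isBigOp_average (f := fun (p : ℕ × ℕ) t ω => (p.1 : ℝ)⁻¹ *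
      (‖E p.1 (t - 1) ω‖ ^ 2 * ‖X (fun s => F s ω) (fun s => y s ω) t‖ ^ 2))
      (K := lam * M)
      (fun p t => ((measurable_norm_sq (hEmeas p.1 (t - 1))).mul
        (measurable_norm_sq (hXm t))).const_mul _) (fun _ _ _ => by positivity) ?_
    filter_upwards [eventually_fst hL, eventually_fst hindX] with p h hind t ht
    have hm : (0 : ℝ) < p.1 := by exact_mod_cast (Nat.zero_le r).trans_lt h.lt
    simp only [ENNReal.ofReal_mul (inv_nonneg.2 hm.le)]
    rw [lintegral_const_mul' _ _ ENNReal.ofReal_ne_top]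
    refine (mul_le_mul_right (lintegral_norm_sq_mul_norm_sq_le (hEmeas p.1 (t - 1)) (hXm t)
      (hind t (t - 1) ht) (a := lam * p.1) (by positivity) (h.lintegral_error_le (t - 1))
      (hX2 t ht)) _).trans_eq ?_
    rw [← ENNReal.ofReal_mul (by positivity)]
    congr 1
    field_simp
  have hl2 : IsBigOp μ (fun p ω => loadingError W U Vhat J p ω ^ 2) (fun p => factorRate p ^ 2)
      (atTop ×ˢ atTop) := by
    simp only [sq]
    refine (hJL.mul hJL).mono_rate (C := 1) ?_
    filter_upwards [loadingRate_le_factorRate] with p hp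
    have h0 := loadingRate_nonneg p
    rw [one_mul]
    exact ⟨mul_self_nonneg _, mul_self_le_mul_self h0 hp⟩
  have hone : ∀ᶠ p in (atTop : Filter ℕ) ×ˢ (atTop : Filter ℕ),
      0 ≤ factorRate p ^ 2 * 1 ∧ factorRate p ^ 2 * 1 ≤ 1 * factorRate p ^ 2 :=
    .of_forall fun p => by rw [mul_one, one_mul]; exact ⟨sq_nonneg _, le_rfl⟩
  have hminv : IsBigOp μ (fun (p : ℕ × ℕ) (_ : Ω) => (p.1 : ℝ)⁻¹) (fun p => factorRate p ^ 2)
      (atTop ×ˢ atTop) := by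
    refine isBigOp_const μ (C := 1) (.of_forall fun p => ?_)
    rw [Real.norm_eq_abs, abs_of_nonneg (by positivity), one_mul]
    have h1 := pow_le_pow_left₀ (by positivity) (le_max_right (√(p.2 : ℝ))⁻¹ (√(p.1 : ℝ))⁻¹) 2
    rwa [inv_pow, Real.sq_sqrt (Nat.cast_nonneg _)] at h1
  have hsum := ((((hl2.mul hA1).mono_rate hone).add ((hminv.mul hA2).mono_rate hone)).add
    ((hl2.mul hA3).mono_rate hone)).const_mul (3 * (r ^ 3 * (√(2 / c) + 2 / c)) ^ 2 * (N + 1))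
  refine hsum.of_norm_le (tendsto_measure_badEvent hc hlam0 hL) ?_
  filter_upwards [eventually_fst hL] with p h ω hω
  refine abs_le_abs_of_nonneg (by unfold regressorError; positivity) ?_
  unfold regressorError
  refine (mul_le_mul_of_nonneg_left (Finset.sum_le_sum fun t ht =>
    sq_regressor_error_le hc hlam0 h hω (hVhat p.1 p.2 ω h.lt) hJ t (Finset.mem_Icc.1 ht).1)
    (by positivity)).trans_eq ?_
  rw [← Finset.mul_sum, Finset.sum_add_distrib, Finset.sum_add_distrib, ← Finset.mul_sum,
    ← Finset.mul_sum (f := fun t => (p.1 : ℝ)⁻¹ * (‖(U p.1)ᵀ * E p.1 (t - 1) ω‖ ^ 2 *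
        ‖X (fun s => F s ω) (fun s => y s ω) t‖ ^ 2)),
    ← Finset.mul_sum (f := fun t => (p.1 : ℝ)⁻¹ * (‖E p.1 (t - 1) ω‖ ^ 2 *
        ‖X (fun s => F s ω) (fun s => y s ω) t‖ ^ 2))]
  ring

end RegressorEstimation

/-! ### Consistency of the regression on estimated factors. -/

section Regression

variable {Ω : Type*} [MeasurableSpace Ω] {μ : Measure Ω} {N r : ℕ}

lemma X_mulVec_param (F : ℕ → Tensor3 N r) (y : ℕ → Fin N → ℝ) (t : ℕ) (β : Fin r → ℝ)
    (ρ α : Fin N → ℝ) :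
    X F y t *ᵥ param β ρ α = ∑ k, β k • (slice (F (t - 1)) k *ᵥ y (t - 1)) +
      Matrix.diagonal ρ *ᵥ y (t - 1) + α := by
  unfold X regressor param
  rw [Matrix.fromCols_mulVec_sumElim, Matrix.fromCols_mulVec_sumElim, Matrix.one_mulVec, ← add_assoc]
  congr 2
  · ext i
    simp only [Matrix.mulVec, dotProduct, Matrix.of_apply, Finset.sum_apply, Pi.smul_apply,
      smul_eq_mul]
    exact Finset.sum_congr rfl fun k _ => mul_comm _ _
  · ext i
    rw [Matrix.mulVec_diagonal, Matrix.mulVec_diagonal, mul_comm]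

lemma extendSign_mul_thetaStar {J : Fin r → ℝ} (hJ : ∀ k, J k = 1 ∨ J k = -1) (β : Fin r → ℝ)
    (ρ α : Fin N → ℝ) : extendSign J * thetaStar β ρ α J = param β ρ α := by
  ext p
  rcases p with k | k | k
  · have h : J k * J k = 1 := extendSign_sq (N := N) hJ (Sum.inl k)
    simp only [extendSign, thetaStar, param, Pi.mul_apply, Sum.elim_inl, Matrix.vecMul_diagonal]
    linear_combination β k * h
  · simp [extendSign, thetaStar, param]
  · simp [extendSign, thetaStar, param]

lemma norm_thetaStar {J : Fin r → ℝ} (hJ : ∀ k, J k = 1 ∨ J k = -1) (β : Fin r → ℝ)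
    (ρ α : Fin N → ℝ) :
    ‖WithLp.toLp 2 (thetaStar β ρ α J)‖ = ‖WithLp.toLp 2 (param β ρ α)‖ := by
  refine (sq_eq_sq₀ (norm_nonneg _) (norm_nonneg _)).1 ?_
  rw [norm_toLp_sq, norm_toLp_sq, ← extendSign_mul_thetaStar hJ β ρ α,
    dotProduct_sign_mul (extendSign_sq hJ)]

/-- Moments of the noise come from the model itself: `ν = y - Xθ`, and `y` at date `t` is a block of
the regressors at `t + 1`. -/
lemma norm_noise_sq_le {F : ℕ → Tensor3 N r} {y ν : ℕ → Fin N → ℝ} {θ : Param r N → ℝ} {t : ℕ}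
    (h : y t = X F y t *ᵥ θ + ν t) :
    ‖WithLp.toLp 2 (ν t)‖ ^ 2 ≤
      2 * ‖X F y (t + 1)‖ ^ 2 + 2 * ‖WithLp.toLp 2 θ‖ ^ 2 * ‖X F y t‖ ^ 2 := by
  have h1 : ν t = y t + -(X F y t *ᵥ θ) := by rw [h]; abel
  have h2 := dotProduct_self_add_le (y t) (-(X F y t *ᵥ θ))
  rw [← h1, neg_dotProduct_neg] at h2
  have h3 := dotProduct_self_le_norm_regressor_sq (F t) (y t)
  have h4 := pow_le_pow_left₀ (norm_nonneg _) (norm_toLp_mulVec_le (X F y t) θ) 2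
  rw [norm_toLp_sq, mul_pow] at h4
  rw [norm_toLp_sq]
  have h5 : ‖X F y (t + 1)‖ = ‖regressor (F t) (y t)‖ := rfl
  rw [h5]
  linarith

/-- Consistency is stated in the sup norm of functions, the least-squares bound in the Euclidean
norm. -/
lemma norm_le_norm_toLp {ι : Type*} [Fintype ι] (x : ι → ℝ) : ‖x‖ ≤ ‖WithLp.toLp 2 x‖ :=
  (pi_norm_le_iff_of_nonneg (norm_nonneg _)).2 fun i => PiLp.norm_apply_le (WithLp.toLp 2 x) i

/-- If an event is, up to asymptotically negligible sets, contained in events of arbitrarily small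
asymptotic probability, then it is asymptotically negligible. -/
lemma tendsto_measure_zero_of_subset_union {S : ℕ × ℕ → Set Ω} {A : ℝ → ℕ → Set Ω}
    {B : ℝ → ℕ × ℕ → Set Ω}
    (hA : ∀ ε : ℝ, 0 < ε → ∃ c : ℝ, 0 < c ∧ ∀ᶠ T : ℕ in atTop, μ (A c T) ≤ ENNReal.ofReal ε)
    (hB : ∀ c : ℝ, 0 < c → Tendsto (fun p => μ (B c p)) (atTop ×ˢ atTop) (𝓝 0))
    (hS : ∀ c : ℝ, 0 < c → ∀ᶠ p in atTop ×ˢ atTop, S p ⊆ A c p.2 ∪ B c p) :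
    Tendsto (fun p => μ (S p)) (atTop ×ˢ atTop) (𝓝 0) := by
  refine ENNReal.tendsto_nhds_zero.2 fun ε hε => ?_
  rcases eq_or_ne ε ⊤ with rfl | htop
  · simp
  have hε' : 0 < ε.toReal := ENNReal.toReal_pos hε.ne' htop
  obtain ⟨c, hc, hAc⟩ := hA (ε.toReal / 2) (by positivity)
  have hBc := ENNReal.tendsto_nhds_zero.1 (hB c hc) (ENNReal.ofReal (ε.toReal / 2))
    (by simpa using hε')
  filter_upwards [eventually_snd hAc, hBc, hS c hc] with p h1 h2 h3
  calc μ (S p) ≤ μ (A c p.2) + μ (B c p) := (measure_mono h3).trans (measure_union_le _ _)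
    _ ≤ ENNReal.ofReal (ε.toReal / 2) + ENNReal.ofReal (ε.toReal / 2) := add_le_add h1 h2
    _ = ε := by
        rw [← ENNReal.ofReal_add (by positivity) (by positivity), add_halves,
          ENNReal.ofReal_toReal htop]

variable {W : (m : ℕ) → ℕ → Ω → Tensor3 N m} {F : ℕ → Ω → Tensor3 N r}
  {y ν : ℕ → Ω → Fin N → ℝ} {β : Fin r → ℝ} {ρ α : Fin N → ℝ}
  {Vhat : (m : ℕ) → ℕ → Ω → Matrix (Fin m) (Fin r) ℝ} {J : ℕ → ℕ → Ω → Fin r → ℝ}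

/-- The event that the true regressors are too close to collinear. -/
def collinearEvent (F : ℕ → Ω → Tensor3 N r) (y : ℕ → Ω → Fin N → ℝ) (c : ℝ) (T : ℕ) : Set Ω :=
  {ω | ¬ ∀ v : Param r N → ℝ, c * (v ⬝ᵥ v) ≤
    v ⬝ᵥ (((T : ℝ)⁻¹ • gram (X (fun s => F s ω) (fun s => y s ω)) T) *ᵥ v)}

omit [MeasurableSpace Ω] in
lemma le_gram_of_notMem_collinearEvent {c : ℝ} {T : ℕ} {ω : Ω} (h : ω ∉ collinearEvent F y c T)
    (v : Param r N → ℝ) : c * (v ⬝ᵥ v) ≤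
      (T : ℝ)⁻¹ * (v ⬝ᵥ (gram (X (fun s => F s ω) (fun s => y s ω)) T *ᵥ v)) := by
  have h1 : ∀ v : Param r N → ℝ, c * (v ⬝ᵥ v) ≤
      v ⬝ᵥ (((T : ℝ)⁻¹ • gram (X (fun s => F s ω) (fun s => y s ω)) T) *ᵥ v) := by
    by_contra hne
    exact h hne
  have h2 := h1 v
  rwa [Matrix.smul_mulVec, dotProduct_smul, smul_eq_mul] at h2

/-- Non-collinearity survives a mean-square error below `c / 4`. The constant `c` depends on the
tolerated probability `ε`, which is why `tendsto_measure_zero_of_subset_union` is needed. -/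
lemma tendsto_measure_not_isUnit_gram
    (hrank : ∀ ε : ℝ, 0 < ε → ∃ c : ℝ, 0 < c ∧ ∀ᶠ T : ℕ in atTop,
      μ (collinearEvent F y c T) ≤ ENNReal.ofReal ε)
    (hJ : ∀ m T ω k, J m T ω k = 1 ∨ J m T ω k = -1)
    (herr : IsBigOp μ (regressorError W F y Vhat J) (fun p => factorRate p ^ 2)
      (atTop ×ˢ atTop)) :
    Tendsto (fun p : ℕ × ℕ => μ {ω | ¬ IsUnit (gram
      (Xhat (fun s => W p.1 s ω) (fun s => y s ω) (Vhat p.1 p.2 ω) p.2) p.2).det})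
      (atTop ×ˢ atTop) (𝓝 0) := by
  have hrate : Tendsto (fun p => factorRate p ^ 2) (atTop ×ˢ atTop) (𝓝 0) := by
    simpa using tendsto_factorRate.pow 2
  refine tendsto_measure_zero_of_subset_union hrank
    (B := fun c p => {ω | c / 4 ≤ ‖regressorError W F y Vhat J p ω‖})
    (fun c hc => herr.tendsto_measure_le hrate (by positivity))
    (fun c hc => .of_forall fun p ω hω => ?_)
  by_contra hn
  rw [Set.mem_union, not_or] at hn
  refine hω (isUnit_det_gram (c := c / 4) (by positivity) (le_gram_of_meanSquare_le
    (extendSign_sq (hJ p.1 p.2 ω)) (le_gram_of_notMem_collinearEvent hn.1) ?_))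
  exact (le_abs_self _).trans (not_le.1 hn.2).le

/-- Dividing by `T` instead of `√T` turns tightness into the rate `T^{-1/2}`. -/
lemma isBigOp_score
    (hscore : IsBigOp μ (fun (T : ℕ) ω => WithLp.toLp 2 ((√(T : ℝ))⁻¹ • ∑ t ∈ Finset.Icc 1 T,
      (X (fun s => F s ω) (fun s => y s ω) t)ᵀ *ᵥ ν t ω)) (fun _ => 1) atTop) :
    IsBigOp μ (fun (p : ℕ × ℕ) ω => (p.2 : ℝ)⁻¹ * ‖WithLp.toLp 2 (∑ t ∈ Finset.Icc 1 p.2,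
      (X (fun s => F s ω) (fun s => y s ω) t)ᵀ *ᵥ ν t ω)‖) factorRate (atTop ×ˢ atTop) := by
  set Z : ℕ → Ω → Param r N → ℝ := fun T ω => ∑ t ∈ Finset.Icc 1 T,
    (X (fun s => F s ω) (fun s => y s ω) t)ᵀ *ᵥ ν t ω
  change IsBigOp μ (fun (p : ℕ × ℕ) ω => (p.2 : ℝ)⁻¹ * ‖WithLp.toLp 2 (Z p.2 ω)‖) factorRate _
  have h0 : IsBigOp μ (fun (T : ℕ) ω => WithLp.toLp 2 ((√(T : ℝ))⁻¹ • Z T ω)) (fun _ => 1) atTop :=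
    hscore
  clear_value Z
  have h1 : IsBigOp μ (fun (p : ℕ × ℕ) ω => ‖WithLp.toLp 2 ((√(p.2 : ℝ))⁻¹ • Z p.2 ω)‖)
      (fun _ => 1) ((atTop : Filter ℕ) ×ˢ (atTop : Filter ℕ)) :=
    (h0.comp_tendsto (tendsto_snd (f := (atTop : Filter ℕ)))).of_norm_le (B := fun _ => ∅)
      (by simp) (.of_forall fun p ω _ => (norm_norm _).le)
  have h2 : IsBigOp μ (fun (p : ℕ × ℕ) (_ : Ω) => (√(p.2 : ℝ))⁻¹) factorRate
      ((atTop : Filter ℕ) ×ˢ (atTop : Filter ℕ)) := by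
    refine isBigOp_const μ (C := 1) (.of_forall fun p => ?_)
    rw [Real.norm_eq_abs, abs_of_nonneg (by positivity), one_mul]
    exact le_max_left _ _
  refine IsBigOp.mono_rate (C := 1) ((h2.mul h1).of_norm_le (B := fun _ => ∅)
    (by simp) (.of_forall fun p ω _ => ?_))
    (.of_forall fun p => by rw [mul_one, one_mul]; exact ⟨factorRate_nonneg p, le_rfl⟩)
  refine le_of_eq ?_
  congr 1
  rw [WithLp.toLp_smul, norm_smul, Real.norm_eq_abs, abs_of_nonneg (by positivity), ← mul_assoc,
    ← mul_inv, Real.mul_self_sqrt (Nat.cast_nonneg _)]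

lemma isBigOp_noise
    (hFmeas : ∀ t, Measurable (F t)) (hymeas : ∀ t, Measurable (y t))
    (hmodel : ∀ᵐ ω ∂μ, ∀ t, 1 ≤ t →
      y t ω = X (fun s => F s ω) (fun s => y s ω) t *ᵥ param β ρ α + ν t ω)
    {M : ℝ} (hM : 0 ≤ M) (hX2 : ∀ t, 1 ≤ t → ∫⁻ ω, ENNReal.ofReal
      (‖X (fun s => F s ω) (fun s => y s ω) t‖ ^ 2) ∂μ ≤ ENNReal.ofReal M) :
    IsBigOp μ (fun (p : ℕ × ℕ) ω => (p.2 : ℝ)⁻¹ * ∑ t ∈ Finset.Icc 1 p.2,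
      ‖WithLp.toLp 2 (ν t ω)‖ ^ 2) (fun _ => 1) (atTop ×ˢ atTop) := by
  have hXm := measurable_X hFmeas hymeas
  set q := ‖WithLp.toLp 2 (param β ρ α)‖ with hq
  have h1 := isBigOp_average (μ := μ) (f := fun _ t ω =>
    2 * ‖X (fun s => F s ω) (fun s => y s ω) (t + 1)‖ ^ 2 +
      2 * q ^ 2 * ‖X (fun s => F s ω) (fun s => y s ω) t‖ ^ 2) (K := 2 * M + 2 * q ^ 2 * M)
    (fun _ t => ((measurable_norm_sq (hXm (t + 1))).const_mul _).add
      ((measurable_norm_sq (hXm t)).const_mul _)) (fun _ _ _ => by positivity)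
    (.of_forall fun _ t ht => by
      simp only [ENNReal.ofReal_add (mul_nonneg zero_le_two (sq_nonneg _))
        (mul_nonneg (mul_nonneg zero_le_two (sq_nonneg q)) (sq_nonneg _))]
      rw [lintegral_add_left ((measurable_norm_sq (hXm (t + 1))).const_mul _).ennreal_ofReal,
        ENNReal.ofReal_add (by positivity) (by positivity)]
      simp only [ENNReal.ofReal_mul zero_le_two,
        ENNReal.ofReal_mul (mul_nonneg zero_le_two (sq_nonneg q))]
      rw [lintegral_const_mul' _ _ ENNReal.ofReal_ne_top,
        lintegral_const_mul' _ _ (ENNReal.mul_ne_top ENNReal.ofReal_ne_top ENNReal.ofReal_ne_top)]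
      exact add_le_add (mul_le_mul_right (hX2 (t + 1) (by omega)) _)
        (mul_le_mul_right (hX2 t ht) _))
  refine h1.of_norm_le (B := fun _ => {ω | ¬ ∀ t, 1 ≤ t →
    y t ω = X (fun s => F s ω) (fun s => y s ω) t *ᵥ param β ρ α + ν t ω})
    (by simp only [ae_iff.1 hmodel]; exact tendsto_const_nhds)
    (.of_forall fun p ω hω => ?_)
  have hω' : ∀ t, 1 ≤ t →
      y t ω = X (fun s => F s ω) (fun s => y s ω) t *ᵥ param β ρ α + ν t ω := by
    by_contra hne; exact hω hne
  refine abs_le_abs_of_nonneg (by positivity) ?_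
  refine mul_le_mul_of_nonneg_left (Finset.sum_le_sum fun t ht => ?_) (by positivity)
  exact norm_noise_sq_le (F := fun s => F s ω) (y := fun s => y s ω) (ν := fun s => ν s ω)
    (hω' t (Finset.mem_Icc.1 ht).1)

/-- Consistency of least squares on the estimated regressors. -/
lemma tendstoInMeasure_thetaHat_sub [IsProbabilityMeasure μ]
    (hFmeas : ∀ t, Measurable (F t)) (hymeas : ∀ t, Measurable (y t))
    (hmodel : ∀ᵐ ω ∂μ, ∀ t, 1 ≤ t →
      y t ω = X (fun s => F s ω) (fun s => y s ω) t *ᵥ param β ρ α + ν t ω)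
    {M : ℝ} (hM : 0 ≤ M) (hX2 : ∀ t, 1 ≤ t → ∫⁻ ω, ENNReal.ofReal
      (‖X (fun s => F s ω) (fun s => y s ω) t‖ ^ 2) ∂μ ≤ ENNReal.ofReal M)
    (hscore : IsBigOp μ (fun (T : ℕ) ω => WithLp.toLp 2 ((√(T : ℝ))⁻¹ • ∑ t ∈ Finset.Icc 1 T,
      (X (fun s => F s ω) (fun s => y s ω) t)ᵀ *ᵥ ν t ω)) (fun _ => 1) atTop)
    (hrank : ∀ ε : ℝ, 0 < ε → ∃ c : ℝ, 0 < c ∧ ∀ᶠ T : ℕ in atTop,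
      μ (collinearEvent F y c T) ≤ ENNReal.ofReal ε)
    (hJ : ∀ m T ω k, J m T ω k = 1 ∨ J m T ω k = -1)
    (herr : IsBigOp μ (regressorError W F y Vhat J) (fun p => factorRate p ^ 2)
      (atTop ×ˢ atTop)) :
    TendstoInMeasure μ (fun (p : ℕ × ℕ) ω =>
      thetaHat (fun s => W p.1 s ω) (fun s => y s ω) (Vhat p.1 p.2 ω) p.2 -
        thetaStar β ρ α (J p.1 p.2 ω)) (atTop ×ˢ atTop) (fun _ => 0) := by
  have hXm := measurable_X hFmeas hymeas
  set q := ‖WithLp.toLp 2 (param β ρ α)‖ with hq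
  set Bad : Set Ω := {ω | ¬ ∀ t, 1 ≤ t →
    y t ω = X (fun s => F s ω) (fun s => y s ω) t *ᵥ param β ρ α + ν t ω} with hBad
  have hBad0 : μ Bad = 0 := ae_iff.1 hmodel
  set S : ℕ × ℕ → Ω → ℝ := fun p ω => (p.2 : ℝ)⁻¹ *
    ‖WithLp.toLp 2 (∑ t ∈ Finset.Icc 1 p.2,
      (X (fun s => F s ω) (fun s => y s ω) t)ᵀ *ᵥ ν t ω)‖ with hS
  set n : ℕ × ℕ → Ω → ℝ := fun p ω => (p.2 : ℝ)⁻¹ * ∑ t ∈ Finset.Icc 1 p.2,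
    ‖WithLp.toLp 2 (ν t ω)‖ ^ 2 with hn
  set x : ℕ × ℕ → Ω → ℝ := fun p ω => (p.2 : ℝ)⁻¹ * ∑ t ∈ Finset.Icc 1 p.2,
    ‖X (fun s => F s ω) (fun s => y s ω) t‖ ^ 2 with hx
  set a := regressorError W F y Vhat J with ha
  have hS1 : IsBigOp μ S factorRate (atTop ×ˢ atTop) := isBigOp_score hscore
  have hx1 : IsBigOp μ x (fun _ => (1 : ℝ) ^ 2) (atTop ×ˢ atTop) := by
    rw [one_pow]
    exact isBigOp_average (f := fun _ t ω => ‖X (fun s => F s ω) (fun s => y s ω) t‖ ^ 2)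
      (fun _ t => measurable_norm_sq (hXm t)) (fun _ _ _ => sq_nonneg _) (.of_forall fun _ => hX2)
  have hn1 : IsBigOp μ n (fun _ => (1 : ℝ) ^ 2) (atTop ×ˢ atTop) := by
    rw [one_pow]
    exact isBigOp_noise hFmeas hymeas hmodel hM hX2
  have hasq := herr.sqrt (.of_forall factorRate_nonneg)
  have hone := (.of_forall fun _ => zero_le_one :
    ∀ᶠ p : ℕ × ℕ in (atTop : Filter ℕ) ×ˢ (atTop : Filter ℕ), (0 : ℝ) ≤ 1)
  have hr1 : ∀ᶠ p in (atTop : Filter ℕ) ×ˢ (atTop : Filter ℕ),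
      0 ≤ factorRate p * 1 ∧ factorRate p * 1 ≤ 1 * factorRate p :=
    .of_forall fun p => by rw [mul_one, one_mul]; exact ⟨factorRate_nonneg p, le_rfl⟩
  have ha1 : IsBigOp μ a factorRate (atTop ×ˢ atTop) := by
    refine herr.mono_rate (C := 1) ?_
    filter_upwards [tendsto_factorRate.eventually_lt_const zero_lt_one] with p hp
    have h0 := factorRate_nonneg p
    exact ⟨sq_nonneg _, by nlinarith⟩
  have hQ : IsBigOp μ (fun p ω => S p ω + √(a p ω) * √(n p ω) +
      q * (a p ω + √(a p ω) * √(x p ω))) factorRate (atTop ×ˢ atTop) :=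
    (hS1.add ((hasq.mul (hn1.sqrt hone)).mono_rate hr1)).add
      ((ha1.add ((hasq.mul (hx1.sqrt hone)).mono_rate hr1)).const_mul q)
  rw [tendstoInMeasure_iff_norm]
  intro η hη
  -- The threshold `c / 4` keeps the estimated Gram matrix bounded below. The threshold `η * c / 8`,
  -- multiplied by the factor `4 / c` of `norm_ols_sub_le`, gives `η / 2 < η`.
  refine tendsto_measure_zero_of_subset_union hrank
    (B := fun c p => ({ω | c / 4 ≤ ‖a p ω‖} ∪ {ω | η * c / 8 ≤ ‖S p ω + √(a p ω) * √(n p ω) +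
      q * (a p ω + √(a p ω) * √(x p ω))‖}) ∪ Bad) (fun c hc => ?_)
    (fun c hc => .of_forall fun p ω hω => ?_)
  · have h1 := ha1.tendsto_measure_le tendsto_factorRate (δ := c / 4) (by positivity)
    have h2 := hQ.tendsto_measure_le tendsto_factorRate (δ := η * c / 8) (by positivity)
    have h3 := h1.add h2
    rw [add_zero] at h3
    refine tendsto_of_tendsto_of_tendsto_of_le_of_le tendsto_const_nhds h3 (fun _ => zero_le)
      fun p => ?_
    refine (measure_union_le _ _).trans ?_
    rw [hBad0, add_zero]
    exact measure_union_le _ _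
  · by_contra hn'
    simp only [Set.mem_union, not_or] at hn'
    obtain ⟨hcol, ⟨h1, h2⟩, h3⟩ := hn'
    have hω' : ∀ t, 1 ≤ t →
        y t ω = X (fun s => F s ω) (fun s => y s ω) t *ᵥ param β ρ α + ν t ω := by
      by_contra hne; exact h3 hne
    have h4 := norm_ols_sub_le (extendSign_sq (hJ p.1 p.2 ω)) hc
      (le_gram_of_notMem_collinearEvent hcol) (a := a p ω) rfl
      ((le_abs_self _).trans (not_le.1 h1).le) (fun s => y s ω) (fun s => ν s ω)
      (thetaStar β ρ α (J p.1 p.2 ω)) (fun t ht => by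
        rw [scaleCols_mulVec, extendSign_mul_thetaStar (hJ p.1 p.2 ω)]
        exact hω' t (Finset.mem_Icc.1 ht).1)
    rw [norm_thetaStar (hJ p.1 p.2 ω), ← hq, mul_comm _ q] at h4
    have h5 : S p ω + √(a p ω) * √(n p ω) + q * (a p ω + √(a p ω) * √(x p ω)) < η * c / 8 :=
      (le_abs_self _).trans_lt (not_le.1 h2)
    have h6 : η ≤ ‖thetaHat (fun s => W p.1 s ω) (fun s => y s ω) (Vhat p.1 p.2 ω) p.2 -
        thetaStar β ρ α (J p.1 p.2 ω)‖ := by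
      have h := hω
      simp only [sub_zero, Set.mem_ofPred_eq] at h
      exact h
    have h7 := h6.trans ((norm_le_norm_toLp _).trans h4)
    have h8 := h7.trans (mul_le_mul_of_nonneg_left h5.le (by positivity : 0 ≤ 4 / c))
    have h9 : 4 / c * (η * c / 8) = η / 2 := by field_simp; norm_num
    rw [h9] at h8
    linarith

end Regression

end FNAR

/-! ### Assembly of the main theorem. -/

theorem proposition2
    {Ω : Type*} [MeasurableSpace Ω] (μ : Measure Ω) [IsProbabilityMeasure μ]
    (N r : ℕ)
    -- observed tensors, common components, idiosyncratic errors, loadings, for `m` layers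
    (W χ E : (m : ℕ) → ℕ → Ω → FNAR.Tensor3 N m)
    (U Vχ : (m : ℕ) → Matrix (Fin m) (Fin r) ℝ)
    (Γχ ΓW : (m : ℕ) → Matrix (Fin m) (Fin m) ℝ)
    -- factors, observed series, errors and parameters of the autoregression
    (F : ℕ → Ω → FNAR.Tensor3 N r) (y ν : ℕ → Ω → Fin N → ℝ)
    (β : Fin r → ℝ) (ρ α : Fin N → ℝ)
    (hEmeas : ∀ m t, Measurable (E m t)) (hFmeas : ∀ t, Measurable (F t))
    (hymeas : ∀ t, Measurable (y t)) (hνmeas : ∀ t, Measurable (ν t))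
    (hF2 : ∀ t k p, MemLp (fun ω => F t ω k p) 2 μ)
    -- the factor decomposition of the weight tensors
    (hWF : ∀ᶠ m in atTop, ∀ t, ∀ᵐ ω ∂μ, W m t ω = U m * F t ω + E m t ω)
    -- common components, and factors as their normalized principal components
    (hWχ : ∀ᶠ m in atTop, ∀ t, ∀ᵐ ω ∂μ, W m t ω = χ m t ω + E m t ω)
    (hΓχ : ∀ᶠ m in atTop, ∀ t, FNAR.crossMoment μ (χ m t) (χ m t) = Γχ m)
    (hVχ : ∀ᶠ m in atTop, FNAR.IsTopEigenvectors (Γχ m) (Vχ m))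
    (hF : ∀ᶠ m in atTop, ∀ t, ∀ᵐ ω ∂μ,
      F t ω = FNAR.eigInvSqrt r (Γχ m) * (Vχ m)ᵀ * χ m t ω)
    (hU : ∀ᶠ m in atTop, U m = Vχ m * FNAR.eigSqrt r (Γχ m))
    -- moments of the idiosyncratic errors
    (hE0 : ∀ᶠ m in atTop, ∀ t k p, ∫ ω, E m t ω k p ∂μ = 0)
    (hE4 : ∀ᶠ m in atTop, ∀ t, Integrable (fun ω => ‖E m t ω‖ ^ 4) μ)
    -- errors and factors are uncorrelated along the third mode
    (hEF : ∀ᶠ m in atTop, ∀ t, FNAR.crossMoment μ (E m t) (F t) = 0)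
    -- pervasiveness of the common factors
    (cund cbar : Fin r → ℝ)
    (hsep : ∀ i j : Fin r, (i : ℕ) + 1 = (j : ℕ) → cbar j < cund i)
    (hperv : ∀ j : Fin r, 0 < cund j ∧
      ((cund j : ℝ) : EReal) <
        liminf (fun m : ℕ => ((FNAR.eig (Γχ m) j / (m : ℝ) : ℝ) : EReal)) atTop ∧
      limsup (fun m : ℕ => ((FNAR.eig (Γχ m) j / (m : ℝ) : ℝ) : EReal)) atTop <
        ((cbar j : ℝ) : EReal))
    -- non-pervasiveness of the idiosyncratic components
    (lam : ℝ)
    (hlam : ∀ᶠ m in atTop, ∀ t, FNAR.eig (FNAR.crossMoment μ (E m t) (E m t)) 0 ≤ lam)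
    -- convergence of the sample covariance
    (hΓW : ∀ᶠ m in atTop, ∀ t, FNAR.crossMoment μ (W m t) (W m t) = ΓW m)
    (R : ℝ)
    (hR : ∀ᶠ m in atTop, ∀ T : ℕ, 1 ≤ T → ∀ i j : Fin m,
      Integrable (fun ω => (FNAR.sampleMoment (fun t => W m t ω) T i j - ΓW m i j) ^ 2) μ ∧
      (T : ℝ) * ∫ ω, (FNAR.sampleMoment (fun t => W m t ω) T i j - ΓW m i j) ^ 2 ∂μ < R)
    -- the factor network autoregression
    (hFNAR : ∀ t, 1 ≤ t → ∀ᵐ ω ∂μ,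
      y t ω = ∑ k, β k • (FNAR.slice (F (t - 1) ω) k *ᵥ y (t - 1) ω)
        + Matrix.diagonal ρ *ᵥ y (t - 1) ω + α + ν t ω)
    -- bounded eighth moments of the regressors
    (M : ℝ)
    (hX8 : ∀ t, 1 ≤ t →
      Integrable (fun ω => ‖FNAR.X (fun s => F s ω) (fun s => y s ω) t‖ ^ 8) μ ∧
      ∫ ω, ‖FNAR.X (fun s => F s ω) (fun s => y s ω) t‖ ^ 8 ∂μ ≤ M)
    -- central limit theorem for the scores
    (S : Matrix (FNAR.Param r N) (FNAR.Param r N) ℝ) (hS : S.PosSemidef)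
    (hSplim : ∀ a b, TendstoInMeasure μ
      (fun (T : ℕ) ω => ((T : ℝ)⁻¹ • ∑ t ∈ Finset.Icc 1 T,
        (FNAR.X (fun s => F s ω) (fun s => y s ω) t)ᵀ * Matrix.vecMulVec (ν t ω) (ν t ω) *
          FNAR.X (fun s => F s ω) (fun s => y s ω) t) a b)
      atTop (fun _ => S a b))
    (hCLT : TendstoInDistribution
      (fun (T : ℕ) ω => WithLp.toLp 2 ((√(T : ℝ))⁻¹ • ∑ t ∈ Finset.Icc 1 T,
        (FNAR.X (fun s => F s ω) (fun s => y s ω) t)ᵀ *ᵥ ν t ω))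
      atTop (id : EuclideanSpace ℝ (FNAR.Param r N) → EuclideanSpace ℝ (FNAR.Param r N))
      (fun _ => μ) (multivariateGaussian 0 S))
    -- exogeneity, and independence of the layer errors
    (hexog : ∀ t, 1 ≤ t → ∀ i,
      μ[fun ω => ν t ω i | MeasurableSpace.comap
        (fun ω => FNAR.X (fun s => F s ω) (fun s => y s ω) t) inferInstance] =ᵐ[μ] 0)
    (hindX : ∀ᶠ m in atTop, ∀ t s, 1 ≤ t →
      IndepFun (fun ω => FNAR.X (fun s => F s ω) (fun s => y s ω) t) (E m s) μ)
    (hindν : ∀ᶠ m in atTop, ∀ t s, 1 ≤ t → IndepFun (ν t) (E m s) μ)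
    -- the true regressors are not asymptotically collinear
    (hrank : ∀ ε : ℝ, 0 < ε → ∃ c : ℝ, 0 < c ∧ ∀ᶠ T : ℕ in atTop,
      μ {ω | ¬ ∀ v : FNAR.Param r N → ℝ, c * (v ⬝ᵥ v) ≤
        v ⬝ᵥ (((T : ℝ)⁻¹ • FNAR.gram (FNAR.X (fun s => F s ω) (fun s => y s ω)) T) *ᵥ v)}
        ≤ ENNReal.ofReal ε)
    -- eigenvectors of the sample second moment, used in the estimated factors
    (Vhat : (m : ℕ) → ℕ → Ω → Matrix (Fin m) (Fin r) ℝ)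
    (hVhat : ∀ m T ω, r < m →
      FNAR.IsTopEigenvectors (FNAR.sampleMoment (fun t => W m t ω) T) (Vhat m T ω)) :
    (∃ J, FNAR.IsSignMatrix μ W U F Vhat J) ∧
    Tendsto (fun p : ℕ × ℕ => μ {ω | ¬ IsUnit (FNAR.gram
      (FNAR.Xhat (fun s => W p.1 s ω) (fun s => y s ω) (Vhat p.1 p.2 ω) p.2) p.2).det})
      (atTop ×ˢ atTop) (𝓝 0) ∧
    ∀ J, FNAR.IsSignMatrix μ W U F Vhat J →
      TendstoInMeasure μ
        (fun (p : ℕ × ℕ) ω =>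
          FNAR.thetaHat (fun s => W p.1 s ω) (fun s => y s ω) (Vhat p.1 p.2 ω) p.2 -
            FNAR.thetaStar β ρ α (J p.1 p.2 ω))
        (atTop ×ˢ atTop) (fun _ => 0) := by
  have hlam' : ∀ᶠ m in atTop, ∀ t, FNAR.eig (FNAR.crossMoment μ (E m t) (E m t)) 0 ≤ |lam| :=
    hlam.mono fun m h t => (h t).trans (le_abs_self lam)
  have hFL : ∀ t, FNAR.SqIntegrable μ (F t) := hF2
  obtain ⟨c, C, hc, hC, hbounds⟩ := FNAR.exists_eventually_eig_bounds Γχ cund cbar hsep hperv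
  have hL : ∀ᶠ m in atTop,
      FNAR.FactorLayer μ (W m) (E m) (U m) (Γχ m) (ΓW m) F c C |lam| R := by
    filter_upwards [hWF, hWχ, hΓχ, hVχ, hF, hU, hE4, hEF, hlam', hΓW, hR, hbounds,
      eventually_gt_atTop r] with m h1 h2 h3 h4 h5 h6 h7 h8 h9 h10 h11 h12 h13
    exact FNAR.factorLayer_of_model (hEmeas m) hFL h1 h2 h3 h4 h5 h6 h7 h8 h9 (abs_nonneg lam) h10
      h11 hc h13 h12.1 h12.2.1 h12.2.2
  have hX2 : ∀ t, 1 ≤ t → ∫⁻ ω, ENNReal.ofReal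
      (‖FNAR.X (fun s => F s ω) (fun s => y s ω) t‖ ^ 2) ∂μ ≤ ENNReal.ofReal (1 + |M|) :=
    fun t ht => FNAR.lintegral_norm_sq_le_of_pow_eight (hX8 t ht).1
      ((hX8 t ht).2.trans (le_abs_self M))
  have hmodel : ∀ᵐ ω ∂μ, ∀ t, 1 ≤ t → y t ω =
      FNAR.X (fun s => F s ω) (fun s => y s ω) t *ᵥ FNAR.param β ρ α + ν t ω := by
    refine ae_all_iff.2 fun t => ?_
    by_cases ht : 1 ≤ t
    · filter_upwards [hFNAR t ht] with ω hω _
      rw [FNAR.X_mulVec_param]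
      exact hω
    · exact .of_forall fun ω h => absurd h ht
  have hscore := FNAR.isBigOp_one_of_tendstoInDistribution hCLT
  have herr : ∀ J : ℕ → ℕ → Ω → Fin r → ℝ, (∀ m T ω k, J m T ω k = 1 ∨ J m T ω k = -1) →
      FNAR.IsBigOp μ (FNAR.loadingError W U Vhat J) FNAR.loadingRate (atTop ×ˢ atTop) →
      FNAR.IsBigOp μ (FNAR.regressorError W F y Vhat J) (fun p => FNAR.factorRate p ^ 2)
        (atTop ×ˢ atTop) := fun J hJ hJL =>
    FNAR.isBigOp_regressorError hc hC (abs_nonneg lam) hEmeas hFmeas hymeas hL hX2 hindX hVhat hJ hJL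
  obtain ⟨J₀, hJ₀, hJL₀⟩ := FNAR.exists_sign_isBigOp_loadingError hc hC (abs_nonneg lam) hL hVhat
  -- Invertibility does not mention signs, so the single choice `J₀` serves. For the last claim the
  -- regressor bound is rederived from the loading rate of the given `J`.
  refine ⟨⟨J₀, hJ₀, hJL₀, FNAR.isBigOp_factorsHat_sub hc (abs_nonneg lam) hEmeas hFmeas hFL hL hVhat
    hJ₀ hJL₀⟩, FNAR.tendsto_measure_not_isUnit_gram hrank hJ₀ (herr J₀ hJ₀ hJL₀), fun J hJ => ?_⟩
  exact FNAR.tendstoInMeasure_thetaHat_sub hFmeas hymeas hmodel (by positivity) hX2 hscore hrank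
    hJ.sign (herr J hJ.sign hJ.loadings)
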